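/- Let $c>\ell>0$ be integers, $2\le r\le\omega$, and let $\varphi$ be a $C^r$-diffeomorphism of $\mathbb R^c$ with a hyperbolic fixed point $p$ whose tangent space has a dominated $D\varphi(p)$-invariant splitting $\mathbb R^c=E^s\oplus E^{cu}\oplus E^{uu}$, where $E^s$ is the stable direction, $E^u=E^{cu}\oplus E^{uu}$ the unstable direction ($E^s$ or $E^{cu}$ may be trivial), and $\dim E^{uu}=\ell$. Let $G(\ell,c)$ be the Grassmannian of $\ell$-planes of $\mathbb R^c$ with the metric $\|P_F-P_{F'}\|$ ($P_F$ the orthogonal projection onto $F$), $\hat M=\mathbb R^c\times G(\ell,c)$, and for a diffeomorphism $\psi$ of $\mathbb R^c$ let $\hat\psi(x,F)=(\psi(x),D\psi(x)F)$ be the induced bijection of $\hat M$. Definitions. For bijections $f_1,\dots,f_d$ of $M$ ($M=\mathbb R^c$ or $\hat M$), $d\ge 2$, let $\Phi(\xi,x)=(\tau\xi,f_{\xi_0}(x))$ be the one-step skew-product on $\{1,\dots,d\}^{\mathbb Z}\times M$, $\tau$ the shift. Let $B,D\subset M$ be bounded open sets with $\overline B\subset D$. Then $B$ is a *$cs$-blending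 region of $cs$-index $k\geq 1$ on $D$ with respect to $\{f_1,\dots,f_d\}$* if the $f_i^{\pm1}$ are locally Lipschitz, $\overline B\subset\bigcup_i f_i(B)$, and the maximal invariant set $\Gamma=\bigcap_{n\in\mathbb Z}\Phi^n(\{1,\dots,d\}^{\mathbb Z}\times\overline D)$ is contained in $\{1,\dots,d\}^{\mathbb Z}\times D$, transitive (some point of $\Gamma$ has a forward orbit dense in $\Gamma$) and hyperbolic of index $k$: $\Gamma$ is compact, and over $\Gamma$ the tangent spaces of the fibres split, invariantly under the derivatives of the fibre maps, as a uniformly contracted subspace of dimension $k$ and a uniformly expanded one. An *$\ell$-cone* is a set $\mathcal C=\{v:\ \|(Sv)_2\|\le\|(Sv)_1\|\}$ for a linear isomorphism $S:\mathbb R^c\to\mathbb R^\ell\times\mathbb R^{c-\ell}$; a plane belongs to $\mathcal C$ if it is contained in it. It is *unstable* for diffeomorphisms $\varphi_i$ over $B$ if, for all $x\in B$ and all $i$, $D\varphi_i(x)$ maps $\mathcal C\setminus\{0\}$ into the interior of $\mathcal C$ and expands the vectors of $\mathcal C$ by a factor at least $\theta>1$ in some fixed Euclidean norm ($\theta$ and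 the norm not depending on $x$ and $i$). A $cs$-blending region $B$ for $\{\varphi_i\}$ has *$\ell$-tangency $\hat B$* if $\hat B\subset B\times\mathcal C$ for an unstable $\ell$-cone $\mathcal C$ for $\{\varphi_i\}$ over $B$, and $\hat B$ is a $cs$-blending region for $\{\hat\varphi_i\}$ on some bounded open $\hat D\subset\hat M$. For $0<\kappa<1$ (the base contraction rate $\nu^\alpha$), a one-step skew-product is *in $\mathcal{PHS}$ with rate $\kappa$* if there are $\gamma,\hat\gamma\in(\kappa,1)$ with $\gamma\,d(x,y)<d(f_ix,f_iy)<\hat\gamma^{-1}d(x,y)$ for all $i$ and $x\ne y$. Proposition. There are an $\ell$-cone $\mathcal C^{uu}$ with $E^{uu}\setminus\{0\}\subset\operatorname{int}\mathcal C^{uu}$, an integer $d\ge2$, orthogonal matrices $A_i(\varepsilon)$ and vectors $c_i(\varepsilon)\in\mathbb R^c$, $i=1,\dots,d$, depending continuously on $\varepsilon\ge0$, such that the $C^r$-diffeomorphisms $\varphi_i=\varphi_i(\varepsilon)=A_i(\varepsilon)\,\varphi+c_i(\varepsilon)$ satisfy $\varphi_i(0)=\varphi$ and, for every $\varepsilon>0$: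 1. each $\hat\varphi_i$ is a homeomorphism of $\hat M$, locally Lipschitz together with its inverse; 2. there are a bounded open neighborhood $B$ of $p$ in $\mathbb R^c$ and an open neighborhood $G\subset\mathcal C^{uu}$ of $E^{uu}$ in $G(\ell,c)$ such that $\mathcal C^{uu}$ is an unstable $\ell$-cone for $\{\varphi_1,\dots,\varphi_d\}$ over $B$ and, with $\hat B=B\times G$, $$\overline{\hat B}\subset\bigcup_{i=1}^d\hat\varphi_i(\hat B);$$ moreover, if $E^s\neq\{0\}$, then $B$ is a $cs$-blending region of $cs$-index $\dim E^s$ with respect to $\{\varphi_1,\dots,\varphi_d\}$ (on some $D$), and $\hat B$ is an $\ell$-tangency of it with cone $\mathcal C^{uu}$; 3. if $\tau\times\varphi$ is in $\mathcal{PHS}$ with rate $\kappa$, so is $\tau\ltimes(\varphi_1,\dots,\varphi_d)$; and if $\tau\times\varphi$ is in $\mathcal{PHS}$ with some rate and $D\varphi$, $D\varphi^{-1}$ are Lipschitz, then $\tau\ltimes(\hat\varphi_1,\dots,\hat\varphi_d)$ is in $\mathcal{PHS}$ with some rate (in particular the $\hat\varphi_i$ are globally bi-Lipschitz). -/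

import Mathlib

open Set Filter Topology Asymptotics
open scoped NNReal Manifold ContDiff

noncomputable section

/-! ### The spaces `ℝ^c`, `G(ℓ,c)` and the maps induced by a diffeomorphism -/

/-- `ℝ^c` with its Euclidean norm. -/
abbrev Euc (c : ℕ) : Type := EuclideanSpace ℝ (Fin c)

/-- `C^r`-diffeomorphisms of `ℝ^c`. -/
abbrev EucDiffeo (c : ℕ) (r : WithTop ℕ∞) : Type :=
  Diffeomorph 𝓘(ℝ, Euc c) 𝓘(ℝ, Euc c) (Euc c) (Euc c) r

/-- The Grassmannian `G(ℓ,c)` of `ℓ`-dimensional linear subspaces of `ℝ^c`. -/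
def Gr (ℓ c : ℕ) : Type := {F : Submodule ℝ (Euc c) // Module.finrank ℝ F = ℓ}

namespace Gr

variable {ℓ c : ℕ}

/-- The usual embedding of the Grassmannian: a subspace goes to its orthogonal projection. -/
def proj (F : Gr ℓ c) : Euc c →L[ℝ] Euc c := F.1.starProjection

theorem proj_injective : Function.Injective (proj : Gr ℓ c → (Euc c →L[ℝ] Euc c)) := by
  intro F F' h
  exact Subtype.ext (Submodule.starProjection_inj.1 h)

/-- The gap metric `d(F, F') = ‖P_F - P_F'‖`. -/
instance : MetricSpace (Gr ℓ c) := MetricSpace.induced proj proj_injective inferInstance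

end Gr

/-- `(x, F) ↦ (x, P_F)`, which presents `ℝ^c × G(ℓ,c)` as an embedded submanifold of a
normed space. -/
def grEmb (ℓ c : ℕ) : Euc c × Gr ℓ c → Euc c × (Euc c →L[ℝ] Euc c) := fun z => (z.1, z.2.proj)

section Lift

variable {c : ℕ} {r : WithTop ℕ∞}

theorem EucDiffeo.fderiv_symm_comp (hr : 1 ≤ r) (φ : EucDiffeo c r) (x : Euc c) :
    (fderiv ℝ φ.symm (φ x)).comp (fderiv ℝ φ x) = ContinuousLinearMap.id ℝ (Euc c) := by
  have hr0 : r ≠ 0 := (zero_lt_one.trans_le hr).ne'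
  have h1 : DifferentiableAt ℝ φ x := φ.contDiff.differentiable hr0 x
  have h2 : DifferentiableAt ℝ φ.symm (φ x) := φ.symm.contDiff.differentiable hr0 _
  rw [← fderiv_comp x h2 h1]
  have : (φ.symm ∘ φ : Euc c → Euc c) = id := by
    funext y
    simp
  rw [this, fderiv_id]

theorem EucDiffeo.finrank_map (hr : 1 ≤ r) (φ : EucDiffeo c r) (x : Euc c)
    (F : Submodule ℝ (Euc c)) :
    Module.finrank ℝ (F.map (fderiv ℝ φ x : Euc c →ₗ[ℝ] Euc c)) = Module.finrank ℝ F := by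
  have hinj : Function.Injective (fderiv ℝ φ x : Euc c →ₗ[ℝ] Euc c) := by
    intro v w hvw
    have h := EucDiffeo.fderiv_symm_comp hr φ x
    have hv := DFunLike.congr_fun h v
    have hw := DFunLike.congr_fun h w
    simp only [ContinuousLinearMap.comp_apply, ContinuousLinearMap.id_apply] at hv hw
    rw [← hv, ← hw]
    exact congrArg _ hvw
  exact (Submodule.equivMapOfInjective _ hinj F).finrank_eq.symm

/-- The image `Dφ(x)F ∈ G(ℓ,c)` of a plane `F ∈ G(ℓ,c)`. -/
def EucDiffeo.pushPlane {ℓ : ℕ} (hr : 1 ≤ r) (φ : EucDiffeo c r) (x : Euc c) (F : Gr ℓ c) :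
    Gr ℓ c :=
  ⟨F.1.map (fderiv ℝ φ x : Euc c →ₗ[ℝ] Euc c), (EucDiffeo.finrank_map hr φ x F.1).trans F.2⟩

theorem EucDiffeo.pushPlane_symm {ℓ : ℕ} (hr : 1 ≤ r) (φ : EucDiffeo c r) (x : Euc c)
    (F : Gr ℓ c) :
    EucDiffeo.pushPlane hr φ.symm (φ x) (EucDiffeo.pushPlane hr φ x F) = F := by
  apply Subtype.ext
  show Submodule.map _ (Submodule.map _ F.1) = F.1
  rw [← Submodule.map_comp, ← ContinuousLinearMap.toLinearMap_comp,
    EucDiffeo.fderiv_symm_comp hr φ x]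
  exact Submodule.map_id _

/-- The induced bijection `φ̂(x, F) = (φ(x), Dφ(x)F)` of `ℝ^c × G(ℓ,c)`. -/
def EucDiffeo.hat (ℓ : ℕ) (hr : 1 ≤ r) (φ : EucDiffeo c r) : Equiv.Perm (Euc c × Gr ℓ c) where
  toFun z := (φ z.1, EucDiffeo.pushPlane hr φ z.1 z.2)
  invFun z := (φ.symm z.1, EucDiffeo.pushPlane hr φ.symm z.1 z.2)
  left_inv z := by
    refine Prod.ext (by simp) ?_
    exact EucDiffeo.pushPlane_symm hr φ z.1 z.2
  right_inv z := by
    refine Prod.ext (by simp) ?_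
    have h := EucDiffeo.pushPlane_symm hr φ.symm z.1 z.2
    exact h

/-- The diffeomorphism `x ↦ A φ(x) + b`, where `A` is a linear isometry (an orthogonal matrix). -/
def EucDiffeo.affineTwist (φ : EucDiffeo c r) (A : Euc c ≃ₗᵢ[ℝ] Euc c) (b : Euc c) :
    EucDiffeo c r where
  toEquiv := φ.toEquiv.trans (A.toEquiv.trans (Equiv.addRight b))
  contMDiff_toFun := by
    rw [contMDiff_iff_contDiff]
    exact (A.contDiff.comp φ.contDiff).add contDiff_const
  contMDiff_invFun := by
    rw [contMDiff_iff_contDiff]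
    exact φ.symm.contDiff.comp (A.symm.contDiff.comp (contDiff_id.add contDiff_const))

theorem EucDiffeo.affineTwist_apply (φ : EucDiffeo c r) (A : Euc c ≃ₗᵢ[ℝ] Euc c) (b x : Euc c) :
    φ.affineTwist A b x = A (φ x) + b := rfl

/-- The family `φ_i = A_i φ + b_i`. -/
def EucDiffeo.twists {𝒜 : Type*} (φ : EucDiffeo c r) (A : 𝒜 → (Euc c ≃ₗᵢ[ℝ] Euc c))
    (b : 𝒜 → Euc c) : 𝒜 → EucDiffeo c r :=
  fun i => φ.affineTwist (A i) (b i)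

/-- The family of induced maps `φ̂_i`. -/
def EucDiffeo.hats {𝒜 : Type*} (ℓ : ℕ) (hr : 1 ≤ r) (ψ : 𝒜 → EucDiffeo c r) :
    𝒜 → Equiv.Perm (Euc c × Gr ℓ c) :=
  fun i => (ψ i).hat ℓ hr

end Lift

/-! ### Symbolic one-step skew-products -/

section SkewProduct

variable {𝒜 M V : Type*}

/-- The shift `(τ ξ)_i = ξ_{i+1}` on bi-infinite sequences. -/
def shiftMap (𝒜 : Type*) : Equiv.Perm (ℤ → 𝒜) where
  toFun ξ i := ξ (i + 1)
  invFun ξ i := ξ (i - 1)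
  left_inv ξ := by funext i; simp
  right_inv ξ := by funext i; simp

/-- The one-step skew-product `Φ = τ ⋉ (f_i)`, `Φ(ξ, x) = (τ ξ, f_{ξ_0}(x))`. -/
def oneStep (f : 𝒜 → Equiv.Perm M) : Equiv.Perm ((ℤ → 𝒜) × M) where
  toFun z := (shiftMap 𝒜 z.1, f (z.1 0) z.2)
  invFun z := ((shiftMap 𝒜).symm z.1, (f (z.1 (-1))).symm z.2)
  left_inv z := by
    refine Prod.ext (by simp) ?_
    simp [shiftMap]
  right_inv z := by
    refine Prod.ext (by simp) ?_
    simp [shiftMap]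

/-- The maximal invariant set `⋂_{n ∈ ℤ} Φ^n (𝒜^ℤ × K)`. -/
def maxInvariant (f : 𝒜 → Equiv.Perm M) (K : Set M) : Set ((ℤ → 𝒜) × M) :=
  ⋂ n : ℤ, ⇑(oneStep f ^ n) '' (univ ×ˢ K)

/-- A set that contains a point whose forward orbit is dense in it. -/
def IsTransitiveSet [TopologicalSpace 𝒜] [TopologicalSpace M] (f : 𝒜 → Equiv.Perm M)
    (Γ : Set ((ℤ → 𝒜) × M)) : Prop :=
  ∃ z ∈ Γ, Γ ⊆ closure (range fun n : ℕ => (oneStep f ^ n) z)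

/-- `g` and its inverse are locally Lipschitz. -/
def IsLocallyBiLipschitz [PseudoEMetricSpace M] (g : Equiv.Perm M) : Prop :=
  LocallyLipschitz g ∧ LocallyLipschitz g.symm

/-- Partial hyperbolicity of the one-step skew-product with fibre maps `f_i`, where `κ = ν^α < 1`
is the contraction rate in the base:
`ν^α < γ < 1 < γ'⁻¹ < ν^{-α}` and `γ d(x,y) < d(f_i x, f_i y) < γ'⁻¹ d(x,y)` for `x ≠ y`. -/
def IsPHS [MetricSpace M] (κ : ℝ) (f : 𝒜 → Equiv.Perm M) : Prop :=
  0 < κ ∧ ∃ γ γ' : ℝ, κ < γ ∧ γ < 1 ∧ κ < γ' ∧ γ' < 1 ∧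
    ∀ i x y, x ≠ y → γ * dist x y < dist (f i x) (f i y) ∧ dist (f i x) (f i y) < γ'⁻¹ * dist x y

section Hyperbolic

variable [NormedAddCommGroup V] [NormedSpace ℝ V]

/-- The tangent space at `x` of the space `M` embedded in `V` by `ι`: velocities of curves. -/
def tangentVelocities (ι : M → V) (x : M) : Set V :=
  {v | ∃ g : ℝ → M, g 0 = x ∧ HasDerivAt (fun t => ι (g t)) v 0}

/-- `L` represents (on tangent vectors) the derivative at `x` of the map `g : M → M`,
where `M` is embedded in `V` by `ι`. -/
def IsEmbDeriv [TopologicalSpace M] (ι : M → V) (g : M → M) (x : M) (L : V →L[ℝ] V) : Prop :=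
  (fun y => ι (g y) - ι (g x) - L (ι y - ι x)) =o[𝓝 x] fun y => ι y - ι x

/-- The products `T(z_{n-1}) ⋯ T(z_1) T(z_0)` along the orbit `z_j = Φ^j(z)`. -/
def cocycle (f : 𝒜 → Equiv.Perm M) (T : (ℤ → 𝒜) × M → V →L[ℝ] V) :
    ℕ → (ℤ → 𝒜) × M → V →L[ℝ] V
  | 0, _ => ContinuousLinearMap.id ℝ V
  | n + 1, z => (T ((oneStep f ^ n) z)).comp (cocycle f T n z)

/-- The compact set `Γ`, invariant under `Φ = τ ⋉ (f_i)`, is hyperbolic of `cs`-index `k`: over `Γ`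
the tangent spaces of the fibres split as `E^s ⊕ E^u`, invariantly under the derivatives of the
fibre maps, with `E^s` of dimension `k` and uniformly contracted and `E^u` uniformly expanded
(the base shift is hyperbolic by itself). The fibre `M` is a manifold embedded in `V` by `ι`. -/
def IsHyperbolicSet [TopologicalSpace 𝒜] [TopologicalSpace M] (ι : M → V)
    (f : 𝒜 → Equiv.Perm M) (Γ : Set ((ℤ → 𝒜) × M)) (k : ℕ) : Prop :=
  IsCompact Γ ∧ oneStep f '' Γ = Γ ∧
  ∃ (T : (ℤ → 𝒜) × M → V →L[ℝ] V) (Es Eu : (ℤ → 𝒜) × M → Submodule ℝ V),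
    (∀ z ∈ Γ,
      IsEmbDeriv ι (f (z.1 0)) z.2 (T z) ∧
      ((Es z ⊔ Eu z : Submodule ℝ V) : Set V) = tangentVelocities ι z.2 ∧
      Disjoint (Es z) (Eu z) ∧
      Module.finrank ℝ (Es z) = k ∧
      (Es z).map (T z : V →ₗ[ℝ] V) = Es (oneStep f z) ∧
      (Eu z).map (T z : V →ₗ[ℝ] V) = Eu (oneStep f z)) ∧
    ∃ C > (0 : ℝ), ∃ θ : ℝ, 0 < θ ∧ θ < 1 ∧ ∀ z ∈ Γ, ∀ n : ℕ,
      (∀ v ∈ Es z, ‖cocycle f T n z v‖ ≤ C * θ ^ n * ‖v‖) ∧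
      (∀ v ∈ Eu z, ‖v‖ ≤ C * θ ^ n * ‖cocycle f T n z v‖)

/-- `B` is a `cs`-blending region of `cs`-index `k` on `D` with respect to the family `(f_i)`,
indexed by the whole alphabet. -/
structure IsCsBlendingRegion [TopologicalSpace 𝒜] [MetricSpace M] (ι : M → V)
    (f : 𝒜 → Equiv.Perm M) (B D : Set M) (k : ℕ) : Prop where
  locallyBiLipschitz : ∀ i, IsLocallyBiLipschitz (f i)
  isOpen_B : IsOpen B
  isOpen_D : IsOpen D
  isBounded_B : Bornology.IsBounded B
  isBounded_D : Bornology.IsBounded D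
  closure_subset : closure B ⊆ D
  /-- the `cs`-cover -/
  cover : closure B ⊆ ⋃ i, f i '' B
  /-- the maximal invariant set of the closure of `D` is isolated -/
  isolated : maxInvariant f (closure D) ⊆ univ ×ˢ D
  transitive : IsTransitiveSet f (maxInvariant f (closure D))
  hyperbolic : IsHyperbolicSet ι f (maxInvariant f (closure D)) k
  index_pos : 0 < k

end Hyperbolic

end SkewProduct

/-! ### Cones and tangencies -/

section Cones

variable {c : ℕ} {r : WithTop ℕ∞}

/-- `C` is a cone of dimension `ℓ` in `ℝ^c`: in suitable linear coordinates
`ℝ^c ≃ ℝ^ℓ × ℝ^{c-ℓ}` it is `{(v, w) : ‖w‖ ≤ ‖v‖}`. -/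
def IsCone (ℓ : ℕ) (C : Set (Euc c)) : Prop :=
  ∃ S : Euc c ≃L[ℝ] Euc ℓ × Euc (c - ℓ), C = {v | ‖(S v).2‖ ≤ ‖(S v).1‖}

/-- `C` is an unstable `ℓ`-cone over `B` for the diffeomorphisms `φ_i`: their derivatives at the
points of `B` map it strictly inside itself and, in a suitable Euclidean norm, uniformly expand its
vectors. -/
def IsUnstableCone {𝒜 : Type*} (ℓ : ℕ) (φ : 𝒜 → EucDiffeo c r) (B C : Set (Euc c)) : Prop :=
  IsCone ℓ C ∧
  (∀ x ∈ B, ∀ i, ∀ v ∈ C, v ≠ 0 → fderiv ℝ (φ i) x v ∈ interior C) ∧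
  ∃ (S : Euc c ≃L[ℝ] Euc c) (θ : ℝ), 1 < θ ∧
    ∀ x ∈ B, ∀ i, ∀ v ∈ C, θ * ‖S v‖ ≤ ‖S (fderiv ℝ (φ i) x v)‖

/-- The set of `ℓ`-planes contained in a cone. -/
def conePlanes (ℓ : ℕ) (C : Set (Euc c)) : Set (Gr ℓ c) := {F | (F.1 : Set (Euc c)) ⊆ C}

/-- `B̂ ⊆ ℝ^c × G(ℓ,c)` is an `ℓ`-tangency of the blending region `B`, with respect to the
`φ_i` and the unstable cone `C`: it is a `cs`-blending region for the induced maps, contained in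
`B × C`. -/
def IsTangency {𝒜 : Type*} [TopologicalSpace 𝒜] (ℓ : ℕ) (hr : 1 ≤ r) (φ : 𝒜 → EucDiffeo c r)
    (B C : Set (Euc c)) (Bhat : Set (Euc c × Gr ℓ c)) : Prop :=
  IsUnstableCone ℓ φ B C ∧ Bhat ⊆ B ×ˢ conePlanes ℓ C ∧
  ∃ (Dhat : Set (Euc c × Gr ℓ c)) (k : ℕ),
    IsCsBlendingRegion (grEmb ℓ c) (EucDiffeo.hats ℓ hr φ) Bhat Dhat k

end Cones

/-! ### Hyperbolic linear maps with a dominated splitting -/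

section Linear

variable {E : Type*} [NormedAddCommGroup E] [NormedSpace ℝ E]

/-- `F` dominates `E₁` under the iterates of `L`. -/
def IsDominatedBy (L : E →L[ℝ] E) (E₁ F : Submodule ℝ E) : Prop :=
  ∃ C > (0 : ℝ), ∃ θ : ℝ, 0 < θ ∧ θ < 1 ∧ ∀ n : ℕ, ∀ u ∈ E₁, ∀ v ∈ F,
    ‖(L ^ n) u‖ * ‖v‖ ≤ C * θ ^ n * (‖(L ^ n) v‖ * ‖u‖)

/-- `L` is hyperbolic with dominated splitting `E^s ⊕ E^cu ⊕ E^uu`, where `E^s` is the stable and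
`E^cu ⊕ E^uu` the unstable direction of `L`. -/
structure IsHyperbolicDominated (L : E →L[ℝ] E) (Es Ecu Euu : Submodule ℝ E) : Prop where
  isInternal : DirectSum.IsInternal ![Es, Ecu, Euu]
  map_s : Es.map (L : E →ₗ[ℝ] E) = Es
  map_cu : Ecu.map (L : E →ₗ[ℝ] E) = Ecu
  map_uu : Euu.map (L : E →ₗ[ℝ] E) = Euu
  contracting : ∃ C > (0 : ℝ), ∃ θ : ℝ, 0 < θ ∧ θ < 1 ∧ ∀ n : ℕ, ∀ v ∈ Es,
    ‖(L ^ n) v‖ ≤ C * θ ^ n * ‖v‖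
  expanding : ∃ C > (0 : ℝ), ∃ θ : ℝ, 0 < θ ∧ θ < 1 ∧ ∀ n : ℕ, ∀ v ∈ Ecu ⊔ Euu,
    ‖v‖ ≤ C * θ ^ n * ‖(L ^ n) v‖
  dominated_s_cu : IsDominatedBy L Es Ecu
  dominated_cu_uu : IsDominatedBy L Ecu Euu

end Linear

end

/-! The lifted map is itself hyperbolic at (p, E^uu). In a graph chart of the Grassmannian the
planes near E^uu are slopes K : E^uu → E^s ⊕ E^cu, on which Dφ(p) acts by K ↦ d K a⁻¹, and
domination makes this a contraction. So the lift is locally a perturbation of a hyperbolic linear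
map Λ̂ whose stable space is E^s times the whole space of slopes.

Add to Λ̂ finitely many translations v_i in stable directions. The images of the unit ball then
cover the closed unit ball with room to spare: unstable directions are covered by expansion, stable
ones by the translations. This survives C¹-small perturbations (`HypLin.exists_covering_family`). So
does the dynamics: every itinerary has exactly one orbit in a large ball (`HypLin.exists_orbit`,
`HypLin.orbit_unique`), so the maximal invariant set is the graph of a continuous map on the full
shift, hence compact and transitive; cones give its hyperbolic splitting (`HypLin.stab_sup_unst`).
`IsEmbChart.isCsBlendingRegion` collects this.

The translations are produced by small twists: φ followed by the rotation exp(δ B_i) about p and a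
translation by δ² s_i. The rotation moves the image of E^uu at p with any prescribed velocity,
because every infinitesimal displacement of a plane comes from a skew-adjoint matrix
(`exists_skewAdjoint`). Now zoom in by δ² in position and by δ in slope. Position acts on slopes
only through Dφ, an effect of order δ², negligible against δ. The coupling thus disappears in the
limit, and the zoomed maps converge in C¹ on balls to Λ̂ + v_i (`eventually_rescale_near`,
`eventually_rescale_zero`). Since slopes evolve by Dφ, this needs Dφ to be C¹, that is r ≥ 2. All
small δ > 0 work, and larger ε are capped.

The unstable cone comes from the domination at p in a suitably weighted norm (`exists_cone_bounds`).
The PHS inequalities for φ survive because the twists are isometries; those for the lifts follow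
from a Lipschitz estimate in the gap metric (`EucDiffeo.lipschitzOnWith_hat`). -/

noncomputable section

/-! ### Perturbations of a hyperbolic linear map -/

/-- A hyperbolic linear automorphism `Λ` of a normed space, with its invariant projections `Ps`, `Pu`
onto the stable and unstable directions, for a norm adapted to `Λ`. -/
structure HypLin (X : Type*) [NormedAddCommGroup X] [NormedSpace ℝ X] where
  Λ : X ≃L[ℝ] X
  Ps : X →L[ℝ] X
  Pu : X →L[ℝ] X
  rate : ℝ
  add_proj : ∀ x, Ps x + Pu x = x
  Ps_Pu : ∀ x, Ps (Pu x) = 0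
  Pu_Ps : ∀ x, Pu (Ps x) = 0
  Ps_comm : ∀ x, Ps (Λ x) = Λ (Ps x)
  Pu_comm : ∀ x, Pu (Λ x) = Λ (Pu x)
  norm_eq : ∀ x, ‖x‖ = max ‖Ps x‖ ‖Pu x‖
  rate_pos : 0 < rate
  rate_lt : rate < 1
  contr : ∀ x, ‖Λ (Ps x)‖ ≤ rate * ‖Ps x‖
  expand : ∀ x, ‖Pu x‖ ≤ rate * ‖Λ (Pu x)‖

namespace HypLin

variable {X : Type*} [NormedAddCommGroup X] [NormedSpace ℝ X] (H : HypLin X) {η R τ : ℝ}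

theorem norm_Ps_le (x : X) : ‖H.Ps x‖ ≤ ‖x‖ := by
  rw [H.norm_eq x]; exact le_max_left _ _

theorem norm_Pu_le (x : X) : ‖H.Pu x‖ ≤ ‖x‖ := by
  rw [H.norm_eq x]; exact le_max_right _ _

theorem norm_le_of {x : X} {K : ℝ} (h1 : ‖H.Ps x‖ ≤ K) (h2 : ‖H.Pu x‖ ≤ K) : ‖x‖ ≤ K := by
  rw [H.norm_eq x]; exact max_le h1 h2

theorem Pu_Pu (x : X) : H.Pu (H.Pu x) = H.Pu x := by
  have h := H.add_proj (H.Pu x)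
  rwa [H.Ps_Pu, zero_add] at h

theorem Ps_Ps (x : X) : H.Ps (H.Ps x) = H.Ps x := by
  have h := H.add_proj (H.Ps x)
  rwa [H.Pu_Ps, add_zero] at h

theorem Pu_comm_symm (x : X) : H.Pu (H.Λ.symm x) = H.Λ.symm (H.Pu x) := by
  apply H.Λ.injective
  rw [← H.Pu_comm]; simp

theorem Ps_comm_symm (x : X) : H.Ps (H.Λ.symm x) = H.Λ.symm (H.Ps x) := by
  apply H.Λ.injective
  rw [← H.Ps_comm]; simp

theorem norm_symm_Pu_le (x : X) : ‖H.Λ.symm (H.Pu x)‖ ≤ H.rate * ‖H.Pu x‖ := by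
  have h := H.expand (H.Λ.symm x)
  rw [H.Pu_comm_symm] at h
  simpa using h

/-- `F` differs from `Λ` by an `η`-Lipschitz map on the closed ball of radius `R`. -/
def IsNear (η R : ℝ) (F : X → X) : Prop :=
  ∀ x, ‖x‖ ≤ R → ∀ y, ‖y‖ ≤ R → ‖(F x - H.Λ x) - (F y - H.Λ y)‖ ≤ η * ‖x - y‖

variable {H}

theorem IsNear.norm_Ps_sub_le {F : X → X} (hF : H.IsNear η R F) {x y : X} (hx : ‖x‖ ≤ R)
    (hy : ‖y‖ ≤ R) : ‖H.Ps (F x - F y)‖ ≤ (H.rate + η) * ‖x - y‖ := by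
  have e : H.Ps (F x - F y)
      = H.Λ (H.Ps (x - y)) + H.Ps ((F x - H.Λ x) - (F y - H.Λ y)) := by
    rw [← H.Ps_comm, ← map_add]; congr 1; rw [map_sub]; abel
  rw [e, add_mul]
  refine (norm_add_le _ _).trans (add_le_add ?_ ?_)
  · exact (H.contr _).trans (mul_le_mul_of_nonneg_left (H.norm_Ps_le _) H.rate_pos.le)
  · exact (H.norm_Ps_le _).trans (hF x hx y hy)

/-- Unstable differences are estimated backwards, from the images, by the expansion of `Λ`. No
inverse of `F` is needed. -/
theorem IsNear.norm_Pu_sub_le {F : X → X} (hF : H.IsNear η R F) {x y : X} (hx : ‖x‖ ≤ R)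
    (hy : ‖y‖ ≤ R) : ‖H.Pu (x - y)‖ ≤ H.rate * (‖F x - F y‖ + η * ‖x - y‖) := by
  have e : H.Λ (H.Pu (x - y)) = H.Pu (F x - F y) - H.Pu ((F x - H.Λ x) - (F y - H.Λ y)) := by
    rw [← H.Pu_comm, ← map_sub]; congr 1; rw [map_sub]; abel
  refine (H.expand _).trans (mul_le_mul_of_nonneg_left ?_ H.rate_pos.le)
  rw [e]
  refine (norm_sub_le _ _).trans (add_le_add (H.norm_Pu_le _) ?_)
  exact (H.norm_Pu_le _).trans (hF x hx y hy)

/-- With this the backward estimate of the unstable part costs the same factor `rate + η` as the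
forward estimate of the stable part. -/
theorem rate_mul_le (hη : 0 ≤ η) {s : ℝ} (hs : 0 ≤ s) :
    H.rate * (s + η * s) ≤ (H.rate + η) * s := by
  have := mul_nonneg (mul_nonneg hη hs) (sub_nonneg.2 H.rate_lt.le)
  nlinarith

/-- Two orbits in the ball that obey the same maps during a long window are close in its middle. -/
theorem norm_sub_le_of_window (hη : 0 ≤ η) {F F' : ℤ → X → X} {x y : ℤ → X} {N : ℕ}
    (hF : ∀ n, H.IsNear η R (F n)) (hFF' : ∀ n : ℤ, |n| ≤ N → F n = F' n)
    (hx : ∀ n, ‖x n‖ ≤ R) (hy : ∀ n, ‖y n‖ ≤ R)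
    (hxF : ∀ n, x (n + 1) = F n (x n)) (hyF : ∀ n, y (n + 1) = F' n (y n)) :
    ∀ k : ℕ, ∀ n : ℤ, |n| + k ≤ N → ‖x n - y n‖ ≤ (H.rate + η) ^ k * (2 * R) := by
  have hκ : 0 ≤ H.rate + η := add_nonneg H.rate_pos.le hη
  have hR : 0 ≤ R := (norm_nonneg _).trans (hx 0)
  intro k
  induction k with
  | zero =>
    intro n _
    have := norm_sub_le (x n) (y n)
    simp only [pow_zero, one_mul]
    linarith [hx n, hy n]
  | succ k ih =>
    intro n hn
    push_cast at hn
    have h1 := abs_le.1 (show |n| ≤ N - k - 1 by linarith)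
    have hm : |n - 1| + k ≤ N := by
      have : |n - 1| ≤ N - k := abs_le.2 ⟨by linarith, by linarith⟩
      linarith
    have hp : |n + 1| + k ≤ N := by
      have : |n + 1| ≤ N - k := abs_le.2 ⟨by linarith, by linarith⟩
      linarith
    have hn0 : |n| + k ≤ N := by linarith
    have hs : 0 ≤ (H.rate + η) ^ k * (2 * R) := by positivity
    rw [pow_succ', mul_assoc]
    -- The stable part is controlled from time n - 1, the unstable part from times n and n + 1.
    -- Hence each factor `rate + η` uses up one time step at either end of the window.
    apply H.norm_le_of
    · have e1 := hxF (n - 1)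
      have e2 := hyF (n - 1)
      rw [sub_add_cancel] at e1 e2
      rw [e1, e2, ← hFF' (n - 1) (by linarith [hm, Int.natCast_nonneg k])]
      exact ((hF _).norm_Ps_sub_le (hx _) (hy _)).trans
        (mul_le_mul_of_nonneg_left (ih _ hm) hκ)
    · refine ((hF n).norm_Pu_sub_le (hx n) (hy n)).trans ?_
      have e2 := hyF n
      rw [← hFF' n (by linarith [hn0, Int.natCast_nonneg k])] at e2
      rw [← hxF n, ← e2]
      refine le_trans (mul_le_mul_of_nonneg_left (add_le_add (ih _ hp)
        (mul_le_mul_of_nonneg_left (ih _ hn0) hη)) H.rate_pos.le) (rate_mul_le hη hs)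

/-- The window may be taken arbitrarily long, so the distance is bounded by a sequence tending to
zero. -/
theorem orbit_unique (hη : 0 ≤ η) (hκ : H.rate + η < 1) {F : ℤ → X → X} {x y : ℤ → X}
    (hF : ∀ n, H.IsNear η R (F n))
    (hx : ∀ n, ‖x n‖ ≤ R) (hy : ∀ n, ‖y n‖ ≤ R)
    (hxF : ∀ n, x (n + 1) = F n (x n)) (hyF : ∀ n, y (n + 1) = F n (y n)) : x = y := by
  funext n
  have h : ∀ k : ℕ, ‖x n - y n‖ ≤ (H.rate + η) ^ k * (2 * R) := fun k =>
    norm_sub_le_of_window (N := n.natAbs + k) hη hF (fun _ _ => rfl) hx hy hxF hyF k n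
      (by push_cast; simp)
  have h0 : Tendsto (fun k : ℕ => (H.rate + η) ^ k * (2 * R)) atTop (𝓝 (0 * (2 * R))) :=
    (tendsto_pow_atTop_nhds_zero_of_lt_one (add_nonneg H.rate_pos.le hη) hκ).mul_const _
  rw [zero_mul] at h0
  have := ge_of_tendsto' h0 h
  exact sub_eq_zero.1 (norm_le_zero_iff.1 this)

/-- An orbit in the closed ball lies in a smaller ball. -/
theorem orbit_norm_le (hη : 0 ≤ η) {F : ℤ → X → X} {x : ℤ → X}
    (hF : ∀ n, H.IsNear η R (F n)) (h0 : ∀ n, ‖F n 0‖ ≤ τ)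
    (hx : ∀ n, ‖x n‖ ≤ R) (hxF : ∀ n, x (n + 1) = F n (x n)) (n : ℤ) :
    ‖x n‖ ≤ (H.rate + η) * R + τ := by
  have hR : 0 ≤ R := (norm_nonneg _).trans (hx 0)
  have hτ : 0 ≤ τ := (norm_nonneg _).trans (h0 0)
  have hR0 : ‖(0 : X)‖ ≤ R := by simpa
  apply H.norm_le_of
  · have e1 := hxF (n - 1)
    rw [sub_add_cancel] at e1
    have h := (hF (n - 1)).norm_Ps_sub_le (hx (n - 1)) hR0
    rw [← e1, map_sub, sub_zero] at h
    have h2 := norm_sub_norm_le (H.Ps (x n)) (H.Ps (F (n - 1) 0))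
    have h3 := (H.norm_Ps_le _).trans (h0 (n - 1))
    have h4 := mul_le_mul_of_nonneg_left (hx (n - 1)) (add_nonneg H.rate_pos.le hη)
    linarith
  · have h := (hF n).norm_Pu_sub_le (hx n) hR0
    rw [← hxF n, sub_zero] at h
    have h2 := norm_sub_le (x (n + 1)) (F n 0)
    have h3 : ‖x (n + 1) - F n 0‖ + η * ‖x n‖ ≤ (R + η * R) + τ := by
      linarith [hx (n + 1), h0 n, mul_le_mul_of_nonneg_left (hx n) hη]
    have h4 := mul_le_mul_of_nonneg_left h3 H.rate_pos.le
    have h5 := H.rate_mul_le hη hR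
    have h6 := mul_le_mul_of_nonneg_right H.rate_lt.le hτ
    linarith

/-- The operator on sequences whose fixed points are the orbits of `F`. -/
def picard (H : HypLin X) (F : ℤ → X → X) (x : ℤ → X) : ℤ → X := fun n =>
  H.Ps (F (n - 1) (x (n - 1))) + H.Λ.symm (H.Pu (x (n + 1) - (F n (x n) - H.Λ (x n))))

theorem Ps_picard (F : ℤ → X → X) (x : ℤ → X) (n : ℤ) :
    H.Ps (H.picard F x n) = H.Ps (F (n - 1) (x (n - 1))) := by
  simp [picard, H.Ps_Ps, H.Ps_comm_symm, H.Ps_Pu]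

theorem Pu_picard (F : ℤ → X → X) (x : ℤ → X) (n : ℤ) :
    H.Pu (H.picard F x n) = H.Λ.symm (H.Pu (x (n + 1) - (F n (x n) - H.Λ (x n)))) := by
  simp only [picard, map_add, H.Pu_Ps, H.Pu_comm_symm, H.Pu_Pu, zero_add]

/-- In the max norm the stable and unstable parts are estimated separately, so the two contributions
are not added and the operator contracts the sup distance. -/
theorem norm_picard_sub_le (hη : 0 ≤ η) {F : ℤ → X → X} (hF : ∀ n, H.IsNear η R (F n))
    {x y : ℤ → X} (hx : ∀ n, ‖x n‖ ≤ R) (hy : ∀ n, ‖y n‖ ≤ R) {K : ℝ}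
    (hK : ∀ n, ‖x n - y n‖ ≤ K) (n : ℤ) :
    ‖H.picard F x n - H.picard F y n‖ ≤ (H.rate + η) * K := by
  have hK0 : 0 ≤ K := (norm_nonneg _).trans (hK 0)
  apply H.norm_le_of
  · rw [map_sub, Ps_picard, Ps_picard, ← map_sub]
    exact ((hF _).norm_Ps_sub_le (hx _) (hy _)).trans
      (mul_le_mul_of_nonneg_left (hK _) (add_nonneg H.rate_pos.le hη))
  · rw [map_sub, Pu_picard, Pu_picard, ← map_sub, ← map_sub]
    refine (H.norm_symm_Pu_le _).trans (le_trans ?_ (H.rate_mul_le hη hK0))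
    refine mul_le_mul_of_nonneg_left ((H.norm_Pu_le _).trans ?_) H.rate_pos.le
    have e : x (n + 1) - (F n (x n) - H.Λ (x n)) - (y (n + 1) - (F n (y n) - H.Λ (y n)))
      = (x (n + 1) - y (n + 1)) - ((F n (x n) - H.Λ (x n)) - (F n (y n) - H.Λ (y n))) := by abel
    rw [e]
    refine (norm_sub_le _ _).trans (add_le_add (hK _) ?_)
    exact (hF n _ (hx n) _ (hy n)).trans (mul_le_mul_of_nonneg_left (hK n) hη)

theorem norm_picard_le (hη : 0 ≤ η) (hR : 0 ≤ R) {F : ℤ → X → X} (hF : ∀ n, H.IsNear η R (F n))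
    (h0 : ∀ n, ‖F n 0‖ ≤ τ) {x : ℤ → X} (hx : ∀ n, ‖x n‖ ≤ R) (n : ℤ) :
    ‖H.picard F x n‖ ≤ (H.rate + η) * R + τ := by
  have hτ : 0 ≤ τ := (norm_nonneg _).trans (h0 0)
  have h1 := norm_picard_sub_le hη hF hx (y := 0) (fun _ => by simpa) (K := R)
    (fun n => by simpa using hx n) n
  have h2 : ‖H.picard F 0 n‖ ≤ τ := by
    apply H.norm_le_of
    · rw [Ps_picard]
      exact (H.norm_Ps_le _).trans (h0 _)
    · rw [Pu_picard]
      refine (H.norm_symm_Pu_le _).trans ?_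
      have h3 : ‖H.Pu ((0 : ℤ → X) (n + 1) - (F n ((0 : ℤ → X) n) - H.Λ ((0 : ℤ → X) n)))‖ ≤ τ := by
        refine (H.norm_Pu_le _).trans ?_
        simpa using h0 n
      have h4 := mul_le_mul_of_nonneg_left h3 H.rate_pos.le
      have h6 := mul_le_mul_of_nonneg_right H.rate_lt.le hτ
      linarith
  have := norm_sub_norm_le (H.picard F x n) (H.picard F 0 n)
  linarith

theorem IsNear.continuousOn {F : X → X} (hF : H.IsNear η R F) :
    ContinuousOn F (Metric.closedBall 0 R) := by
  have h : LipschitzOnWith η.toNNReal (fun x => F x - H.Λ x) (Metric.closedBall 0 R) := by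
    apply LipschitzOnWith.of_dist_le_mul
    intro x hx y hy
    rw [mem_closedBall_zero_iff] at hx hy
    rw [dist_eq_norm, dist_eq_norm]
    exact (hF x hx y hy).trans
      (mul_le_mul_of_nonneg_right (Real.le_coe_toNNReal _) (norm_nonneg _))
  have := h.continuousOn.add H.Λ.continuous.continuousOn
  refine this.congr fun x _ => ?_
  simp

/-- Maps close to a hyperbolic linear map have an orbit that stays in the ball. -/
theorem exists_orbit [CompleteSpace X] (hη : 0 ≤ η) (hκ : H.rate + η < 1)
    {F : ℤ → X → X} (hF : ∀ n, H.IsNear η R (F n)) (h0 : ∀ n, ‖F n 0‖ ≤ τ)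
    (hRτ : (H.rate + η) * R + τ ≤ R) :
    ∃ x : ℤ → X, (∀ n, ‖x n‖ ≤ R) ∧ ∀ n, x (n + 1) = F n (x n) := by
  have hτ : 0 ≤ τ := (norm_nonneg _).trans (h0 0)
  have hR : 0 ≤ R := by
    by_contra h
    nlinarith
  -- Banach iteration from the zero sequence. The increments are bounded uniformly in n, but only
  -- the limits at each fixed n are needed.
  let s : ℕ → ℤ → X := fun k => (H.picard F)^[k] 0
  have hs : ∀ k n, ‖s k n‖ ≤ R := by
    intro k
    induction k with
    | zero => intro n; simpa [s] using hR
    | succ k ih =>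
      intro n
      simp only [s, Function.iterate_succ_apply']
      exact (norm_picard_le hη hR hF h0 ih n).trans hRτ
  have hd : ∀ k n, ‖s k n - s (k + 1) n‖ ≤ (H.rate + η) ^ k * (2 * R) := by
    intro k
    induction k with
    | zero =>
      intro n
      have := norm_sub_le (s 0 n) (s (0 + 1) n)
      linarith [hs 0 n, hs (0 + 1) n]
    | succ k ih =>
      intro n
      rw [pow_succ', mul_assoc]
      have := norm_picard_sub_le hη hF (hs k) (hs (k + 1)) ih n
      simpa only [s, Function.iterate_succ_apply'] using this
  have hlim : ∀ n, ∃ y, Tendsto (fun k => s k n) atTop (𝓝 y) := by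
    intro n
    apply cauchySeq_tendsto_of_complete
    apply cauchySeq_of_le_geometric (H.rate + η) (2 * R) hκ
    intro k
    rw [dist_eq_norm, mul_comm]
    exact hd k n
  choose x hx using hlim
  have hxR : ∀ n, ‖x n‖ ≤ R := fun n => le_of_tendsto' (hx n).norm fun k => hs k n
  have hFx : ∀ m n, Tendsto (fun k => F m (s k n)) atTop (𝓝 (F m (x n))) := by
    intro m n
    have h1 := (hF m).continuousOn (x n) (by simpa using hxR n)
    apply h1.tendsto.comp
    exact tendsto_nhdsWithin_iff.2 ⟨hx n, Eventually.of_forall fun k => by simpa using hs k n⟩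
  have hfix : ∀ n, x n = H.picard F x n := by
    intro n
    have h1 : Tendsto (fun k => s (k + 1) n) atTop (𝓝 (x n)) := (tendsto_add_atTop_iff_nat 1).2 (hx n)
    have h2 : Tendsto (fun k => s (k + 1) n) atTop (𝓝 (H.picard F x n)) := by
      simp only [s, Function.iterate_succ_apply']
      refine ((H.Ps.continuous.tendsto _).comp (hFx _ _)).add
        ((H.Λ.symm.continuous.tendsto _).comp ((H.Pu.continuous.tendsto _).comp
          ((hx _).sub ((hFx _ _).sub ((H.Λ.continuous.tendsto _).comp (hx _))))))
    exact tendsto_nhds_unique h1 h2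
  refine ⟨x, hxR, fun n => ?_⟩
  have h1 : H.Ps (x (n + 1)) = H.Ps (F n (x n)) := by
    rw [hfix (n + 1), Ps_picard, add_sub_cancel_right]
  -- Applying `Λ` to the unstable part of the fixed point equation cancels `Λ.symm` and leaves the
  -- orbit relation.
  have h2 : H.Pu (x (n + 1)) = H.Pu (F n (x n)) := by
    have h3 : H.Pu (x n) = _ := (congrArg H.Pu (hfix n)).trans (Pu_picard F x n)
    have h4 := congrArg H.Λ h3
    rw [ContinuousLinearEquiv.apply_symm_apply, ← H.Pu_comm, ← sub_eq_zero, ← map_sub] at h4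
    rw [← sub_eq_zero, ← map_sub, ← neg_eq_zero, ← map_neg, ← h4]
    congr 1
    abel
  rw [← H.add_proj (x (n + 1)), h1, h2, H.add_proj]

end HypLin

theorem eq_zero_of_norm_le_geometric {E : Type*} [NormedAddCommGroup E] {κ K : ℝ} (h0 : 0 ≤ κ) (h1 : κ < 1) {v : E}
    (h : ∀ k : ℕ, ‖v‖ ≤ κ ^ k * K) : v = 0 := by
  have h0 : Tendsto (fun k : ℕ => κ ^ k * K) atTop (𝓝 (0 * K)) :=
    (tendsto_pow_atTop_nhds_zero_of_lt_one h0 h1).mul_const _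
  rw [zero_mul] at h0
  exact norm_le_zero_iff.1 (ge_of_tendsto' h0 h)

/-! ### Linear cocycles close to a hyperbolic map: cones, stable and unstable subspaces. -/

namespace HypLin

variable {X : Type*} [NormedAddCommGroup X] [NormedSpace ℝ X] {H : HypLin X} {η : ℝ}

theorem isNear_of_linear {L : X →L[ℝ] X} (hL : ‖L - (H.Λ : X →L[ℝ] X)‖ ≤ η) (R : ℝ) :
    H.IsNear η R L := by
  intro x _ y _
  have e : L x - H.Λ x - (L y - H.Λ y) = (L - (H.Λ : X →L[ℝ] X)) (x - y) := by
    simp only [map_sub, sub_apply, ContinuousLinearEquiv.coe_coe]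
  rw [e]
  exact ((L - (H.Λ : X →L[ℝ] X)).le_opNorm _).trans
    (mul_le_mul_of_nonneg_right hL (norm_nonneg _))

/-- Vectors whose orbit under `A 0, A 1, …` is bounded. -/
def stab (A : ℤ → X →L[ℝ] X) : Submodule ℝ X where
  carrier := {v | ∃ K : ℝ, ∃ w : ℕ → X, w 0 = v ∧ (∀ k : ℕ, w (k + 1) = A k (w k)) ∧ ∀ k, ‖w k‖ ≤ K}
  zero_mem' := ⟨0, 0, rfl, fun k => by simp, fun k => by simp⟩
  add_mem' := by
    rintro v v' ⟨K, w, h0, h1, h2⟩ ⟨K', w', h0', h1', h2'⟩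
    refine ⟨K + K', w + w', by simp [h0, h0'], fun k => by simp [h1, h1'], fun k => ?_⟩
    exact (norm_add_le _ _).trans (add_le_add (h2 k) (h2' k))
  smul_mem' := by
    rintro c v ⟨K, w, h0, h1, h2⟩
    refine ⟨‖c‖ * K, c • w, by simp [h0], fun k => by simp [h1], fun k => ?_⟩
    simpa [norm_smul] using mul_le_mul_of_nonneg_left (h2 k) (norm_nonneg c)

/-- Vectors with a bounded backward orbit under `A (-1), A (-2), …`. -/
def unst (A : ℤ → X →L[ℝ] X) : Submodule ℝ X where
  carrier := {v | ∃ K : ℝ, ∃ w : ℕ → X, w 0 = v ∧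
    (∀ k : ℕ, w k = A (-(k + 1)) (w (k + 1))) ∧ ∀ k, ‖w k‖ ≤ K}
  zero_mem' := ⟨0, 0, rfl, fun k => by simp, fun k => by simp⟩
  add_mem' := by
    rintro v v' ⟨K, w, h0, h1, h2⟩ ⟨K', w', h0', h1', h2'⟩
    refine ⟨K + K', w + w', by simp [h0, h0'], fun k => ?_, fun k => ?_⟩
    · simp only [Pi.add_apply, map_add]
      rw [← h1, ← h1']
    · exact (norm_add_le _ _).trans (add_le_add (h2 k) (h2' k))
  smul_mem' := by
    rintro c v ⟨K, w, h0, h1, h2⟩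
    refine ⟨‖c‖ * K, c • w, by simp [h0], fun k => ?_, fun k => ?_⟩
    · simp only [Pi.smul_apply, map_smul]
      rw [← h1]
    · simpa [norm_smul] using mul_le_mul_of_nonneg_left (h2 k) (norm_nonneg c)

section Step

variable {L : X →L[ℝ] X}

theorem norm_Ps_map_le (hL : ‖L - (H.Λ : X →L[ℝ] X)‖ ≤ η) (v : X) :
    ‖H.Ps (L v)‖ ≤ (H.rate + η) * ‖v‖ := by
  have := (isNear_of_linear hL ‖v‖).norm_Ps_sub_le (x := v) (y := 0) le_rfl (by simp)
  simpa using this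

/-- On the cone the norm is that of the unstable part, so the error `η * ‖v‖` of the backward
estimate can be absorbed on the left. -/
theorem norm_le_of_cone (hL : ‖L - (H.Λ : X →L[ℝ] X)‖ ≤ η) (hκ : H.rate + η < 1) {v : X}
    (hv : ‖H.Ps v‖ ≤ ‖H.Pu v‖) : ‖v‖ ≤ (H.rate + η) * ‖L v‖ := by
  have hη : 0 ≤ η := (norm_nonneg _).trans hL
  have h := (isNear_of_linear hL ‖v‖).norm_Pu_sub_le (x := v) (y := 0) le_rfl (by simp)
  simp only [sub_zero, map_zero] at h
  have hn := H.norm_eq v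
  rw [max_eq_right hv] at hn
  rw [← hn] at h
  have hp := H.rate_pos
  have h1 := H.rate_lt
  have h2 : (1 - H.rate * η) * ‖v‖ ≤ H.rate * ‖L v‖ := by linarith
  have h3 : 0 < 1 - H.rate * η := by nlinarith
  -- The difference of the two sides is η (1 - rate (rate + η)), which is nonnegative.
  have h4 : H.rate ≤ (H.rate + η) * (1 - H.rate * η) := by
    have : 0 ≤ η * (1 - H.rate * (H.rate + η)) := mul_nonneg hη (by nlinarith)
    nlinarith
  refine le_of_mul_le_mul_left ?_ h3
  calc _ ≤ H.rate * ‖L v‖ := h2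
    _ ≤ ((H.rate + η) * (1 - H.rate * η)) * ‖L v‖ :=
        mul_le_mul_of_nonneg_right h4 (norm_nonneg _)
    _ = _ := by ring

/-- If the stable part carried the norm of `L v`, then `L v` would be shorter than `v` by the
forward estimate, although `L` expands vectors of the cone. -/
theorem map_cone_lt (hL : ‖L - (H.Λ : X →L[ℝ] X)‖ ≤ η) (hκ : H.rate + η < 1) {v : X}
    (hv : ‖H.Ps v‖ ≤ ‖H.Pu v‖) (hv0 : v ≠ 0) : ‖H.Ps (L v)‖ < ‖H.Pu (L v)‖ := by
  have hη : 0 ≤ η := (norm_nonneg _).trans hL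
  have hp := H.rate_pos
  have h1 := norm_Ps_map_le hL v
  have h2 := norm_le_of_cone hL hκ hv
  have h3 : 0 < ‖v‖ := norm_pos_iff.2 hv0
  have h4 : ‖H.Ps (L v)‖ < ‖L v‖ := by
    have : (H.rate + η) * ‖v‖ < ‖v‖ := by nlinarith
    have : (H.rate + η) * ‖L v‖ ≤ ‖L v‖ := by nlinarith [norm_nonneg (L v)]
    linarith
  by_contra h
  rw [not_lt] at h
  rw [H.norm_eq (L v), max_eq_left h] at h4
  exact lt_irrefl _ h4

theorem map_cone_le (hL : ‖L - (H.Λ : X →L[ℝ] X)‖ ≤ η) (hκ : H.rate + η < 1) {v : X}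
    (hv : ‖H.Ps v‖ ≤ ‖H.Pu v‖) : ‖H.Ps (L v)‖ ≤ ‖H.Pu (L v)‖ := by
  by_cases hv0 : v = 0
  · simp [hv0]
  · exact (map_cone_lt hL hκ hv hv0).le

theorem norm_map_le_of_cone (hL : ‖L - (H.Λ : X →L[ℝ] X)‖ ≤ η) {v : X}
    (hv : ‖H.Pu (L v)‖ ≤ ‖H.Ps (L v)‖) : ‖L v‖ ≤ (H.rate + η) * ‖v‖ := by
  rw [H.norm_eq (L v), max_eq_left hv]
  exact norm_Ps_map_le hL v

end Step

variable {A : ℤ → X →L[ℝ] X}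

/-- Otherwise the vector lies in the unstable cone, its orbit stays there and grows geometrically,
contradicting boundedness. -/
theorem stab_cone (hA : ∀ n, ‖A n - (H.Λ : X →L[ℝ] X)‖ ≤ η) (hκ : H.rate + η < 1) {v : X}
    (hv : v ∈ stab A) : ‖H.Pu v‖ ≤ ‖H.Ps v‖ := by
  obtain ⟨K, w, rfl, h1, h2⟩ := hv
  have hη : 0 ≤ η := (norm_nonneg _).trans (hA 0)
  have hκ0 : 0 ≤ H.rate + η := add_nonneg H.rate_pos.le hη
  by_contra h
  rw [not_le] at h
  have h3 : ∀ k, ‖H.Ps (w k)‖ ≤ ‖H.Pu (w k)‖ ∧ ‖w 0‖ ≤ (H.rate + η) ^ k * ‖w k‖ := by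
    intro k
    induction k with
    | zero => exact ⟨h.le, by simp⟩
    | succ k ih =>
      rw [h1 k]
      refine ⟨map_cone_le (hA k) hκ ih.1, ih.2.trans ?_⟩
      rw [pow_succ, mul_assoc]
      exact mul_le_mul_of_nonneg_left (norm_le_of_cone (hA k) hκ ih.1) (pow_nonneg hκ0 _)
  have h4 : w 0 = 0 := eq_zero_of_norm_le_geometric hκ0 hκ (K := K) fun k =>
    (h3 k).2.trans (mul_le_mul_of_nonneg_left (h2 k) (pow_nonneg hκ0 _))
  simp [h4] at h

/-- The time reversal of `stab_cone`: the complement of the unstable cone is backward invariant, and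
there backward orbits grow geometrically. -/
theorem unst_cone (hA : ∀ n, ‖A n - (H.Λ : X →L[ℝ] X)‖ ≤ η) (hκ : H.rate + η < 1) {v : X}
    (hv : v ∈ unst A) : ‖H.Ps v‖ ≤ ‖H.Pu v‖ := by
  obtain ⟨K, w, rfl, h1, h2⟩ := hv
  have hη : 0 ≤ η := (norm_nonneg _).trans (hA 0)
  have hκ0 : 0 ≤ H.rate + η := add_nonneg H.rate_pos.le hη
  by_contra h
  rw [not_le] at h
  have h3 : ∀ k, ‖H.Pu (w k)‖ < ‖H.Ps (w k)‖ ∧ ‖w 0‖ ≤ (H.rate + η) ^ k * ‖w k‖ := by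
    intro k
    induction k with
    | zero => exact ⟨h, by simp⟩
    | succ k ih =>
      have e := h1 k
      refine ⟨?_, ih.2.trans ?_⟩
      · by_contra h5
        rw [not_lt] at h5
        have := map_cone_le (hA (-(k + 1))) hκ h5
        rw [← e] at this
        exact absurd ih.1 (not_lt.2 this)
      · rw [pow_succ, mul_assoc]
        refine mul_le_mul_of_nonneg_left ?_ (pow_nonneg hκ0 _)
        have := norm_map_le_of_cone (hA (-(k + 1))) (v := w (k + 1)) (by rw [← e]; exact ih.1.le)
        rwa [← e] at this
  have h4 : w 0 = 0 := eq_zero_of_norm_le_geometric hκ0 hκ (K := K) fun k =>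
    (h3 k).2.trans (mul_le_mul_of_nonneg_left (h2 k) (pow_nonneg hκ0 _))
  simp [h4] at h

theorem map_mem_stab {v : X} (hv : v ∈ stab A) : A 0 v ∈ stab (fun n => A (n + 1)) := by
  obtain ⟨K, w, rfl, h1, h2⟩ := hv
  refine ⟨K, fun k => w (k + 1), by simpa using h1 0, fun k => ?_, fun k => h2 _⟩
  simpa using h1 (k + 1)

theorem mem_stab_of_map {v : X} (hv : A 0 v ∈ stab (fun n => A (n + 1))) : v ∈ stab A := by
  obtain ⟨K, w, h0, h1, h2⟩ := hv
  refine ⟨max K ‖v‖, fun k => Nat.casesOn k v w, rfl, fun k => ?_, fun k => ?_⟩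
  · cases k with
    | zero => simpa using h0
    | succ k => simpa using h1 k
  · cases k with
    | zero => exact le_max_right _ _
    | succ k => exact (h2 k).trans (le_max_left _ _)

theorem map_mem_unst {v : X} (hv : v ∈ unst A) : A 0 v ∈ unst (fun n => A (n + 1)) := by
  obtain ⟨K, w, h0, h1, h2⟩ := hv
  refine ⟨max K ‖A 0 v‖, fun k => Nat.casesOn k (A 0 v) w, rfl, fun k => ?_, fun k => ?_⟩
  · cases k with
    | zero => simp [h0]
    | succ k => simpa using h1 k
  · cases k with
    | zero => exact le_max_right _ _
    | succ k => exact (h2 k).trans (le_max_left _ _)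

theorem exists_of_mem_unst {v : X} (hv : v ∈ unst (fun n => A (n + 1))) :
    ∃ u ∈ unst A, A 0 u = v := by
  obtain ⟨K, w, rfl, h1, h2⟩ := hv
  refine ⟨w 1, ⟨K, fun k => w (k + 1), rfl, fun k => ?_, fun k => h2 _⟩, ?_⟩
  · simpa using h1 (k + 1)
  · simpa using (h1 0).symm

/-- Surjectivity supplies a preimage of a vector with bounded forward orbit. For `map_unst` the
preimage is already part of the backward orbit. -/
theorem map_stab (hA0 : Function.Surjective (A 0)) :
    (stab A).map (A 0 : X →ₗ[ℝ] X) = stab (fun n => A (n + 1)) := by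
  ext v
  constructor
  · rintro ⟨u, hu, rfl⟩
    exact map_mem_stab hu
  · intro hv
    obtain ⟨u, rfl⟩ := hA0 v
    exact ⟨u, mem_stab_of_map hv, rfl⟩

theorem map_unst : (unst A).map (A 0 : X →ₗ[ℝ] X) = unst (fun n => A (n + 1)) := by
  ext v
  constructor
  · rintro ⟨u, hu, rfl⟩
    exact map_mem_unst hu
  · intro hv
    obtain ⟨u, hu, rfl⟩ := exists_of_mem_unst hv
    exact ⟨u, hu, rfl⟩

theorem norm_map_stab_le (hA : ∀ n, ‖A n - (H.Λ : X →L[ℝ] X)‖ ≤ η) (hκ : H.rate + η < 1) {v : X}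
    (hv : v ∈ stab A) : ‖A 0 v‖ ≤ (H.rate + η) * ‖v‖ :=
  norm_map_le_of_cone (hA 0) (stab_cone (fun n => hA (n + 1)) hκ (map_mem_stab hv))

theorem norm_unst_le (hA : ∀ n, ‖A n - (H.Λ : X →L[ℝ] X)‖ ≤ η) (hκ : H.rate + η < 1) {v : X}
    (hv : v ∈ unst A) : ‖v‖ ≤ (H.rate + η) * ‖A 0 v‖ :=
  norm_le_of_cone (hA 0) hκ (unst_cone hA hκ hv)

theorem disjoint_stab_unst (hA : ∀ n, ‖A n - (H.Λ : X →L[ℝ] X)‖ ≤ η) (hκ : H.rate + η < 1) :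
    Disjoint (stab A) (unst A) := by
  rw [Submodule.disjoint_def]
  intro v hs hu
  by_contra h0
  have h1 := map_cone_lt (hA 0) hκ (unst_cone hA hκ hu) h0
  exact absurd (stab_cone (fun n => hA (n + 1)) hκ (map_mem_stab hs)) (not_le.2 h1)

/-- The decomposition of `v` is read off a bounded orbit of the cocycle forced by `v` at time -1
only. The orbit jumps by `v` on arriving at time 0; after the jump it is a bounded forward orbit,
before it a bounded backward orbit, and `v` is the difference of the two. -/
theorem stab_sup_unst [CompleteSpace X] (hA : ∀ n, ‖A n - (H.Λ : X →L[ℝ] X)‖ ≤ η)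
    (hκ : H.rate + η < 1) : stab A ⊔ unst A = ⊤ := by
  rw [eq_top_iff]
  intro v _
  have hη : 0 ≤ η := (norm_nonneg _).trans (hA 0)
  let F : ℤ → X → X := fun n w => A n w + if n = -1 then v else 0
  let R : ℝ := ‖v‖ / (1 - (H.rate + η))
  have hF : ∀ n, H.IsNear η R (F n) := by
    intro n x hx y hy
    have := isNear_of_linear (hA n) R x hx y hy
    have e : F n x - H.Λ x - (F n y - H.Λ y) = A n x - H.Λ x - (A n y - H.Λ y) := by
      simp only [F]; abel
    rwa [e]
  have h0 : ∀ n, ‖F n 0‖ ≤ ‖v‖ := by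
    intro n
    by_cases h : n = -1 <;> simp [F, h]
  have hR : (H.rate + η) * R + ‖v‖ ≤ R := by
    have : (1 - (H.rate + η)) * R = ‖v‖ := mul_div_cancel₀ _ (by linarith)
    linarith
  obtain ⟨x, hx, hxF⟩ := exists_orbit hη hκ hF h0 hR
  have hxn : ∀ n, n ≠ -1 → x (n + 1) = A n (x n) := by
    intro n hn
    rw [hxF n]; simp [F, hn]
  have e : x 0 = A (-1) (x (-1)) + v := by
    have := hxF (-1)
    simpa [F] using this
  have hs : x 0 ∈ stab A :=
    ⟨R, fun k => x k, rfl, fun k => by simpa using hxn k (by omega), fun k => hx k⟩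
  have hu : A (-1) (x (-1)) ∈ unst A := by
    refine ⟨max R ‖A (-1) (x (-1))‖, fun k => Nat.casesOn k (A (-1) (x (-1))) (fun k => x (-(k + 1))),
      rfl, fun k => ?_, fun k => ?_⟩
    · cases k with
      | zero => simp
      | succ k =>
        have := hxn (-(k + 1 + 1)) (by omega)
        rw [show (-((k : ℤ) + 1 + 1) + 1) = -(k + 1) by ring] at this
        simpa using this
    · cases k with
      | zero => exact le_max_right _ _
      | succ k => exact (hx _).trans (le_max_left _ _)
  have : v = x 0 - A (-1) (x (-1)) := by rw [e]; abel
  rw [this]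
  exact Submodule.sub_mem _ (Submodule.mem_sup_left hs) (Submodule.mem_sup_right hu)

/-- By the cone conditions `Ps` is injective on `stab` and `Pu` on `unst`. This bounds both
dimensions from above, and their sum is the full dimension, so equality holds. -/
theorem finrank_stab [FiniteDimensional ℝ X] (hA : ∀ n, ‖A n - (H.Λ : X →L[ℝ] X)‖ ≤ η)
    (hκ : H.rate + η < 1) :
    Module.finrank ℝ (stab A) = Module.finrank ℝ (LinearMap.range (H.Ps : X →ₗ[ℝ] X)) := by
  have : CompleteSpace X := FiniteDimensional.complete ℝ X
  have hs : Module.finrank ℝ (stab A) ≤ Module.finrank ℝ (LinearMap.range (H.Ps : X →ₗ[ℝ] X)) := by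
    let g : stab A →ₗ[ℝ] LinearMap.range (H.Ps : X →ₗ[ℝ] X) :=
      (H.Ps : X →ₗ[ℝ] X).rangeRestrict.comp (stab A).subtype
    apply LinearMap.finrank_le_finrank_of_injective (f := g)
    rw [← LinearMap.ker_eq_bot, LinearMap.ker_eq_bot']
    intro v hv
    have h1 : H.Ps (v : X) = 0 := congrArg Subtype.val hv
    have h2 := stab_cone hA hκ v.2
    rw [h1, norm_zero, norm_le_zero_iff] at h2
    have := H.add_proj (v : X)
    rw [h1, h2, add_zero] at this
    exact Subtype.ext this.symm
  have hu : Module.finrank ℝ (unst A) ≤ Module.finrank ℝ (LinearMap.ker (H.Ps : X →ₗ[ℝ] X)) := by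
    let g : unst A →ₗ[ℝ] LinearMap.ker (H.Ps : X →ₗ[ℝ] X) :=
      LinearMap.codRestrict _ ((H.Pu : X →ₗ[ℝ] X).comp (unst A).subtype)
        (fun v => by simp [H.Ps_Pu])
    apply LinearMap.finrank_le_finrank_of_injective (f := g)
    rw [← LinearMap.ker_eq_bot, LinearMap.ker_eq_bot']
    intro v hv
    have h1 : H.Pu (v : X) = 0 := congrArg Subtype.val hv
    have h2 := unst_cone hA hκ v.2
    rw [h1, norm_zero, norm_le_zero_iff] at h2
    have := H.add_proj (v : X)
    rw [h1, h2, add_zero] at this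
    exact Subtype.ext this.symm
  have h1 := Submodule.finrank_sup_add_finrank_inf_eq (stab A) (unst A)
  rw [stab_sup_unst hA hκ, (disjoint_stab_unst hA hκ).eq_bot, finrank_top, finrank_bot] at h1
  have h2 := LinearMap.finrank_range_add_finrank_ker (H.Ps : X →ₗ[ℝ] X)
  omega

end HypLin

/-! ### The full shift and orbits of a one-step skew-product -/

section Symbolic

variable {𝒜 M : Type*}

theorem Equiv.Perm.zpow_apply_of_orbit {α : Type*} (e : Equiv.Perm α) {w : ℤ → α}
    (h : ∀ n, e (w n) = w (n + 1)) (n : ℤ) : (e ^ n) (w 0) = w n := by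
  induction n with
  | zero => simp
  | succ k ih => rw [add_comm (k : ℤ) 1, zpow_one_add, Equiv.Perm.mul_apply, ih, h, add_comm]
  | pred k ih =>
    apply e.injective
    rw [h, ← Equiv.Perm.mul_apply, ← zpow_one_add]
    rw [show (1 + (-(k : ℤ) - 1)) = -k by ring, ih]
    congr 1; ring

theorem oneStep_zpow_fst (f : 𝒜 → Equiv.Perm M) (z : (ℤ → 𝒜) × M) (n : ℤ) (k : ℤ) :
    ((oneStep f ^ n) z).1 k = z.1 (k + n) := by
  have hstep : ∀ (y : (ℤ → 𝒜) × M) (k : ℤ), (oneStep f y).1 k = y.1 (k + 1) := fun _ _ => rfl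
  induction n generalizing k with
  | zero => simp
  | succ m ih =>
    rw [add_comm (m : ℤ) 1, zpow_one_add, Equiv.Perm.mul_apply, hstep, ih]
    exact congrArg z.1 (by ring)
  | pred m ih =>
    have h := hstep ((oneStep f ^ (-(m : ℤ) - 1)) z) (k - 1)
    rw [← Equiv.Perm.mul_apply, ← zpow_one_add, show (1 + (-(m : ℤ) - 1)) = -m by ring, ih,
      sub_add_cancel] at h
    rw [← h]
    exact congrArg _ (by ring)

theorem mem_maxInvariant {f : 𝒜 → Equiv.Perm M} {K : Set M} {z : (ℤ → 𝒜) × M} :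
    z ∈ maxInvariant f K ↔ ∀ n : ℤ, ((oneStep f ^ n) z).2 ∈ K := by
  unfold maxInvariant
  rw [mem_iInter]
  constructor
  · intro h n
    obtain ⟨y, hy, hyz⟩ := h (-n)
    rw [← hyz, ← Equiv.Perm.mul_apply, ← zpow_add]
    simpa using hy
  · intro h n
    refine ⟨(oneStep f ^ (-n)) z, ⟨mem_univ _, h (-n)⟩, ?_⟩
    rw [← Equiv.Perm.mul_apply, ← zpow_add]
    simp

theorem image_maxInvariant (f : 𝒜 → Equiv.Perm M) (K : Set M) :
    oneStep f '' maxInvariant f K = maxInvariant f K := by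
  ext z
  constructor
  · rintro ⟨y, hy, rfl⟩
    rw [mem_maxInvariant] at hy ⊢
    intro n
    have := hy (n + 1)
    rwa [zpow_add_one] at this
  · intro hz
    refine ⟨(oneStep f).symm z, ?_, by simp⟩
    rw [mem_maxInvariant] at hz ⊢
    intro n
    have := hz (n - 1)
    rwa [zpow_sub_one] at this

/-- The full shift has a point with a dense forward orbit. -/
theorem exists_dense_shift_orbit (𝒜 : Type*) [Finite 𝒜] [Nonempty 𝒜] :
    ∃ ζ : ℤ → 𝒜, ∀ (w : ℤ → 𝒜) (N : ℕ), ∃ n : ℕ, ∀ j : ℤ, |j| ≤ N → ζ (j + n) = w j := by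
  let _ : TopologicalSpace 𝒜 := ⊥
  have : DiscreteTopology 𝒜 := ⟨rfl⟩
  let I : ℕ → Type := fun N => Finset.Icc (-(N : ℤ)) N
  -- Baire category: for each of the countably many finite words, the sequences containing it at a
  -- nonnegative shift form an open dense set.
  let U : (Σ N, (I N → 𝒜)) → Set (ℤ → 𝒜) := fun p =>
    {ζ | ∃ n : ℕ, ∀ j : I p.1, ζ ((j : ℤ) + n) = p.2 j}
  have hU : ∀ p, IsOpen (U p) := by
    intro p
    have : U p = ⋃ n : ℕ, ⋂ j : I p.1, (fun ζ : ℤ → 𝒜 => ζ ((j : ℤ) + n)) ⁻¹' {p.2 j} := by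
      ext ζ; simp [U]
    rw [this]
    refine isOpen_iUnion fun n => isOpen_iInter_of_finite fun j => ?_
    exact (isOpen_discrete _).preimage (continuous_apply _)
  have hd : ∀ p, Dense (U p) := by
    rintro ⟨N, v⟩
    rw [dense_iff_inter_open]
    rintro V hV ⟨ξ, hξ⟩
    obtain ⟨J, u, hu, hJ⟩ := isOpen_pi_iff.1 hV ξ hξ
    obtain ⟨m, hm⟩ : ∃ m : ℕ, ∀ j ∈ J, j < m := by
      obtain ⟨b, hb⟩ := J.bddAbove
      refine ⟨b.toNat + 1, fun j hj => ?_⟩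
      have := hb hj
      push_cast
      have := Int.self_le_toNat b
      omega
    -- The word is written at the positions m, …, m + 2N, beyond all coordinates constrained by the
    -- given open set.
    let ζ : ℤ → 𝒜 := fun k => if h : k - (m + N : ℕ) ∈ Finset.Icc (-(N : ℤ)) N then
      v ⟨k - (m + N : ℕ), h⟩ else ξ k
    refine ⟨ζ, hJ fun j hj => ?_, m + N, fun j => ?_⟩
    · have h1 := hm j hj
      have h2 : ¬ (j - (m + N : ℕ) ∈ Finset.Icc (-(N : ℤ)) N) := by
        rw [Finset.mem_Icc]; push_cast; omega
      simp only [ζ, h2, dif_neg, not_false_eq_true]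
      exact (hu j hj).2
    · have h3 : ((j : ℤ) + (m + N : ℕ) - (m + N : ℕ)) = j := by ring
      simp only [ζ, h3]
      rw [dif_pos j.2]
  have : Nonempty (ℤ → 𝒜) := inferInstance
  have hcount : Countable (Σ N, (I N → 𝒜)) := by
    have : ∀ N, Finite (I N) := fun N => by dsimp only [I]; infer_instance
    infer_instance
  obtain ⟨ζ, hζ⟩ := (dense_iInter_of_isOpen hU hd).nonempty
  rw [mem_iInter] at hζ
  refine ⟨ζ, fun w N => ?_⟩
  obtain ⟨n, hn⟩ := hζ ⟨N, fun j => w j⟩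
  exact ⟨n, fun j hj => hn ⟨j, Finset.mem_Icc.2 (abs_le.1 hj)⟩⟩

end Symbolic

/-! ### Coding of the bounded orbits of a family of perturbations -/

/-- A family of maps `f i` that are `C¹`-close to the hyperbolic linear map `H.Λ` on the closed ball
of radius `R`, and whose bounded orbits stay away from its boundary. -/
structure NearFamily {𝒜 X : Type*} [NormedAddCommGroup X] [NormedSpace ℝ X] (H : HypLin X)
    (η R τ : ℝ) (f : 𝒜 → X → X) (Df : 𝒜 → X → X →L[ℝ] X) : Prop where
  η_nonneg : 0 ≤ η
  rate_lt : H.rate + η < 1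
  radius : (H.rate + η) * R + τ < R
  deriv : ∀ i x, ‖x‖ ≤ R → HasFDerivAt (f i) (Df i x) x
  near : ∀ i x, ‖x‖ ≤ R → ‖Df i x - (H.Λ : X →L[ℝ] X)‖ ≤ η
  zero : ∀ i, ‖f i 0‖ ≤ τ
  small : η * ‖(H.Λ.symm : X →L[ℝ] X)‖ < 1

namespace NearFamily

variable {𝒜 X : Type*} [NormedAddCommGroup X] [NormedSpace ℝ X] {H : HypLin X}
  {η R τ : ℝ} {f : 𝒜 → X → X} {Df : 𝒜 → X → X →L[ℝ] X}

/-- Mean value inequality for the difference from `Λ` on the convex ball. -/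
theorem isNear (h : NearFamily H η R τ f Df) (i : 𝒜) : H.IsNear η R (f i) := by
  intro x hx y hy
  refine (convex_closedBall (0 : X) R).norm_image_sub_le_of_norm_hasFDerivWithin_le
    (f := fun x => f i x - H.Λ x) (f' := fun x => Df i x - (H.Λ : X →L[ℝ] X))
    (fun z hz => ?_) (fun z hz => h.near i z (by simpa using hz)) (by simpa using hy) (by simpa using hx)
  exact ((h.deriv i z (by simpa using hz)).sub H.Λ.hasFDerivAt).hasFDerivWithinAt

variable [FiniteDimensional ℝ X]

/-- A kernel vector would be sent by `Λ` to a vector of norm at most `η * ‖v‖`, which `small`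
excludes; in finite dimension injectivity suffices. -/
theorem surjective_deriv (h : NearFamily H η R τ f Df) (i : 𝒜) {x : X} (hx : ‖x‖ ≤ R) :
    Function.Surjective (Df i x) := by
  have hinj : Function.Injective (Df i x : X →ₗ[ℝ] X) := by
    rw [← LinearMap.ker_eq_bot, LinearMap.ker_eq_bot']
    intro v hv
    have hv' : Df i x v = 0 := hv
    have h1 : ‖H.Λ v‖ ≤ η * ‖v‖ := by
      have := ((Df i x - (H.Λ : X →L[ℝ] X)).le_opNorm v).trans
        (mul_le_mul_of_nonneg_right (h.near i x hx) (norm_nonneg v))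
      simpa [hv'] using this
    have h2 : ‖v‖ ≤ ‖(H.Λ.symm : X →L[ℝ] X)‖ * ‖H.Λ v‖ := by
      have := (H.Λ.symm : X →L[ℝ] X).le_opNorm (H.Λ v)
      simpa using this
    have h3 := mul_le_mul_of_nonneg_left h1 (norm_nonneg (H.Λ.symm : X →L[ℝ] X))
    have h4 := h.small
    by_contra hv0
    have h5 := norm_pos_iff.2 hv0
    nlinarith
  exact LinearMap.injective_iff_surjective.1 hinj

theorem exists_code (h : NearFamily H η R τ f Df) (ξ : ℤ → 𝒜) :
    ∃ x : ℤ → X, (∀ n, ‖x n‖ ≤ R) ∧ ∀ n, x (n + 1) = f (ξ n) (x n) := by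
  have : CompleteSpace X := FiniteDimensional.complete ℝ X
  exact HypLin.exists_orbit h.η_nonneg h.rate_lt (F := fun n => f (ξ n)) (fun _ => h.isNear _)
    (fun _ => h.zero _) h.radius.le

/-- The bounded orbit with itinerary `ξ`. -/
def code (h : NearFamily H η R τ f Df) (ξ : ℤ → 𝒜) : ℤ → X := (h.exists_code ξ).choose

theorem norm_code_le (h : NearFamily H η R τ f Df) (ξ : ℤ → 𝒜) (n : ℤ) : ‖h.code ξ n‖ ≤ R :=
  (h.exists_code ξ).choose_spec.1 n

theorem code_succ (h : NearFamily H η R τ f Df) (ξ : ℤ → 𝒜) (n : ℤ) :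
    h.code ξ (n + 1) = f (ξ n) (h.code ξ n) :=
  (h.exists_code ξ).choose_spec.2 n

theorem norm_code_lt (h : NearFamily H η R τ f Df) (ξ : ℤ → 𝒜) (n : ℤ) : ‖h.code ξ n‖ < R :=
  (HypLin.orbit_norm_le h.η_nonneg (F := fun n => f (ξ n)) (fun _ => h.isNear _)
    (fun _ => h.zero _) (h.norm_code_le ξ) (h.code_succ ξ) n).trans_lt h.radius

theorem eq_code (h : NearFamily H η R τ f Df) {ξ : ℤ → 𝒜} {x : ℤ → X} (hx : ∀ n, ‖x n‖ ≤ R)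
    (hxf : ∀ n, x (n + 1) = f (ξ n) (x n)) : x = h.code ξ :=
  HypLin.orbit_unique h.η_nonneg h.rate_lt (F := fun n => f (ξ n)) (fun _ => h.isNear _) hx
    (h.norm_code_le ξ) hxf (h.code_succ ξ)

/-- A shifted bounded orbit is a bounded orbit for the shifted itinerary, so uniqueness identifies
it. -/
theorem code_shift (h : NearFamily H η R τ f Df) (ξ : ℤ → 𝒜) (m : ℤ) (n : ℤ) :
    h.code (fun k => ξ (k + m)) n = h.code ξ (n + m) := by
  refine (congrFun (h.eq_code (ξ := fun k => ξ (k + m)) (x := fun n => h.code ξ (n + m))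
    (fun _ => h.norm_code_le _ _) fun n => ?_) n).symm
  rw [← h.code_succ]
  congr 1; ring

/-- Itineraries agreeing on a window of length N in both directions have orbits that are
exponentially close in N at time 0. -/
theorem continuous_code [TopologicalSpace 𝒜] [DiscreteTopology 𝒜] (h : NearFamily H η R τ f Df) :
    Continuous fun ξ => h.code ξ 0 := by
  rw [continuous_iff_continuousAt]
  intro ξ
  rw [Metric.continuousAt_iff']
  intro ε hε
  have hκ0 : 0 ≤ H.rate + η := add_nonneg H.rate_pos.le h.η_nonneg
  have h0 : Tendsto (fun k : ℕ => (H.rate + η) ^ k * (2 * R)) atTop (𝓝 (0 * (2 * R))) :=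
    (tendsto_pow_atTop_nhds_zero_of_lt_one hκ0 h.rate_lt).mul_const _
  rw [zero_mul] at h0
  obtain ⟨N, hN⟩ := (h0.eventually (gt_mem_nhds hε)).exists
  have h1 : ∀ᶠ ξ' in 𝓝 ξ, ∀ n ∈ Icc (-(N : ℤ)) N, ξ' n = ξ n := by
    rw [eventually_all_finite (finite_Icc _ _)]
    intro n _
    have := (continuous_apply n).tendsto ξ
    exact this ((isOpen_discrete {ξ n}).mem_nhds rfl)
  filter_upwards [h1] with ξ' hξ'
  rw [dist_eq_norm]
  refine lt_of_le_of_lt ?_ hN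
  refine HypLin.norm_sub_le_of_window (N := N) h.η_nonneg (F := fun n => f (ξ' n))
    (F' := fun n => f (ξ n)) (fun _ => h.isNear _) (fun n hn => ?_) (h.norm_code_le _)
    (h.norm_code_le _) (h.code_succ _) (h.code_succ _) N 0 (by simp)
  rw [hξ' n (abs_le.1 hn)]

/-- The derivatives along the orbit with itinerary `ξ`. -/
def codeDeriv (h : NearFamily H η R τ f Df) (ξ : ℤ → 𝒜) : ℤ → X →L[ℝ] X :=
  fun n => Df (ξ n) (h.code ξ n)

theorem codeDeriv_near (h : NearFamily H η R τ f Df) (ξ : ℤ → 𝒜) (n : ℤ) :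
    ‖h.codeDeriv ξ n - (H.Λ : X →L[ℝ] X)‖ ≤ η := h.near _ _ (h.norm_code_le _ _)

theorem codeDeriv_shift (h : NearFamily H η R τ f Df) (ξ : ℤ → 𝒜) :
    h.codeDeriv (shiftMap 𝒜 ξ) = fun n => h.codeDeriv ξ (n + 1) := by
  funext n
  have : shiftMap 𝒜 ξ = fun k => ξ (k + 1) := rfl
  simp only [codeDeriv, this, h.code_shift]

end NearFamily

/-! ### Blending regions in a chart -/

/-- A parametrization `h` of an open subset of `M ⊆ V` (embedded by `ι`) by a vector space `X`,
which is `C¹` as a map to `V` and has local left inverses that extend differentiably to `V`. -/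
structure IsEmbChart {M V X : Type*} [TopologicalSpace M] [NormedAddCommGroup V] [NormedSpace ℝ V]
    [NormedAddCommGroup X] [NormedSpace ℝ X] (ι : M → V) (h : X → M) : Prop where
  inducing : IsInducing ι
  isOpenEmbedding : IsOpenEmbedding h
  contDiff : ContDiff ℝ 1 (ι ∘ h)
  leftInv : ∀ x, ∃ q : V → X, DifferentiableAt ℝ q (ι (h x)) ∧ ∀ᶠ m in 𝓝 (h x), h (q (ι m)) = m

namespace IsEmbChart

variable {M V X : Type*} [NormedAddCommGroup V] [NormedSpace ℝ V]
  [NormedAddCommGroup X] [NormedSpace ℝ X]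

section Top

variable [TopologicalSpace M] {ι : M → V} {h : X → M}

theorem hasFDerivAt (hh : IsEmbChart ι h) (x : X) :
    HasFDerivAt (ι ∘ h) (fderiv ℝ (ι ∘ h) x) x :=
  (hh.contDiff.differentiable one_ne_zero x).hasFDerivAt

/-- The linear left inverse comes from differentiating q ∘ ι ∘ h = id. -/
theorem exists_leftInv (hh : IsEmbChart ι h) (x : X) :
    ∃ (q : V → X) (Q : V →L[ℝ] X), HasFDerivAt q Q (ι (h x)) ∧
      (∀ᶠ m in 𝓝 (h x), h (q (ι m)) = m) ∧ q (ι (h x)) = x ∧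
      ∀ v, Q (fderiv ℝ (ι ∘ h) x v) = v := by
  obtain ⟨q, hq, hqm⟩ := hh.leftInv x
  have hinj := hh.isOpenEmbedding.injective
  refine ⟨q, fderiv ℝ q (ι (h x)), hq.hasFDerivAt, hqm, hinj hqm.self_of_nhds, fun v => ?_⟩
  have h1 : ∀ᶠ y in 𝓝 x, q (ι (h y)) = y := by
    filter_upwards [hh.isOpenEmbedding.continuous.continuousAt.eventually hqm] with y hy
    exact hinj hy
  have h2 : HasFDerivAt (q ∘ (ι ∘ h)) ((fderiv ℝ q (ι (h x))).comp (fderiv ℝ (ι ∘ h) x)) x :=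
    hq.hasFDerivAt.comp x (hh.hasFDerivAt x)
  have h3 : HasFDerivAt (q ∘ (ι ∘ h)) (ContinuousLinearMap.id ℝ X) x :=
    (hasFDerivAt_id x).congr_of_eventuallyEq h1
  exact DFunLike.congr_fun (h2.unique h3) v

theorem injective_fderiv (hh : IsEmbChart ι h) (x : X) :
    Function.Injective (fderiv ℝ (ι ∘ h) x) := by
  obtain ⟨q, Q, -, -, -, hQ⟩ := hh.exists_leftInv x
  exact Function.LeftInverse.injective hQ

/-- A curve whose image under `ι` is differentiable is automatically continuous at 0, because `ι` is
inducing. It therefore stays in the chart for small times, where the local left inverse pulls it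
back to a differentiable curve in `X`. -/
theorem tangentVelocities_eq (hh : IsEmbChart ι h) (x : X) :
    tangentVelocities ι (h x) = range (fderiv ℝ (ι ∘ h) x) := by
  ext v
  constructor
  · rintro ⟨g, hg0, hg⟩
    obtain ⟨q, Q, hq, hqm, hqx, hQ⟩ := hh.exists_leftInv x
    have hgc : ContinuousAt g 0 := by
      rw [hh.inducing.continuousAt_iff]
      exact hg.continuousAt
    have h1 : ∀ᶠ t in 𝓝 (0 : ℝ), h (q (ι (g t))) = g t :=
      hgc.eventually (p := fun m => h (q (ι m)) = m) (by rw [hg0]; exact hqm)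
    have h2 : HasDerivAt (fun t => q (ι (g t))) (Q v) 0 := by
      rw [← hg0] at hq
      exact hq.comp_hasDerivAt 0 hg
    have hx0 : (fun t => q (ι (g t))) 0 = x := by simp [hg0, hqx]
    have h3 : HasDerivAt (fun t => (ι ∘ h) (q (ι (g t)))) (fderiv ℝ (ι ∘ h) x (Q v)) 0 := by
      have := hh.hasFDerivAt x
      rw [← hx0] at this
      have h4 := this.comp_hasDerivAt 0 h2
      simp only [hg0, hqx] at h4
      exact h4
    have h5 : HasDerivAt (fun t => ι (g t)) (fderiv ℝ (ι ∘ h) x (Q v)) 0 := by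
      refine h3.congr_of_eventuallyEq ?_
      filter_upwards [h1] with t ht
      simp [ht]
    exact ⟨Q v, h5.unique hg⟩
  · rintro ⟨u, rfl⟩
    refine ⟨fun t => h (x + t • u), by simp, ?_⟩
    have h1 : HasDerivAt (fun t : ℝ => x + t • u) u 0 := by
      simpa using ((hasDerivAt_id (0 : ℝ)).smul_const u).const_add x
    have h2 := hh.hasFDerivAt x
    rw [show x = (fun t : ℝ => x + t • u) 0 by simp] at h2
    have h3 := h2.comp_hasDerivAt 0 h1
    simp only [zero_smul, add_zero] at h3
    exact h3

/-- The derivatives of the parametrization distort norms boundedly on balls. -/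
theorem exists_norm_bounds [FiniteDimensional ℝ X] (hh : IsEmbChart ι h) (R : ℝ) :
    ∃ K > 0, ∀ x, ‖x‖ ≤ R → ∀ v, ‖fderiv ℝ (ι ∘ h) x v‖ ≤ K * ‖v‖ ∧
      ‖v‖ ≤ K * ‖fderiv ℝ (ι ∘ h) x v‖ := by
  have : ProperSpace X := FiniteDimensional.proper ℝ X
  have hc : Continuous (fderiv ℝ (ι ∘ h)) := hh.contDiff.continuous_fderiv one_ne_zero
  have hc2 : Continuous fun p : X × X => fderiv ℝ (ι ∘ h) p.1 p.2 :=
    (hc.comp continuous_fst).clm_apply continuous_snd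
  -- Compactness of ball times unit sphere gives the upper bound and, applied to the inverse norm,
  -- which is finite by injectivity, the lower one. Homogeneity then covers all vectors.
  let S := Metric.closedBall (0 : X) R ×ˢ Metric.sphere (0 : X) 1
  have hS : IsCompact S := (isCompact_closedBall _ _).prod (isCompact_sphere _ _)
  obtain ⟨K1, hK1⟩ := hS.exists_bound_of_continuousOn hc2.continuousOn
  obtain ⟨K2, hK2⟩ := hS.exists_bound_of_continuousOn
    (f := fun p : X × X => ‖fderiv ℝ (ι ∘ h) p.1 p.2‖⁻¹)
    (hc2.norm.continuousOn.inv₀ (by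
      rintro ⟨x, v⟩ ⟨-, hv⟩ h0
      rw [norm_eq_zero] at h0
      have : v = 0 := hh.injective_fderiv x (by simpa using h0)
      simp [this] at hv))
  refine ⟨max 1 (max K1 K2), by positivity, fun x hx v => ?_⟩
  by_cases hv : v = 0
  · simp [hv]
  have hv0 := norm_pos_iff.2 hv
  let u := ‖v‖⁻¹ • v
  have hu : (x, u) ∈ S := ⟨by simpa using hx, by simp [u, norm_smul, hv0.ne']⟩
  have e : fderiv ℝ (ι ∘ h) x u = ‖v‖⁻¹ • fderiv ℝ (ι ∘ h) x v := by simp [u]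
  have e1 : ‖fderiv ℝ (ι ∘ h) x v‖ = ‖fderiv ℝ (ι ∘ h) x u‖ * ‖v‖ := by
    rw [e, norm_smul, norm_inv, norm_norm]; field_simp
  have h1 := hK1 _ hu
  have h2 := hK2 _ hu
  simp only [norm_inv, norm_norm] at h2
  have h3 : 0 < ‖fderiv ℝ (ι ∘ h) x u‖ := by
    rw [norm_pos_iff]
    intro h0
    have : u = 0 := hh.injective_fderiv x (by simpa using h0)
    simp [u, hv] at this
  refine ⟨?_, ?_⟩
  · rw [e1]
    exact mul_le_mul_of_nonneg_right (h1.trans (by simp)) hv0.le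
  · rw [e1, ← mul_assoc]
    refine le_mul_of_one_le_left hv0.le ?_
    calc (1 : ℝ) = ‖fderiv ℝ (ι ∘ h) x u‖⁻¹ * ‖fderiv ℝ (ι ∘ h) x u‖ := by field_simp
      _ ≤ _ := mul_le_mul_of_nonneg_right (h2.trans (by simp)) h3.le

end Top

section Main

variable {𝒜 : Type*} [MetricSpace M] [FiniteDimensional ℝ X]
  {ι : M → V} {h : X → M} {H : HypLin X} {η R τ : ℝ} {f : 𝒜 → X → X} {Df : 𝒜 → X → X →L[ℝ] X}
  {g : 𝒜 → Equiv.Perm M}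

omit [FiniteDimensional ℝ X] in
-- Near the point the map factors, after `ι`, as (ι ∘ h) ∘ f ∘ q applied to ι m. The ambient
-- derivative is the chain rule for this composition, and the left inverse removes `Q` on tangent
-- vectors.
theorem isEmbDeriv (hh : IsEmbChart ι h) (hf : NearFamily H η R τ f Df)
    (hg : ∀ i x, ‖x‖ ≤ R → g i (h x) = h (f i x)) (i : 𝒜) {x : X} (hx : ‖x‖ < R) :
    ∃ T : V →L[ℝ] V, IsEmbDeriv ι (g i) (h x) T ∧
      ∀ v, T (fderiv ℝ (ι ∘ h) x v) = fderiv ℝ (ι ∘ h) (f i x) (Df i x v) := by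
  obtain ⟨q, Q, hq, hqm, hqx, hQ⟩ := hh.exists_leftInv x
  refine ⟨((fderiv ℝ (ι ∘ h) (f i x)).comp (Df i x)).comp Q, ?_, fun v => by simp [hQ]⟩
  have h1 : HasFDerivAt ((ι ∘ h) ∘ f i) ((fderiv ℝ (ι ∘ h) (f i x)).comp (Df i x)) x :=
    (hh.hasFDerivAt _).comp x (hf.deriv i x hx.le)
  rw [← hqx] at h1
  have h2 := h1.comp _ hq
  simp only [hqx] at h2
  have hι : ContinuousAt ι (h x) := hh.inducing.continuous.continuousAt
  have h3 := h2.isLittleO.comp_tendsto hι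
  have hin : ∀ᶠ m in 𝓝 (h x), ‖q (ι m)‖ < R := by
    have : ContinuousAt (fun m => ‖q (ι m)‖) (h x) :=
      (ContinuousAt.comp (f := ι) (g := q) hq.continuousAt hι).norm
    refine this.eventually (p := fun r => r < R) ?_
    simp only [hqx]
    exact gt_mem_nhds hx
  unfold IsEmbDeriv
  refine h3.congr' ?_ (Eventually.of_forall fun _ => rfl)
  filter_upwards [hqm, hin] with m hm hmR
  simp only [Function.comp_apply, hqx]
  rw [← hg i _ hmR.le, hm, ← hg i x hx.le]

/-- The maximal invariant set is the graph of the coding. -/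
theorem mem_maxInvariant_iff (hh : IsEmbChart ι h) (hf : NearFamily H η R τ f Df)
    (hg : ∀ i x, ‖x‖ ≤ R → g i (h x) = h (f i x)) {K : Set M} (hK : h '' Metric.ball 0 R ⊆ K)
    (hK' : K ⊆ h '' Metric.closedBall 0 R) (z : (ℤ → 𝒜) × M) :
    z ∈ maxInvariant g K ↔ z.2 = h (hf.code z.1 0) := by
  rw [mem_maxInvariant]
  constructor
  · intro hz
    choose x hx hxz using fun n => hK' (hz n)
    simp only [mem_closedBall_zero_iff] at hx
    have : x = hf.code z.1 := by
      apply hf.eq_code hx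
      intro n
      apply hh.isOpenEmbedding.injective
      rw [← hg _ _ (hx n), hxz, hxz, add_comm n 1, zpow_one_add, Equiv.Perm.mul_apply]
      have : ((oneStep g ^ n) z).1 0 = z.1 n := by rw [oneStep_zpow_fst, zero_add]
      rw [← this]
      rfl
    rw [← this, hxz]
    simp
  · intro hz n
    let w : ℤ → (ℤ → 𝒜) × M := fun n => (fun k => z.1 (k + n), h (hf.code z.1 n))
    have hw : ∀ n, oneStep g (w n) = w (n + 1) := by
      intro n
      refine Prod.ext ?_ ?_
      · funext k
        exact congrArg z.1 (by ring)
      · change g (z.1 (0 + n)) (h (hf.code z.1 n)) = h (hf.code z.1 (n + 1))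
        rw [zero_add, hf.code_succ, hg _ _ (hf.norm_code_le _ _)]
    have h0 : w 0 = z := by
      refine Prod.ext ?_ ?_
      · funext k
        exact congrArg z.1 (by ring)
      · exact hz.symm
    rw [← h0, Equiv.Perm.zpow_apply_of_orbit _ hw]
    exact hK ⟨_, by simpa using hf.norm_code_lt _ _, rfl⟩

variable [TopologicalSpace 𝒜] [DiscreteTopology 𝒜] [Finite 𝒜] [Nonempty 𝒜]

omit [Nonempty 𝒜] in
-- The splitting is the image, under the derivative of the chart, of `stab` and `unst` for the
-- derivatives along the coded orbit. Compactness holds because the set is a continuous image of the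
-- full shift.
theorem isHyperbolicSet (hh : IsEmbChart ι h) (hf : NearFamily H η R τ f Df)
    (hg : ∀ i x, ‖x‖ ≤ R → g i (h x) = h (f i x)) {Γ : Set ((ℤ → 𝒜) × M)}
    (hΓ : ∀ z, z ∈ Γ ↔ z.2 = h (hf.code z.1 0)) (hinv : oneStep g '' Γ = Γ) :
    IsHyperbolicSet ι g Γ (Module.finrank ℝ (LinearMap.range (H.Ps : X →ₗ[ℝ] X))) := by
  have hnext : ∀ z ∈ Γ, oneStep g z ∈ Γ := fun z hz => hinv ▸ mem_image_of_mem _ hz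
  refine ⟨?_, hinv, ?_⟩
  · have : Γ = range fun ξ => (ξ, h (hf.code ξ 0)) := by
      ext z
      rw [hΓ]
      constructor
      · intro hz
        exact ⟨z.1, Prod.ext rfl hz.symm⟩
      · rintro ⟨ξ, rfl⟩
        rfl
    rw [this]
    have : CompactSpace (ℤ → 𝒜) := inferInstance
    exact isCompact_range (continuous_id.prodMk
      (hh.isOpenEmbedding.continuous.comp hf.continuous_code))
  let E : (ℤ → 𝒜) → X →L[ℝ] V := fun ξ => fderiv ℝ (ι ∘ h) (hf.code ξ 0)
  have hEinj : ∀ ξ, Function.Injective (E ξ) := fun ξ => hh.injective_fderiv _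
  have hcode : ∀ ξ, hf.code (shiftMap 𝒜 ξ) 0 = f (ξ 0) (hf.code ξ 0) := by
    intro ξ
    have : shiftMap 𝒜 ξ = fun k => ξ (k + 1) := rfl
    rw [this, hf.code_shift, hf.code_succ]
  choose T hT hTE using fun z : (ℤ → 𝒜) × M =>
    hh.isEmbDeriv hf hg (z.1 0) (hf.norm_code_lt z.1 0)
  have hTE' : ∀ z v, T z (E z.1 v) = E (shiftMap 𝒜 z.1) (hf.codeDeriv z.1 0 v) := by
    intro z v
    simp only [E, hcode]
    exact hTE z v
  have hnear := hf.codeDeriv_near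
  have hκ := hf.rate_lt
  have : CompleteSpace X := FiniteDimensional.complete ℝ X
  refine ⟨T, fun z => (HypLin.stab (hf.codeDeriv z.1)).map (E z.1 : X →ₗ[ℝ] V),
    fun z => (HypLin.unst (hf.codeDeriv z.1)).map (E z.1 : X →ₗ[ℝ] V), fun z hz => ⟨?_, ?_, ?_, ?_, ?_, ?_⟩, ?_⟩
  · have := hT z
    rwa [← (hΓ z).1 hz] at this
  · rw [← Submodule.map_sup, HypLin.stab_sup_unst (hnear z.1) hκ, (hΓ z).1 hz,
      hh.tangentVelocities_eq, Submodule.map_top]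
    rfl
  · exact Submodule.disjoint_map (f := (E z.1 : X →ₗ[ℝ] V)) (hEinj _)
      (HypLin.disjoint_stab_unst (hnear z.1) hκ)
  · rw [← HypLin.finrank_stab (hnear z.1) hκ]
    exact (Submodule.equivMapOfInjective (E z.1 : X →ₗ[ℝ] V) (hEinj _) _).finrank_eq.symm
  · have e : (T z : V →ₗ[ℝ] V) ∘ₗ (E z.1 : X →ₗ[ℝ] V)
        = (E (shiftMap 𝒜 z.1) : X →ₗ[ℝ] V) ∘ₗ (hf.codeDeriv z.1 0 : X →ₗ[ℝ] X) :=
      LinearMap.ext fun v => hTE' z v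
    rw [← Submodule.map_comp, e, Submodule.map_comp,
      HypLin.map_stab (hf.surjective_deriv _ (hf.norm_code_le _ _)), ← hf.codeDeriv_shift]
    rfl
  · have e : (T z : V →ₗ[ℝ] V) ∘ₗ (E z.1 : X →ₗ[ℝ] V)
        = (E (shiftMap 𝒜 z.1) : X →ₗ[ℝ] V) ∘ₗ (hf.codeDeriv z.1 0 : X →ₗ[ℝ] X) :=
      LinearMap.ext fun v => hTE' z v
    rw [← Submodule.map_comp, e, Submodule.map_comp, HypLin.map_unst, ← hf.codeDeriv_shift]
    rfl
  · obtain ⟨K, hK0, hK⟩ := hh.exists_norm_bounds R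
    have hκ0 : 0 < H.rate + η := add_pos_of_pos_of_nonneg H.rate_pos hf.η_nonneg
    -- One factor `K` is paid for passing into the chart at the initial point and one for leaving it
    -- at the final point; the rate is not affected.
    refine ⟨K * K, by positivity, H.rate + η, hκ0, hκ, fun z hz => ?_⟩
    have hs : ∀ n : ℕ, ∀ v ∈ HypLin.stab (hf.codeDeriv z.1), ∃ v' ∈ HypLin.stab
        (hf.codeDeriv ((oneStep g ^ n) z).1), cocycle g T n z (E z.1 v)
          = E ((oneStep g ^ n) z).1 v' ∧ ‖v'‖ ≤ (H.rate + η) ^ n * ‖v‖ := by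
      intro n v hv
      induction n with
      | zero => exact ⟨v, hv, rfl, by simp⟩
      | succ n ih =>
        obtain ⟨v', hv', e, hle⟩ := ih
        refine ⟨hf.codeDeriv ((oneStep g ^ n) z).1 0 v', ?_, ?_, ?_⟩
        · have := HypLin.map_mem_stab hv'
          rw [← hf.codeDeriv_shift] at this
          rwa [pow_succ']
        · rw [pow_succ']
          change T _ (cocycle g T n z (E z.1 v)) = _
          rw [e, hTE']
          rfl
        · rw [pow_succ', mul_assoc]
          exact (HypLin.norm_map_stab_le (hnear _) hκ hv').trans
            (mul_le_mul_of_nonneg_left hle hκ0.le)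
    have hu : ∀ n : ℕ, ∀ v ∈ HypLin.unst (hf.codeDeriv z.1), ∃ v' ∈ HypLin.unst
        (hf.codeDeriv ((oneStep g ^ n) z).1), cocycle g T n z (E z.1 v)
          = E ((oneStep g ^ n) z).1 v' ∧ ‖v‖ ≤ (H.rate + η) ^ n * ‖v'‖ := by
      intro n v hv
      induction n with
      | zero => exact ⟨v, hv, rfl, by simp⟩
      | succ n ih =>
        obtain ⟨v', hv', e, hle⟩ := ih
        refine ⟨hf.codeDeriv ((oneStep g ^ n) z).1 0 v', ?_, ?_, ?_⟩
        · have := HypLin.map_mem_unst hv'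
          rw [← hf.codeDeriv_shift] at this
          rwa [pow_succ']
        · rw [pow_succ']
          change T _ (cocycle g T n z (E z.1 v)) = _
          rw [e, hTE']
          rfl
        · rw [pow_succ, mul_assoc]
          exact hle.trans (mul_le_mul_of_nonneg_left
            (HypLin.norm_unst_le (hnear _) hκ hv') (pow_nonneg hκ0.le _))
    refine fun n => ⟨?_, ?_⟩
    · rintro _ ⟨v, hv, rfl⟩
      obtain ⟨v', -, e, hle⟩ := hs n v hv
      change ‖cocycle g T n z (E z.1 v)‖ ≤ K * K * (H.rate + η) ^ n * ‖E z.1 v‖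
      rw [e]
      have h1 := (hK _ (hf.norm_code_le ((oneStep g ^ n) z).1 0) v').1
      have h2 := (hK _ (hf.norm_code_le z.1 0) v).2
      have h3 := pow_nonneg hκ0.le n
      calc ‖E ((oneStep g ^ n) z).1 v'‖ ≤ K * ‖v'‖ := h1
        _ ≤ K * ((H.rate + η) ^ n * ‖v‖) := mul_le_mul_of_nonneg_left hle hK0.le
        _ ≤ K * ((H.rate + η) ^ n * (K * ‖E z.1 v‖)) := by gcongr
        _ = _ := by ring
    · rintro _ ⟨v, hv, rfl⟩
      obtain ⟨v', -, e, hle⟩ := hu n v hv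
      change ‖E z.1 v‖ ≤ K * K * (H.rate + η) ^ n * ‖cocycle g T n z (E z.1 v)‖
      rw [e]
      have h1 := (hK _ (hf.norm_code_le ((oneStep g ^ n) z).1 0) v').2
      have h2 := (hK _ (hf.norm_code_le z.1 0) v).1
      have h3 := pow_nonneg hκ0.le n
      calc ‖E z.1 v‖ ≤ K * ‖v‖ := h2
        _ ≤ K * ((H.rate + η) ^ n * ‖v'‖) := mul_le_mul_of_nonneg_left hle hK0.le
        _ ≤ K * ((H.rate + η) ^ n * (K * ‖E ((oneStep g ^ n) z).1 v'‖)) := by gcongr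
        _ = _ := by ring

omit [FiniteDimensional ℝ X] [TopologicalSpace 𝒜] [DiscreteTopology 𝒜] [Finite 𝒜] [Nonempty 𝒜] in
theorem closure_image_ball_subset [ProperSpace X] (hh : IsEmbChart ι h) (s : ℝ) :
    closure (h '' Metric.ball 0 s) ⊆ h '' Metric.closedBall 0 s :=
  closure_minimal (image_mono Metric.ball_subset_closedBall)
    ((isCompact_closedBall _ _).image hh.isOpenEmbedding.continuous).isClosed

/-- The section ξ ↦ (ξ, h (code ξ 0)) is continuous and intertwines the shift with the skew-product,
so it carries a dense shift orbit to a dense orbit. -/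
theorem isTransitiveSet (hh : IsEmbChart ι h) (hf : NearFamily H η R τ f Df)
    {Γ : Set ((ℤ → 𝒜) × M)}
    (hΓ : ∀ z, z ∈ Γ ↔ z.2 = h (hf.code z.1 0)) (hinv : oneStep g '' Γ = Γ) :
    IsTransitiveSet g Γ := by
  obtain ⟨ζ, hζ⟩ := exists_dense_shift_orbit 𝒜
  let s : (ℤ → 𝒜) → (ℤ → 𝒜) × M := fun ξ => (ξ, h (hf.code ξ 0))
  have hs : Continuous s := continuous_id.prodMk
      (hh.isOpenEmbedding.continuous.comp hf.continuous_code)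
  have hsΓ : ∀ z ∈ Γ, z = s z.1 := fun z hz => Prod.ext rfl ((hΓ z).1 hz)
  have hnext : ∀ z ∈ Γ, oneStep g z ∈ Γ := fun z hz => hinv ▸ mem_image_of_mem _ hz
  have horb : ∀ n : ℕ, (oneStep g ^ n) (s ζ) = s fun k => ζ (k + n) := by
    intro n
    have h1 : (oneStep g ^ n) (s ζ) ∈ Γ := by
      induction n with
      | zero => exact (hΓ _).2 rfl
      | succ n ih => rw [pow_succ']; exact hnext _ ih
    rw [hsΓ _ h1]
    congr 1
    funext k
    have := oneStep_zpow_fst g (s ζ) n k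
    simpa using this
  refine ⟨s ζ, (hΓ _).2 rfl, fun z hz => ?_⟩
  rw [hsΓ z hz, mem_closure_iff_nhds]
  intro U hU
  obtain ⟨J, u, hu, hJ⟩ : ∃ (J : Finset ℤ) (u : ℤ → Set 𝒜), (∀ j ∈ J, z.1 j ∈ u j) ∧
      (J : Set ℤ).pi u ⊆ s ⁻¹' interior U := by
    obtain ⟨J, u, hu, hJ⟩ := isOpen_pi_iff.1 (isOpen_interior.preimage hs) z.1
      (mem_interior_iff_mem_nhds.2 hU)
    exact ⟨J, u, fun j hj => (hu j hj).2, hJ⟩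
  obtain ⟨N, hN⟩ : ∃ N : ℕ, ∀ j ∈ J, |j| ≤ N := by
    refine ⟨J.sup Int.natAbs, fun j hj => ?_⟩
    have := Finset.le_sup (f := Int.natAbs) hj
    rw [Int.abs_eq_natAbs]
    exact_mod_cast this
  obtain ⟨n, hn⟩ := hζ z.1 N
  refine ⟨_, interior_subset (hJ (a := fun k => ζ (k + n)) fun j hj => ?_), n, horb n⟩
  have := hu j hj
  rwa [← hn j (hN j hj)] at this

/-- A family which in a chart is close to a hyperbolic linear map has a blending region, provided
that it covers. -/
theorem isCsBlendingRegion (hh : IsEmbChart ι h) (hf : NearFamily H η R τ f Df)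
    (hg : ∀ i x, ‖x‖ ≤ R → g i (h x) = h (f i x)) (hlip : ∀ i, IsLocallyBiLipschitz (g i))
    (hR : 1 < R) (hcover : closure (h '' Metric.ball 0 1) ⊆ ⋃ i, g i '' (h '' Metric.ball 0 1))
    (hpos : 0 < Module.finrank ℝ (LinearMap.range (H.Ps : X →ₗ[ℝ] X))) :
    IsCsBlendingRegion ι g (h '' Metric.ball 0 1) (h '' Metric.ball 0 R)
      (Module.finrank ℝ (LinearMap.range (H.Ps : X →ₗ[ℝ] X))) := by
  have : ProperSpace X := FiniteDimensional.proper ℝ X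
  have hΓ := hh.mem_maxInvariant_iff hf hg subset_closure (hh.closure_image_ball_subset R)
  have hbdd : ∀ s, Bornology.IsBounded (h '' Metric.ball 0 s) := fun s =>
    ((isCompact_closedBall (0 : X) s).image hh.isOpenEmbedding.continuous).isBounded.subset
      (image_mono Metric.ball_subset_closedBall)
  exact
  { locallyBiLipschitz := hlip
    isOpen_B := hh.isOpenEmbedding.isOpenMap _ Metric.isOpen_ball
    isOpen_D := hh.isOpenEmbedding.isOpenMap _ Metric.isOpen_ball
    isBounded_B := hbdd 1
    isBounded_D := hbdd R
    closure_subset := (hh.closure_image_ball_subset 1).trans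
      (image_mono (Metric.closedBall_subset_ball hR))
    cover := hcover
    isolated := fun z hz => ⟨mem_univ _, by
      rw [(hΓ z).1 hz]
      exact ⟨_, by simpa using hf.norm_code_lt _ _, rfl⟩⟩
    transitive := hh.isTransitiveSet hf hΓ (image_maxInvariant _ _)
    hyperbolic := hh.isHyperbolicSet hf hg hΓ (image_maxInvariant _ _)
    index_pos := hpos }

end Main

end IsEmbChart

/-! ### Lipschitz estimates for the gap metric -/

theorem Gr.dist_eq {ℓ c : ℕ} (F F' : Gr ℓ c) : dist F F' = ‖F.proj - F'.proj‖ := by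
  rw [← dist_eq_norm]; rfl

section Gap

variable {E : Type*} [NormedAddCommGroup E] [InnerProductSpace ℝ E] [FiniteDimensional ℝ E]

/-- A symmetric bound for the gap between two subspaces. -/
theorem norm_starProjection_sub_le {A B : Submodule ℝ E} {K : ℝ}
    (h1 : ∀ w ∈ A, ‖w - B.starProjection w‖ ≤ K * ‖w‖)
    (h2 : ∀ w ∈ B, ‖w - A.starProjection w‖ ≤ K * ‖w‖) (hK : 0 ≤ K) :
    ‖A.starProjection - B.starProjection‖ ≤ K + K := by
  let P := A.starProjection
  let Q := B.starProjection
  have hle : ∀ (A B : Submodule ℝ E), (∀ w ∈ A, ‖w - B.starProjection w‖ ≤ K * ‖w‖) →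
      ‖(1 - B.starProjection) * A.starProjection‖ ≤ K := by
    intro A B h
    refine ContinuousLinearMap.opNorm_le_bound _ hK fun x => ?_
    refine (h _ (A.starProjection_apply_mem x)).trans ?_
    exact mul_le_mul_of_nonneg_left (A.norm_starProjection_apply_le x) hK
  -- Both projections are self-adjoint and adjoints preserve the norm, so the gap splits into two
  -- one-sided gaps.
  have e : P - Q = (1 - Q) * P - star ((1 - P) * Q) := by
    have hP : star P = P := isSelfAdjoint_starProjection A
    have hQ : star Q = Q := isSelfAdjoint_starProjection B
    rw [star_mul, star_sub, star_one, hP, hQ]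
    noncomm_ring
  change ‖P - Q‖ ≤ _
  rw [e]
  refine (norm_sub_le _ _).trans (add_le_add (hle A B h1) ?_)
  rw [ContinuousLinearMap.star_eq_adjoint, LinearIsometryEquiv.norm_map]
  exact hle B A h2

/-- The left-hand vector is the projection of `w - w'` to the orthogonal complement. -/
theorem dist_starProjection_le {A : Submodule ℝ E} (w : E) {w' : E} (hw' : w' ∈ A) :
    ‖w - A.starProjection w‖ ≤ ‖w - w'‖ := by
  have h : w - A.starProjection w = Aᗮ.starProjection (w - w') := by
    rw [A.starProjection_orthogonal_val, map_sub, Submodule.starProjection_eq_self_iff.2 hw']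
    abel
  rw [h]
  exact Aᗮ.norm_starProjection_apply_le _

/-- The gap between the images of two subspaces under two injective maps. -/
theorem norm_starProjection_map_sub_le (F F' : Submodule ℝ E) (T T' : E →L[ℝ] E) {N D K : ℝ}
    (hN : 0 ≤ N) (hT : ∀ v, ‖v‖ ≤ N * ‖T v‖) (hT' : ∀ v, ‖v‖ ≤ N * ‖T' v‖)
    (hTD : ‖T‖ ≤ D) (hTD' : ‖T'‖ ≤ D)
    (hK : ‖T - T'‖ + D * ‖F.starProjection - F'.starProjection‖ ≤ K) :
    ‖(F.map (T : E →ₗ[ℝ] E)).starProjection - (F'.map (T' : E →ₗ[ℝ] E)).starProjection‖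
      ≤ K * N + K * N := by
  have hK0 : 0 ≤ K := le_trans (add_nonneg (norm_nonneg _)
    (mul_nonneg ((norm_nonneg _).trans hTD) (norm_nonneg _))) hK
  have key : ∀ (F F' : Submodule ℝ E) (T T' : E →L[ℝ] E), (∀ v, ‖v‖ ≤ N * ‖T v‖) → ‖T'‖ ≤ D →
      ‖T - T'‖ + D * ‖F.starProjection - F'.starProjection‖ ≤ K →
      ∀ w ∈ F.map (T : E →ₗ[ℝ] E), ‖w - (F'.map (T' : E →ₗ[ℝ] E)).starProjection w‖
        ≤ K * N * ‖w‖ := by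
    rintro F F' T T' hT hD hK _ ⟨v, hv, rfl⟩
    have hD0 := (norm_nonneg _).trans hD
    -- The competitor for the distance from `T v` to the second image is `T' v'`, where `v'` is the
    -- projection of `v` to `F'`.
    let v' := F'.starProjection v
    refine (dist_starProjection_le _ (A := F'.map (T' : E →ₗ[ℝ] E)) (w' := T' v')
      ⟨v', F'.starProjection_apply_mem v, rfl⟩).trans ?_
    have hvF : F.starProjection v = v := Submodule.starProjection_eq_self_iff.2 hv
    have e : T v - T' v' = (T - T') v + T' ((F.starProjection - F'.starProjection) v) := by
      simp only [sub_apply, hvF, map_sub, v']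
      abel
    change ‖T v - T' v'‖ ≤ K * N * ‖T v‖
    rw [e]
    have h1 := (T - T').le_opNorm v
    have h2 := T'.le_opNorm ((F.starProjection - F'.starProjection) v)
    have h3 := (F.starProjection - F'.starProjection).le_opNorm v
    calc _ ≤ ‖T - T'‖ * ‖v‖ + D * (‖F.starProjection - F'.starProjection‖ * ‖v‖) := by
          refine (norm_add_le _ _).trans (add_le_add h1 (h2.trans ?_))
          exact mul_le_mul hD h3 (norm_nonneg _) hD0
      _ = (‖T - T'‖ + D * ‖F.starProjection - F'.starProjection‖) * ‖v‖ := by ring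
      _ ≤ K * (N * ‖T v‖) := mul_le_mul hK (hT v) (norm_nonneg _) hK0
      _ = _ := by ring
  refine norm_starProjection_sub_le (key F F' T T' hT hTD' hK) (key F' F T' T hT' hTD ?_)
    (mul_nonneg hK0 hN)
  rwa [norm_sub_rev, norm_sub_rev F'.starProjection]

end Gap

/-! ### Lipschitz estimates and partial hyperbolicity of the twisted and lifted maps. -/

namespace EucDiffeo

variable {c : ℕ} {r : WithTop ℕ∞} {ℓ : ℕ}

theorem norm_le_mul_fderiv (hr : 1 ≤ r) (ψ : EucDiffeo c r) (x v : Euc c) :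
    ‖v‖ ≤ ‖fderiv ℝ ψ.symm (ψ x)‖ * ‖fderiv ℝ ψ x v‖ := by
  have h := DFunLike.congr_fun (EucDiffeo.fderiv_symm_comp hr ψ x) v
  simp only [ContinuousLinearMap.comp_apply, ContinuousLinearMap.id_apply] at h
  conv_lhs => rw [← h]
  exact (fderiv ℝ ψ.symm (ψ x)).le_opNorm _

/-- The base contributes `K`. In the plane direction, the change of the derivative and the change of
the plane contribute `2 * K` together, the inverse derivative another `K`, and the two one-sided
gaps a factor 2, hence `4 * K * K`. -/
theorem lipschitzOnWith_hat (hr : 1 ≤ r) (ψ : EucDiffeo c r) {s : Set (Euc c)} {K : ℝ≥0}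
    (h0 : LipschitzOnWith K ψ s) (h1 : LipschitzOnWith K (fderiv ℝ ψ) s)
    (h2 : ∀ x ∈ s, ‖fderiv ℝ ψ x‖ ≤ K) (h3 : ∀ x ∈ s, ‖fderiv ℝ ψ.symm (ψ x)‖ ≤ K) :
    LipschitzOnWith (K + 4 * K * K) (ψ.hat ℓ hr) (s ×ˢ univ) := by
  apply LipschitzOnWith.of_dist_le_mul
  rintro ⟨x, F⟩ ⟨hx, -⟩ ⟨y, F'⟩ ⟨hy, -⟩
  simp only at hx hy
  have hK := K.coe_nonneg
  set d := dist (x, F) (y, F') with hd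
  have hd0 : 0 ≤ d := dist_nonneg
  have hdx : dist x y ≤ d := le_max_left _ _
  have hdF : dist F F' ≤ d := le_max_right _ _
  push_cast
  apply max_le
  · have := h0.dist_le_mul x hx y hy
    calc dist (ψ x) (ψ y) ≤ K * dist x y := this
      _ ≤ K * d := mul_le_mul_of_nonneg_left hdx hK
      _ ≤ _ := by nlinarith [mul_nonneg (mul_nonneg hK hK) hd0]
  · have hb : ∀ x ∈ s, ∀ v, ‖v‖ ≤ K * ‖fderiv ℝ ψ x v‖ := fun x hx v =>
      (norm_le_mul_fderiv hr ψ x v).trans (mul_le_mul_of_nonneg_right (h3 x hx) (norm_nonneg _))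
    have h4 : ‖fderiv ℝ ψ x - fderiv ℝ ψ y‖ + K * ‖F.1.starProjection - F'.1.starProjection‖
        ≤ 2 * K * d := by
      have h5 := h1.dist_le_mul x hx y hy
      rw [dist_eq_norm] at h5
      have h6 := mul_le_mul_of_nonneg_left hdx hK
      have h7 := mul_le_mul_of_nonneg_left hdF hK
      rw [Gr.dist_eq] at h7
      have h8 : K * ‖F.1.starProjection - F'.1.starProjection‖ ≤ K * d := h7
      linarith
    have := norm_starProjection_map_sub_le F.1 F'.1 (fderiv ℝ ψ x) (fderiv ℝ ψ y) hK (hb x hx)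
      (hb y hy) (h2 x hx) (h2 y hy) h4
    have e : dist (ψ.hat ℓ hr (x, F)).2 (ψ.hat ℓ hr (y, F')).2
      = ‖(F.1.map (fderiv ℝ ψ x : Euc c →ₗ[ℝ] Euc c)).starProjection
        - (F'.1.map (fderiv ℝ ψ y : Euc c →ₗ[ℝ] Euc c)).starProjection‖ := Gr.dist_eq _ _
    rw [e]
    refine this.trans ?_
    nlinarith [mul_nonneg hK hd0]

/-- As r ≥ 2, the derivative is C¹, hence locally Lipschitz, and the norms of the derivatives of the
map and its inverse are locally bounded; one constant dominating all four bounds is used. -/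
theorem locallyLipschitz_hat (hr : 2 ≤ r) (ψ : EucDiffeo c r) :
    LocallyLipschitz (ψ.hat ℓ (one_le_two.trans hr)) := by
  rintro ⟨x, F⟩
  have h2 : ContDiff ℝ 2 ψ := ψ.contDiff.of_le hr
  have h2' : ContDiff ℝ 2 ψ.symm := ψ.symm.contDiff.of_le hr
  have hd : ContDiff ℝ 1 (fderiv ℝ ψ) := h2.fderiv_right (by norm_num [one_add_one_eq_two])
  have hd' : ContDiff ℝ 1 (fderiv ℝ ψ.symm) := h2'.fderiv_right (by norm_num [one_add_one_eq_two])
  obtain ⟨K1, s1, hs1, hK1⟩ := (h2.of_le one_le_two).locallyLipschitz x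
  obtain ⟨K2, s2, hs2, hK2⟩ := hd.locallyLipschitz x
  have hc3 : Continuous fun y => ‖fderiv ℝ ψ y‖₊ := hd.continuous.nnnorm
  have hc4 : Continuous fun y => ‖fderiv ℝ ψ.symm (ψ y)‖₊ :=
    (hd'.continuous.comp ψ.continuous).nnnorm
  have h3 : ∀ᶠ y in 𝓝 x, ‖fderiv ℝ ψ y‖₊ < ‖fderiv ℝ ψ x‖₊ + 1 :=
    hc3.continuousAt.eventually (gt_mem_nhds (lt_add_one _))
  have h4 : ∀ᶠ y in 𝓝 x, ‖fderiv ℝ ψ.symm (ψ y)‖₊ < ‖fderiv ℝ ψ.symm (ψ x)‖₊ + 1 :=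
    hc4.continuousAt.eventually (gt_mem_nhds (lt_add_one _))
  let K : ℝ≥0 := K1 + K2 + (‖fderiv ℝ ψ x‖₊ + 1) + (‖fderiv ℝ ψ.symm (ψ x)‖₊ + 1)
  have e1 : K1 ≤ K := by
    simp only [K, add_assoc]; exact le_self_add
  have e2 : K2 ≤ K := by
    simp only [K, add_assoc]; exact le_add_left le_self_add
  have e3 : (‖fderiv ℝ ψ x‖₊ + 1) ≤ K := by
    simp only [K]; exact le_add_right (le_add_left le_rfl)
  have e4 : (‖fderiv ℝ ψ.symm (ψ x)‖₊ + 1) ≤ K := le_add_left le_rfl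
  let s := (s1 ∩ s2) ∩ {y | ‖fderiv ℝ ψ y‖₊ < ‖fderiv ℝ ψ x‖₊ + 1 ∧
    ‖fderiv ℝ ψ.symm (ψ y)‖₊ < ‖fderiv ℝ ψ.symm (ψ x)‖₊ + 1}
  have hs : s ∈ 𝓝 x := inter_mem (inter_mem hs1 hs2) (h3.and h4)
  refine ⟨K + 4 * K * K, s ×ˢ univ, prod_mem_nhds hs univ_mem, ?_⟩
  apply lipschitzOnWith_hat
  · exact (hK1.mono fun y hy => hy.1.1).weaken e1
  · exact (hK2.mono fun y hy => hy.1.2).weaken e2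
  · intro y hy
    exact NNReal.coe_le_coe.2 (hy.2.1.le.trans e3)
  · intro y hy
    exact NNReal.coe_le_coe.2 (hy.2.2.le.trans e4)

theorem isLocallyBiLipschitz_hat (hr : 2 ≤ r) (ψ : EucDiffeo c r) :
    IsLocallyBiLipschitz (ψ.hat ℓ (one_le_two.trans hr)) :=
  ⟨locallyLipschitz_hat hr ψ, locallyLipschitz_hat hr ψ.symm⟩

theorem isLocallyBiLipschitz (hr : 1 ≤ r) (ψ : EucDiffeo c r) :
    IsLocallyBiLipschitz ψ.toEquiv :=
  ⟨(ψ.contDiff.of_le hr).locallyLipschitz, (ψ.symm.contDiff.of_le hr).locallyLipschitz⟩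

theorem lipschitzWith_hat (hr : 1 ≤ r) (ψ : EucDiffeo c r) {K : ℝ≥0}
    (h0 : LipschitzWith K ψ) (h0' : LipschitzWith K ψ.symm) (h1 : LipschitzWith K (fderiv ℝ ψ)) :
    LipschitzWith (K + 4 * K * K) (ψ.hat ℓ hr) := by
  rw [← lipschitzOnWith_univ, ← univ_prod_univ]
  exact lipschitzOnWith_hat hr ψ h0.lipschitzOnWith h1.lipschitzOnWith
    (fun x _ => norm_fderiv_le_of_lipschitz ℝ h0) (fun x _ => norm_fderiv_le_of_lipschitz ℝ h0')

theorem fderiv_affineTwist (hr : 1 ≤ r) (φ : EucDiffeo c r) (A : Euc c ≃ₗᵢ[ℝ] Euc c) (b x : Euc c) :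
    fderiv ℝ (φ.affineTwist A b) x
      = (A.toContinuousLinearEquiv : Euc c →L[ℝ] Euc c).comp (fderiv ℝ φ x) := by
  have h : HasFDerivAt φ (fderiv ℝ φ x) x :=
    (φ.contDiff.differentiable (zero_lt_one.trans_le hr).ne' x).hasFDerivAt
  have h2 := ((A.toContinuousLinearEquiv : Euc c →L[ℝ] Euc c).hasFDerivAt.comp x h).add_const b
  exact h2.fderiv

theorem fderiv_affineTwist_symm (hr : 1 ≤ r) (φ : EucDiffeo c r) (A : Euc c ≃ₗᵢ[ℝ] Euc c)
    (b x : Euc c) : fderiv ℝ (φ.affineTwist A b).symm x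
      = (fderiv ℝ φ.symm (A.symm (x - b))).comp
        (A.symm.toContinuousLinearEquiv : Euc c →L[ℝ] Euc c) := by
  have h : HasFDerivAt φ.symm (fderiv ℝ φ.symm (A.symm (x - b))) (A.symm (x - b)) :=
    (φ.symm.contDiff.differentiable (zero_lt_one.trans_le hr).ne' _).hasFDerivAt
  have h1 : HasFDerivAt (fun x => A.symm (x - b))
      (A.symm.toContinuousLinearEquiv : Euc c →L[ℝ] Euc c) x := by
    have h3 := (A.symm.toContinuousLinearEquiv : Euc c →L[ℝ] Euc c).hasFDerivAt.comp x
      ((hasFDerivAt_id x).sub_const b)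
    exact h3
  have h2 := h.comp x h1
  have e : ⇑(φ.affineTwist A b).symm = fun x => φ.symm (A.symm (x - b)) := by
    funext y
    rw [sub_eq_add_neg]
    rfl
  rw [e]
  exact h2.fderiv

theorem dist_affineTwist (φ : EucDiffeo c r) (A : Euc c ≃ₗᵢ[ℝ] Euc c) (b x y : Euc c) :
    dist (φ.affineTwist A b x) (φ.affineTwist A b y) = dist (φ x) (φ y) := by
  rw [affineTwist_apply, affineTwist_apply, dist_add_right, A.dist_map]

/-- Composing with an isometry changes no distance between images, so the same constants serve. -/
theorem isPHS_twists {𝒜 : Type*} (φ : EucDiffeo c r) (A : 𝒜 → Euc c ≃ₗᵢ[ℝ] Euc c) (b : 𝒜 → Euc c)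
    {κ : ℝ} (h : IsPHS κ fun _ : 𝒜 => φ.toEquiv) :
    IsPHS κ fun i => (φ.twists A b i).toEquiv := by
  obtain ⟨h0, γ, γ', h1, h2, h3, h4, h5⟩ := h
  refine ⟨h0, γ, γ', h1, h2, h3, h4, fun i x y hxy => ?_⟩
  have := h5 i x y hxy
  have e : dist ((φ.twists A b i).toEquiv x) ((φ.twists A b i).toEquiv y)
    = dist (φ.toEquiv x) (φ.toEquiv y) := dist_affineTwist φ (A i) (b i) x y
  rwa [e]

/-- Since the rate may be chosen freely, any uniform bi-Lipschitz bound is enough. -/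
theorem exists_isPHS_of_lipschitz {𝒜 M : Type*} [MetricSpace M] {g : 𝒜 → Equiv.Perm M} {K : ℝ≥0}
    (h : ∀ i, LipschitzWith K (g i)) (h' : ∀ i, LipschitzWith K (g i).symm) : ∃ κ, IsPHS κ g := by
  -- The margin 2 makes the inequalities strict and keeps `L` above 1 even when `K` vanishes.
  let L : ℝ := K + 2
  have hL : 1 < L := by have := K.coe_nonneg; simp only [L]; linarith
  have hL0 : 0 < L := by linarith
  have h1 : L⁻¹ < 1 := inv_lt_one_of_one_lt₀ hL
  have h2 : L⁻¹ / 2 < L⁻¹ := half_lt_self (by positivity)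
  refine ⟨L⁻¹ / 2, by positivity, L⁻¹, L⁻¹, h2, h1, h2, h1, fun i x y hxy => ⟨?_, ?_⟩⟩
  · have h3 := (h' i).dist_le_mul (g i x) (g i y)
    simp only [Equiv.symm_apply_apply] at h3
    have h4 : 0 < dist (g i x) (g i y) := dist_pos.2 ((g i).injective.ne hxy)
    rw [inv_mul_lt_iff₀ hL0]
    simp only [L]
    linarith
  · have h3 := (h i).dist_le_mul x y
    have h4 : 0 < dist x y := dist_pos.2 hxy
    rw [inv_inv]
    simp only [L]
    linarith

theorem norm_coe_linearIsometryEquiv_le (A : Euc c ≃ₗᵢ[ℝ] Euc c) :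
    ‖(A.toContinuousLinearEquiv : Euc c →L[ℝ] Euc c)‖ ≤ 1 :=
  ContinuousLinearMap.opNorm_le_bound _ zero_le_one fun x => by simp

/-- The two PHS inequalities are Lipschitz bounds for the map and its inverse. Isometric twists
preserve these bounds and those of the derivatives, so the lifts and their inverses are uniformly
Lipschitz. -/
theorem exists_isPHS_hats {𝒜 : Type*} (hr : 1 ≤ r) (φ : EucDiffeo c r)
    (A : 𝒜 → Euc c ≃ₗᵢ[ℝ] Euc c) (b : 𝒜 → Euc c)
    (h : ∃ κ : ℝ, IsPHS κ fun _ : 𝒜 => φ.toEquiv) [Nonempty 𝒜]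
    (hK : ∃ K : ℝ≥0, LipschitzWith K (fderiv ℝ φ) ∧ LipschitzWith K (fderiv ℝ φ.symm)) :
    ∃ κ : ℝ, IsPHS κ (EucDiffeo.hats ℓ hr (φ.twists A b)) := by
  obtain ⟨κ, h0, γ, γ', h1, h2, h3, h4, h5⟩ := h
  obtain ⟨K, hK1, hK2⟩ := hK
  have hγ : 0 < γ := h0.trans h1
  have hγ' : 0 < γ' := h0.trans h3
  obtain ⟨i0⟩ := ‹Nonempty 𝒜›
  let L : ℝ≥0 := K + Real.toNNReal γ⁻¹ + Real.toNNReal γ'⁻¹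
  have hL : (L : ℝ) = K + γ⁻¹ + γ'⁻¹ := by
    simp only [L]
    push_cast
    rw [Real.coe_toNNReal _ (by positivity), Real.coe_toNNReal _ (by positivity)]
  have hg : 0 < γ⁻¹ := by positivity
  have hg' : 0 < γ'⁻¹ := by positivity
  have hK0 := K.coe_nonneg
  have f1 : ∀ x y, dist (φ x) (φ y) ≤ L * dist x y := by
    intro x y
    by_cases hxy : x = y
    · simp [hxy]
    · refine (h5 i0 x y hxy).2.le.trans (mul_le_mul_of_nonneg_right ?_ dist_nonneg)
      rw [hL]; linarith
  have f2 : ∀ x y, dist (φ.symm x) (φ.symm y) ≤ L * dist x y := by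
    intro x y
    by_cases hxy : x = y
    · simp [hxy]
    · have h6 := (h5 i0 (φ.symm x) (φ.symm y) (φ.symm.injective.ne hxy)).1
      have h7 : dist (φ.toEquiv (φ.symm x)) (φ.toEquiv (φ.symm y)) = dist x y := by
        have e : ∀ z, φ.toEquiv (φ.symm z) = z := fun z => φ.apply_symm_apply z
        rw [e, e]
      rw [h7] at h6
      have h8 : dist (φ.symm x) (φ.symm y) ≤ γ⁻¹ * dist x y := by
        rw [le_inv_mul_iff₀ hγ]; exact h6.le
      refine h8.trans (mul_le_mul_of_nonneg_right ?_ dist_nonneg)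
      rw [hL]; linarith
  have hKL : (K : ℝ) ≤ L := by rw [hL]; linarith
  have g1 : ∀ i, LipschitzWith L (φ.twists A b i) := fun i =>
    LipschitzWith.of_dist_le_mul fun x y => by
      rw [show dist (φ.twists A b i x) (φ.twists A b i y) = _ from dist_affineTwist φ (A i) (b i) x y]
      exact f1 x y
  have g2 : ∀ i, LipschitzWith L (φ.twists A b i).symm := fun i =>
    LipschitzWith.of_dist_le_mul fun x y => by
      have e : ∀ x, (φ.twists A b i).symm x = φ.symm ((A i).symm (x + -b i)) := fun _ => rfl
      rw [e, e]
      refine (f2 _ _).trans ?_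
      rw [(A i).symm.dist_map, dist_add_right]
  have g3 : ∀ i, LipschitzWith L (fderiv ℝ (φ.twists A b i)) := fun i =>
    LipschitzWith.of_dist_le_mul fun x y => by
      have e : ∀ x, fderiv ℝ (φ.twists A b i) x = _ := fderiv_affineTwist hr φ (A i) (b i)
      rw [e, e, dist_eq_norm, ← ContinuousLinearMap.comp_sub]
      refine (ContinuousLinearMap.opNorm_comp_le _ _).trans ?_
      refine (mul_le_of_le_one_left (norm_nonneg _) (norm_coe_linearIsometryEquiv_le _)).trans ?_
      rw [← dist_eq_norm]
      exact (hK1.dist_le_mul x y).trans (mul_le_mul_of_nonneg_right hKL dist_nonneg)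
  have g4 : ∀ i, LipschitzWith L (fderiv ℝ (φ.twists A b i).symm) := fun i =>
    LipschitzWith.of_dist_le_mul fun x y => by
      have e : ∀ x, fderiv ℝ (φ.twists A b i).symm x = _ := fderiv_affineTwist_symm hr φ (A i) (b i)
      rw [e, e, dist_eq_norm, ← ContinuousLinearMap.sub_comp]
      refine (ContinuousLinearMap.opNorm_comp_le _ _).trans ?_
      refine (mul_le_of_le_one_right (norm_nonneg _) (norm_coe_linearIsometryEquiv_le _)).trans ?_
      rw [← dist_eq_norm]
      refine (hK2.dist_le_mul _ _).trans (mul_le_mul hKL ?_ dist_nonneg L.coe_nonneg)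
      rw [(A i).symm.dist_map, dist_sub_right]
  exact exists_isPHS_of_lipschitz (fun i => lipschitzWith_hat hr _ (g1 i) (g2 i) (g3 i))
    (fun i => lipschitzWith_hat hr (φ.twists A b i).symm (g2 i) (g1 i) (g4 i))

end EucDiffeo

/-! ### Graph charts of the Grassmannian -/

/-- Openness is a consequence of the local left inverses: points near `h x` are images of their
values under the continuous map q ∘ ι. -/
theorem IsEmbChart.of_leftInv {M V X : Type*} [TopologicalSpace M] [NormedAddCommGroup V]
    [NormedSpace ℝ V] [NormedAddCommGroup X] [NormedSpace ℝ X] {ι : M → V} {h : X → M}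
    (hι : IsInducing ι) (hinj : Function.Injective h) (hd : ContDiff ℝ 1 (ι ∘ h))
    (hq : ∀ x, ∃ q : V → X, DifferentiableAt ℝ q (ι (h x)) ∧ ∀ᶠ m in 𝓝 (h x), h (q (ι m)) = m) :
    IsEmbChart ι h where
  inducing := hι
  contDiff := hd
  leftInv := hq
  isOpenEmbedding := by
    refine IsOpenEmbedding.of_continuous_injective_isOpenMap
      (hι.continuous_iff.2 hd.continuous) hinj ?_
    rw [isOpenMap_iff_nhds_le]
    intro x N hN
    obtain ⟨q, hq, hqm⟩ := hq x
    have hqx : q (ι (h x)) = x := hinj hqm.self_of_nhds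
    have hc : ContinuousAt (fun m => q (ι m)) (h x) :=
      ContinuousAt.comp (f := ι) (g := q) hq.continuousAt hι.continuous.continuousAt
    have hN' : ∀ᶠ m in 𝓝 (h x), h (q (ι m)) ∈ N := by
      refine hc.eventually (p := fun y => h y ∈ N) ?_
      simp only [hqx]
      exact hN
    filter_upwards [hqm, hN'] with m h1 h2
    rwa [h1] at h2

/-! ### The orthogonal projection onto the range of an injective map. -/

section Proj

variable {U E : Type*} [NormedAddCommGroup U] [InnerProductSpace ℝ U] [FiniteDimensional ℝ U]
  [NormedAddCommGroup E] [InnerProductSpace ℝ E] [FiniteDimensional ℝ E]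

/-- Taking adjoints as a linear map over the reals. -/
def adjointL : (U →L[ℝ] E) →ₗ[ℝ] (E →L[ℝ] U) where
  toFun J := ContinuousLinearMap.adjoint J
  map_add' J J' := by simp
  map_smul' a J := by simp

/-- The formula `J (J†J)⁻¹ J†` for the orthogonal projection to the range of an injective map. -/
def rangeProj (J : U →L[ℝ] E) : E →L[ℝ] E :=
  J ∘L ((ContinuousLinearMap.adjoint J ∘L J).inverse ∘L ContinuousLinearMap.adjoint J)

theorem isInvertible_of_injective {f : U →L[ℝ] U} (hf : Function.Injective f) : f.IsInvertible :=
  ⟨(LinearEquiv.ofInjectiveEndo (f : U →ₗ[ℝ] U) hf).toContinuousLinearEquiv, by ext; rfl⟩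

/-- Pairing J†J u with u gives ‖J u‖², so the kernel is trivial. -/
theorem isInvertible_adjoint_comp_self {J : U →L[ℝ] E} (hJ : Function.Injective J) :
    (ContinuousLinearMap.adjoint J ∘L J).IsInvertible := by
  apply isInvertible_of_injective
  rw [injective_iff_map_eq_zero]
  intro u hu
  have h1 : inner ℝ (J u) (J u) = 0 := by
    rw [← ContinuousLinearMap.adjoint_inner_left]
    change inner ℝ ((ContinuousLinearMap.adjoint J ∘L J) u) u = 0
    rw [hu, inner_zero_left]
  have h2 := inner_self_eq_zero.1 h1
  exact hJ (by rw [h2, map_zero])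

theorem starProjection_range {J : U →L[ℝ] E} (hJ : Function.Injective J) :
    (LinearMap.range (J : U →ₗ[ℝ] E)).starProjection = rangeProj J := by
  ext1 x
  apply Submodule.eq_starProjection_of_mem_of_inner_eq_zero
  · exact ⟨_, rfl⟩
  · rintro _ ⟨u, rfl⟩
    change inner ℝ (x - rangeProj J x) (J u) = 0
    rw [← ContinuousLinearMap.adjoint_inner_left, map_sub]
    obtain ⟨e, he⟩ := isInvertible_adjoint_comp_self hJ
    have h1 : ∀ y, ContinuousLinearMap.adjoint J (J y) = e y := fun y => by
      have := DFunLike.congr_fun he y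
      exact this.symm
    have h2 : ContinuousLinearMap.adjoint J (rangeProj J x) = ContinuousLinearMap.adjoint J x := by
      simp only [rangeProj, ContinuousLinearMap.comp_apply]
      rw [h1, ← he, ContinuousLinearMap.inverse_equiv]
      simp
    rw [h2, sub_self, inner_zero_left]

/-- Inversion of operators is smooth at invertible ones. This is the source of the smoothness of the
graph chart. -/
theorem contDiffAt_rangeProj {J : U →L[ℝ] E} (hJ : Function.Injective J) {n : WithTop ℕ∞} :
    ContDiffAt ℝ n (rangeProj : (U →L[ℝ] E) → E →L[ℝ] E) J := by
  have hadj : ContDiff ℝ n fun J : U →L[ℝ] E => ContinuousLinearMap.adjoint J :=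
    (LinearMap.toContinuousLinearMap (adjointL (U := U) (E := E))).contDiff
  have h1 : ContDiff ℝ n fun J : U →L[ℝ] E => ContinuousLinearMap.adjoint J ∘L J :=
    hadj.clm_comp contDiff_id
  obtain ⟨e, he⟩ := isInvertible_adjoint_comp_self hJ
  have h2 : ContDiffAt ℝ n (fun J : U →L[ℝ] E => (ContinuousLinearMap.adjoint J ∘L J).inverse) J := by
    refine ContDiffAt.comp (g := ContinuousLinearMap.inverse) J ?_ h1.contDiffAt
    rw [← he]
    exact contDiffAt_map_inverse e
  exact contDiffAt_id.clm_comp (h2.clm_comp hadj.contDiffAt)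

end Proj

/-! ### Graphs and slopes of linear maps. -/

section Slope

variable {U W : Type*} [NormedAddCommGroup U] [NormedSpace ℝ U] [NormedAddCommGroup W]
  [NormedSpace ℝ W]

/-- The linear map whose graph is the range of `J : U → U × W`. -/
def graphSlope (J : U →L[ℝ] U × W) : U →L[ℝ] W :=
  (ContinuousLinearMap.snd ℝ U W ∘L J) ∘L (ContinuousLinearMap.fst ℝ U W ∘L J).inverse

/-- `u ↦ (u, K u)`. -/
def graphMap (K : U →L[ℝ] W) : U →L[ℝ] U × W := (ContinuousLinearMap.id ℝ U).prod K

theorem graphMap_apply (K : U →L[ℝ] W) (u : U) : graphMap K u = (u, K u) := rfl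

theorem fst_comp_graphMap (K : U →L[ℝ] W) :
    ContinuousLinearMap.fst ℝ U W ∘L graphMap K = ContinuousLinearMap.id ℝ U := rfl

theorem graphMap_graphSlope_comp {J : U →L[ℝ] U × W} {e : U ≃L[ℝ] U}
    (he : (e : U →L[ℝ] U) = ContinuousLinearMap.fst ℝ U W ∘L J) :
    graphMap (graphSlope J) ∘L (e : U →L[ℝ] U) = J := by
  ext1 u
  have h1 : e u = (J u).1 := DFunLike.congr_fun he u
  simp only [ContinuousLinearMap.comp_apply, graphMap_apply, graphSlope, ← he,
    ContinuousLinearMap.inverse_equiv, ContinuousLinearEquiv.coe_coe,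
    ContinuousLinearEquiv.symm_apply_apply]
  exact Prod.ext h1 rfl

theorem contDiffAt_graphSlope [CompleteSpace U] {J : U →L[ℝ] U × W}
    (hJ : (ContinuousLinearMap.fst ℝ U W ∘L J).IsInvertible) {n : WithTop ℕ∞} :
    ContDiffAt ℝ n (graphSlope : (U →L[ℝ] U × W) → U →L[ℝ] W) J := by
  obtain ⟨e, he⟩ := hJ
  have h1 : ContDiff ℝ n fun J : U →L[ℝ] U × W => ContinuousLinearMap.fst ℝ U W ∘L J :=
    contDiff_const.clm_comp contDiff_id
  have h2 : ContDiff ℝ n fun J : U →L[ℝ] U × W => ContinuousLinearMap.snd ℝ U W ∘L J :=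
    contDiff_const.clm_comp contDiff_id
  have h3 : ContDiffAt ℝ n
      (fun J : U →L[ℝ] U × W => (ContinuousLinearMap.fst ℝ U W ∘L J).inverse) J := by
    refine ContDiffAt.comp (g := ContinuousLinearMap.inverse) J ?_ h1.contDiffAt
    rw [← he]
    exact contDiffAt_map_inverse e
  exact h2.contDiffAt.clm_comp h3

end Slope

/-! ### The graph chart of the Grassmannian and its regularity. -/

section GraphChart

variable {ℓ c : ℕ} (S : Euc c ≃L[ℝ] Euc ℓ × Euc (c - ℓ))

theorem injective_symm_comp_graphMap (K : Euc ℓ →L[ℝ] Euc (c - ℓ)) :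
    Function.Injective ((S.symm : Euc ℓ × Euc (c - ℓ) →L[ℝ] Euc c) ∘L graphMap K) := by
  intro u v h
  have := S.symm.injective h
  exact congrArg Prod.fst this

/-- The plane which in the coordinates `S` is the graph of `K`. -/
def graphPlane (K : Euc ℓ →L[ℝ] Euc (c - ℓ)) : Gr ℓ c :=
  ⟨LinearMap.range (((S.symm : Euc ℓ × Euc (c - ℓ) →L[ℝ] Euc c) ∘L graphMap K :
      Euc ℓ →L[ℝ] Euc c) : Euc ℓ →ₗ[ℝ] Euc c), by
    rw [LinearMap.finrank_range_of_inj (injective_symm_comp_graphMap S K)]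
    simp⟩

variable {S}

theorem mem_graphPlane {K : Euc ℓ →L[ℝ] Euc (c - ℓ)} {v : Euc c} :
    v ∈ (graphPlane S K).1 ↔ (S v).2 = K (S v).1 := by
  constructor
  · rintro ⟨u, rfl⟩
    simp [graphMap_apply]
  · intro h
    refine ⟨(S v).1, ?_⟩
    change S.symm ((S v).1, K (S v).1) = v
    rw [← h]
    simp

theorem graphPlane_injective : Function.Injective (graphPlane S) := by
  intro K K' h
  ext1 u
  have h1 : S.symm (u, K u) ∈ (graphPlane S K').1 := by
    rw [← h, mem_graphPlane]; simp
  rw [mem_graphPlane] at h1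
  simpa using h1

/-- The graph of the slope lies in `F`, after reparametrizing `J` by its invertible first component,
and both planes have dimension ℓ. -/
theorem eq_graphPlane {F : Gr ℓ c} {J : Euc ℓ →L[ℝ] Euc c} (hJF : ∀ u, J u ∈ F.1)
    (hJ : (ContinuousLinearMap.fst ℝ _ _ ∘L ((S : Euc c →L[ℝ] Euc ℓ × Euc (c - ℓ)) ∘L J)).IsInvertible) :
    F = graphPlane S (graphSlope ((S : Euc c →L[ℝ] Euc ℓ × Euc (c - ℓ)) ∘L J)) := by
  obtain ⟨e, he⟩ := hJ
  have h1 := graphMap_graphSlope_comp he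
  set K := graphSlope ((S : Euc c →L[ℝ] Euc ℓ × Euc (c - ℓ)) ∘L J)
  apply Subtype.ext
  symm
  apply Submodule.eq_of_le_of_finrank_eq
  · rintro _ ⟨u, rfl⟩
    have h2 := DFunLike.congr_fun h1 (e.symm u)
    have h3 : graphMap K u = S (J (e.symm u)) := by simpa using h2
    change S.symm (graphMap K u) ∈ F.1
    rw [h3, ContinuousLinearEquiv.symm_apply_apply]
    exact hJF _
  · rw [(graphPlane S K).2, F.2]

theorem proj_graphPlane (K : Euc ℓ →L[ℝ] Euc (c - ℓ)) :
    (graphPlane S K).proj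
      = rangeProj ((S.symm : Euc ℓ × Euc (c - ℓ) →L[ℝ] Euc c) ∘L graphMap K) :=
  starProjection_range (injective_symm_comp_graphMap S K)

theorem contDiff_graphMap {U W : Type*} [NormedAddCommGroup U] [NormedSpace ℝ U]
    [NormedAddCommGroup W] [NormedSpace ℝ W] {n : WithTop ℕ∞} :
    ContDiff ℝ n (graphMap : (U →L[ℝ] W) → U →L[ℝ] U × W) := by
  have e : (graphMap : (U →L[ℝ] W) → U →L[ℝ] U × W) = fun K =>
      ContinuousLinearMap.inl ℝ U W + ContinuousLinearMap.inr ℝ U W ∘L K := by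
    funext K
    ext1 u
    simp [graphMap_apply]
  rw [e]
  exact contDiff_const.add (contDiff_const.clm_comp contDiff_id)

theorem contDiff_proj_graphPlane {n : WithTop ℕ∞} :
    ContDiff ℝ n fun K => (graphPlane S K).proj := by
  simp only [proj_graphPlane]
  rw [contDiff_iff_contDiffAt]
  intro K
  exact (contDiffAt_rangeProj (injective_symm_comp_graphMap S K)).comp K
    (contDiff_const.clm_comp contDiff_graphMap).contDiffAt

theorem isInducing_grEmb (ℓ c : ℕ) : IsInducing (grEmb ℓ c) := by
  have h : Isometry (Gr.proj : Gr ℓ c → Euc c →L[ℝ] Euc c) := Isometry.of_dist_eq fun _ _ => rfl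
  exact IsInducing.id.prodMap h.isEmbedding.isInducing

/-- The chart of `ℝ^c × G(ℓ,c)` that is affine in the first factor and a graph chart in the second,
scaled by `ρ` and `δ`. -/
def hatChart {Y : Type*} (T : Y → Euc c) (S : Euc c ≃L[ℝ] Euc ℓ × Euc (c - ℓ)) (p : Euc c)
    (ρ δ : ℝ) (z : Y × (Euc ℓ →L[ℝ] Euc (c - ℓ))) : Euc c × Gr ℓ c :=
  (p + ρ • T z.1, graphPlane S (δ • z.2))

variable {Y : Type*} [NormedAddCommGroup Y] [NormedSpace ℝ Y]

theorem isEmbChart_affine (T : Y ≃L[ℝ] Euc c) (p : Euc c) {ρ : ℝ} (hρ : ρ ≠ 0) :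
    IsEmbChart (id : Euc c → Euc c) (fun y => p + ρ • T y) := by
  apply IsEmbChart.of_leftInv IsInducing.id
  · intro y y' h
    exact T.injective (smul_right_injective _ hρ (add_left_cancel h))
  · exact contDiff_const.add (T.contDiff.const_smul ρ)
  · intro y
    refine ⟨fun v => ρ⁻¹ • T.symm (v - p), ?_, Eventually.of_forall fun v => ?_⟩
    · exact (T.symm.differentiableAt.comp _ (differentiableAt_id.sub_const p)).const_smul _
    · simp [smul_smul, hρ]

/-- To recover a slope from a projection P, let `J` parametrize the base plane. For P close to the
base projection, the first component of P ∘ J stays invertible, so P ∘ J parametrizes the nearby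
plane and `graphSlope` reads off its slope. The formula makes sense for every operator P, and is
differentiable at the base projection. -/
theorem isEmbChart_hatChart (T : Y ≃L[ℝ] Euc c) (S : Euc c ≃L[ℝ] Euc ℓ × Euc (c - ℓ)) (p : Euc c)
    {ρ δ : ℝ} (hρ : ρ ≠ 0) (hδ : δ ≠ 0) : IsEmbChart (grEmb ℓ c) (hatChart T S p ρ δ) := by
  apply IsEmbChart.of_leftInv (isInducing_grEmb ℓ c)
  · rintro ⟨y, K⟩ ⟨y', K'⟩ h
    have h1 := congrArg Prod.fst h
    have h2 := graphPlane_injective (congrArg Prod.snd h)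
    exact Prod.ext (T.injective (smul_right_injective _ hρ (add_left_cancel h1)))
      (smul_right_injective _ hδ h2)
  · refine ContDiff.prodMk ?_ ?_
    · exact contDiff_const.add ((T.contDiff.comp contDiff_fst).const_smul ρ)
    · exact contDiff_proj_graphPlane.comp (contDiff_snd.const_smul δ)
  · rintro ⟨y, K⟩
    let J : Euc ℓ →L[ℝ] Euc c := (S.symm : Euc ℓ × Euc (c - ℓ) →L[ℝ] Euc c) ∘L graphMap (δ • K)
    let N : (Euc c →L[ℝ] Euc c) → (Euc ℓ →L[ℝ] Euc ℓ × Euc (c - ℓ)) := fun P =>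
      (S : Euc c →L[ℝ] Euc ℓ × Euc (c - ℓ)) ∘L (P ∘L J)
    have hN : ContDiff ℝ 1 N := contDiff_const.clm_comp (contDiff_id.clm_comp contDiff_const)
    have hJ0 : (graphPlane S (δ • K)).proj ∘L J = J := by
      ext1 u
      exact Submodule.starProjection_eq_self_iff.2 ⟨u, rfl⟩
    have hN0 : N (graphPlane S (δ • K)).proj = graphMap (δ • K) := by
      simp only [N, hJ0]
      ext1 u
      simp [J]
    have hinv0 : (ContinuousLinearMap.fst ℝ _ _ ∘L N (graphPlane S (δ • K)).proj).IsInvertible := by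
      rw [hN0, fst_comp_graphMap]
      exact ⟨ContinuousLinearEquiv.refl ℝ _, rfl⟩
    refine ⟨fun v => (ρ⁻¹ • T.symm (v.1 - p), δ⁻¹ • graphSlope (N v.2)), ?_, ?_⟩
    · refine DifferentiableAt.prodMk ?_ ?_
      · exact (T.symm.differentiableAt.comp _ (differentiableAt_fst.sub_const p)).const_smul _
      · have h1 : DifferentiableAt ℝ graphSlope (N (graphPlane S (δ • K)).proj) :=
          (contDiffAt_graphSlope hinv0 (n := 1)).differentiableAt one_ne_zero
        have h2 : DifferentiableAt ℝ N (graphPlane S (δ • K)).proj :=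
          hN.differentiable one_ne_zero _
        have h3 : DifferentiableAt ℝ (fun v : Euc c × (Euc c →L[ℝ] Euc c) => graphSlope (N v.2))
            (grEmb ℓ c (hatChart T S p ρ δ (y, K))) :=
          DifferentiableAt.comp (g := fun P => graphSlope (N P)) _ (h1.comp _ h2) differentiableAt_snd
        exact h3.const_smul δ⁻¹
    · have hc : Continuous fun m : Euc c × Gr ℓ c =>
          ContinuousLinearMap.fst ℝ _ _ ∘L N (grEmb ℓ c m).2 := by
        refine continuous_const.clm_comp (hN.continuous.comp ?_)
        exact continuous_snd.comp (isInducing_grEmb ℓ c).continuous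
      have hev : ∀ᶠ m in 𝓝 (hatChart T S p ρ δ (y, K)),
          (ContinuousLinearMap.fst ℝ _ _ ∘L N (grEmb ℓ c m).2).IsInvertible := by
        obtain ⟨e, he⟩ := hinv0
        refine hc.continuousAt.eventually (p := fun f => f.IsInvertible) ?_
        have h1 := ContinuousLinearEquiv.nhds e
        rw [he] at h1
        exact h1
      filter_upwards [hev] with m hm
      refine Prod.ext ?_ ?_
      · simp [hatChart, smul_smul, hρ, grEmb]
      · simp only [hatChart, smul_inv_smul₀ hδ]
        symm
        exact eq_graphPlane (J := m.2.proj ∘L J) (fun u => Submodule.starProjection_apply_mem _ _) hm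

end GraphChart

/-! ### Adapted norms -/

section Adapted

variable {E : Type*} [NormedAddCommGroup E] [InnerProductSpace ℝ E] [FiniteDimensional ℝ E]

/-- A linear map with an iterate of norm at most `μ ^ N` has norm at most `μ` for some Euclidean
norm. -/
theorem exists_adapted_coords (T : E →L[ℝ] E) {N : ℕ} (hN : 0 < N) {μ : ℝ} (hμ : 0 < μ)
    (hT : ∀ v, ‖(T ^ N) v‖ ≤ μ ^ N * ‖v‖) {k : ℕ} (hk : Module.finrank ℝ E = k) :
    ∃ S : E ≃L[ℝ] Euc k, ∀ v, ‖S (T v)‖ ≤ μ * ‖S v‖ := by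
  -- The adapted norm squared is the sum of (μ⁻ʲ ‖Tʲ v‖)² over j < N. It is realised by embedding
  -- `E` in a Euclidean product, so that it comes from an inner product.
  let J : E →ₗ[ℝ] PiLp 2 (fun _ : Fin N => E) :=
    { toFun := fun v => WithLp.toLp 2 fun j => (μ ^ (j : ℕ))⁻¹ • (T ^ (j : ℕ)) v
      map_add' := fun v w => by ext j; simp
      map_smul' := fun a v => by ext j; simp [smul_comm a] }
  let a : E → ℕ → ℝ := fun v j => ((μ ^ j)⁻¹ * ‖(T ^ j) v‖) ^ 2
  have hJn : ∀ v, ‖J v‖ ^ 2 = ∑ j ∈ Finset.range N, a v j := by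
    intro v
    rw [PiLp.norm_sq_eq_of_L2, Finset.sum_range]
    refine Finset.sum_congr rfl fun j _ => ?_
    simp only [J, LinearMap.coe_mk, AddHom.coe_mk, a, norm_smul, norm_inv, norm_pow,
      Real.norm_of_nonneg hμ.le]
  have hJinj : Function.Injective J := by
    intro v w h
    have := congrArg (fun z : PiLp 2 (fun _ : Fin N => E) => z ⟨0, hN⟩) h
    simpa [J] using this
  have hJT : ∀ v, ‖J (T v)‖ ≤ μ * ‖J v‖ := by
    intro v
    refine le_of_sq_le_sq ?_ (by positivity)
    rw [mul_pow, hJn, hJn]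
    have h1 : ∀ j, a (T v) j = μ ^ 2 * a v (j + 1) := by
      intro j
      have e : (T ^ j) (T v) = (T ^ (j + 1)) v := by rw [pow_succ]; rfl
      simp only [a, e, pow_succ]
      field_simp
    simp only [h1, ← Finset.mul_sum]
    refine mul_le_mul_of_nonneg_left ?_ (by positivity)
    have h2 := Finset.sum_range_succ' (a v) N
    rw [Finset.sum_range_succ] at h2
    -- Applying `T` shifts the sum by one index; the bound on the N-th iterate says that the term
    -- gained is at most the term lost.
    have h3 : a v N ≤ a v 0 := by
      simp only [a, pow_zero, inv_one, one_mul]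
      refine pow_le_pow_left₀ (by positivity) ?_ 2
      rw [inv_mul_le_iff₀ (by positivity)]
      exact hT v
    linarith
  let Y := LinearMap.range J
  let e1 : E ≃ₗ[ℝ] Y := LinearEquiv.ofInjective J hJinj
  have hY : Module.finrank ℝ Y = k := e1.finrank_eq.symm.trans hk
  let e2 : Y ≃ₗᵢ[ℝ] Euc k := ((stdOrthonormalBasis ℝ Y).reindex (finCongr hY)).repr
  refine ⟨(e1.trans e2.toLinearEquiv).toContinuousLinearEquiv, fun v => ?_⟩
  have hS : ∀ v, ‖(e1.trans e2.toLinearEquiv).toContinuousLinearEquiv v‖ = ‖J v‖ := by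
    intro v
    exact e2.norm_map (e1 v)
  rw [hS, hS]
  exact hJT v

/-- Coordinates adapted to a dominated splitting. -/
theorem exists_adapted_splitting (L : E ≃L[ℝ] E) {E₁ E₂ : Submodule ℝ E} (hc : IsCompl E₁ E₂)
    (h₁ : E₁.map (L : E →ₗ[ℝ] E) = E₁) (h₂ : E₂.map (L : E →ₗ[ℝ] E) = E₂) {N : ℕ} (hN : 0 < N)
    {m : ℝ} (hm : 0 < m) (hc₁ : ∀ v ∈ E₁, ‖((L : E →L[ℝ] E) ^ N) v‖ ≤ m ^ N / 2 * ‖v‖)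
    (hc₂ : ∀ v ∈ E₂, m ^ N * ‖v‖ ≤ 1 / 2 * ‖((L : E →L[ℝ] E) ^ N) v‖) {k₁ k₂ : ℕ}
    (hk₁ : Module.finrank ℝ E₁ = k₁) (hk₂ : Module.finrank ℝ E₂ = k₂) :
    ∃ (S : E ≃L[ℝ] Euc k₁ × Euc k₂) (d : Euc k₁ ≃L[ℝ] Euc k₁) (a : Euc k₂ ≃L[ℝ] Euc k₂) (μ : ℝ),
      0 < μ ∧ μ < 1 ∧ (∀ v, S (L v) = (d (S v).1, a (S v).2)) ∧
      (∀ w, ‖d w‖ ≤ μ * m * ‖w‖) ∧ (∀ u, m * ‖u‖ ≤ μ * ‖a u‖) ∧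
      (∀ v, v ∈ E₁ ↔ (S v).2 = 0) ∧ ∀ v, v ∈ E₂ ↔ (S v).1 = 0 := by
  -- By Bernoulli's inequality μ^N ≥ 1/2, so the factors 1/2 of the hypotheses turn into μ^N.
  let μ : ℝ := 1 + -(1 / (2 * N))
  have hN0 : (0 : ℝ) < N := by exact_mod_cast hN
  have hN1 : (1 : ℝ) ≤ N := by exact_mod_cast hN
  have hfrac : 1 / (2 * (N : ℝ)) ≤ 1 / 2 := by
    apply one_div_le_one_div_of_le <;> linarith
  have hfrac0 : 0 < 1 / (2 * (N : ℝ)) := by positivity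
  have hμ0 : 0 < μ := by simp only [μ]; linarith
  have hμ1 : μ < 1 := by simp only [μ]; linarith
  have hμN : 1 / 2 ≤ μ ^ N := by
    have := one_add_mul_le_pow (a := -(1 / (2 * (N : ℝ)))) (by linarith) N
    refine le_trans (le_of_eq ?_) this
    field_simp
    ring
  let L₁ : E₁ ≃L[ℝ] E₁ := (L.toLinearEquiv.ofSubmodules E₁ E₁ h₁).toContinuousLinearEquiv
  let L₂ : E₂ ≃L[ℝ] E₂ := (L.toLinearEquiv.ofSubmodules E₂ E₂ h₂).toContinuousLinearEquiv
  have hL₁ : ∀ v : E₁, ((L₁ v : E₁) : E) = L v := fun v => rfl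
  have hL₂ : ∀ v : E₂, ((L₂ v : E₂) : E) = L v := fun v => rfl
  -- Normalised by the separating rate m, the map on `E₁` and the inverse of the map on `E₂` both
  -- have N-th iterate of norm at most 1/2.
  let T₁ : E₁ →L[ℝ] E₁ := m⁻¹ • (L₁ : E₁ →L[ℝ] E₁)
  let T₂ : E₂ →L[ℝ] E₂ := m • (L₂.symm : E₂ →L[ℝ] E₂)
  have hT₁ : ∀ (n : ℕ) (v : E₁), m ^ n • (((T₁ ^ n) v : E₁) : E) = ((L : E →L[ℝ] E) ^ n) v := by
    intro n
    induction n with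
    | zero => intro v; simp
    | succ n ih =>
      intro v
      have e : (T₁ ^ (n + 1)) v = (T₁ ^ n) (T₁ v) := by rw [pow_succ]; rfl
      have e' : ((L : E →L[ℝ] E) ^ (n + 1)) v = ((L : E →L[ℝ] E) ^ n) (L v) := by rw [pow_succ]; rfl
      rw [e, e', pow_succ', mul_smul, ih]
      have e'' : ((T₁ v : E₁) : E) = m⁻¹ • L v := rfl
      rw [e'', map_smul, smul_smul, mul_inv_cancel₀ hm.ne', one_smul]
  have hT₂ : ∀ (n : ℕ) (v : E₂), ((L : E →L[ℝ] E) ^ n) ((T₂ ^ n) v : E₂) = m ^ n • (v : E) := by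
    intro n
    induction n with
    | zero => intro v; simp
    | succ n ih =>
      intro v
      have e : (T₂ ^ (n + 1)) v = T₂ ((T₂ ^ n) v) := by rw [pow_succ']; rfl
      have e' : ∀ x, ((L : E →L[ℝ] E) ^ (n + 1)) x = ((L : E →L[ℝ] E) ^ n) (L x) := fun x => by
        rw [pow_succ]; rfl
      have e'' : ∀ y : E₂, L ((T₂ y : E₂) : E) = m • (y : E) := by
        intro y
        change L (m • ((L₂.symm y : E₂) : E)) = _
        rw [map_smul, ← hL₂, ContinuousLinearEquiv.apply_symm_apply]
      rw [e', e, e'', map_smul, ih, smul_smul, pow_succ']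
  obtain ⟨S₁, hS₁⟩ := exists_adapted_coords T₁ hN hμ0 (fun v => by
    have h := hc₁ v v.2
    rw [← hT₁, norm_smul, norm_pow, Real.norm_of_nonneg hm.le] at h
    have hmN : 0 < m ^ N := by positivity
    have h4 : ‖(T₁ ^ N) v‖ ≤ 1 / 2 * ‖v‖ := by
      refine le_of_mul_le_mul_left (h.trans (le_of_eq ?_)) hmN
      rw [Submodule.coe_norm]
      ring
    exact h4.trans (mul_le_mul_of_nonneg_right hμN (norm_nonneg _))) hk₁
  obtain ⟨S₂, hS₂⟩ := exists_adapted_coords T₂ hN hμ0 (fun v => by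
    have h := hc₂ _ ((T₂ ^ N) v).2
    rw [hT₂, norm_smul, norm_pow, Real.norm_of_nonneg hm.le] at h
    have hmN : 0 < m ^ N := by positivity
    have h4 : ‖(T₂ ^ N) v‖ ≤ 1 / 2 * ‖v‖ := by
      refine le_of_mul_le_mul_left (h.trans (le_of_eq ?_)) hmN
      rw [Submodule.coe_norm]
      ring
    exact h4.trans (mul_le_mul_of_nonneg_right hμN (norm_nonneg _))) hk₂
  let P : (E₁ × E₂) ≃L[ℝ] E := (Submodule.prodEquivOfIsCompl E₁ E₂ hc).toContinuousLinearEquiv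
  have hP : ∀ z : E₁ × E₂, P z = z.1 + z.2 := fun z => rfl
  let S : E ≃L[ℝ] Euc k₁ × Euc k₂ := P.symm.trans (S₁.prodCongr S₂)
  have hS : ∀ z : E₁ × E₂, S (P z) = (S₁ z.1, S₂ z.2) := by
    intro z
    simp [S]
  refine ⟨S, (S₁.symm.trans L₁).trans S₁, (S₂.symm.trans L₂).trans S₂, μ, hμ0, hμ1, ?_, ?_, ?_, ?_, ?_⟩
  · intro v
    obtain ⟨z, rfl⟩ := P.surjective v
    have e : L (P z) = P (L₁ z.1, L₂ z.2) := by
      rw [hP, hP, map_add]; rfl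
    rw [e, hS, hS]
    simp
  · intro w
    obtain ⟨v, rfl⟩ := S₁.surjective w
    have h := hS₁ v
    have e : T₁ v = m⁻¹ • L₁ v := rfl
    rw [e, map_smul, norm_smul, norm_inv, Real.norm_of_nonneg hm.le, inv_mul_le_iff₀ hm] at h
    simp only [ContinuousLinearEquiv.trans_apply, ContinuousLinearEquiv.symm_apply_apply]
    linarith
  · intro u
    obtain ⟨v, rfl⟩ := S₂.surjective u
    have h := hS₂ (L₂ v)
    have e : T₂ (L₂ v) = m • v := by
      change m • L₂.symm (L₂ v) = _
      simp
    rw [e, map_smul, norm_smul, Real.norm_of_nonneg hm.le] at h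
    simpa using h
  · intro v
    obtain ⟨z, rfl⟩ := P.surjective v
    rw [hS, hP]
    simp only [map_eq_zero_iff S₂ S₂.injective]
    constructor
    · intro h
      have : (z.2 : E) ∈ E₁ := (Submodule.add_mem_iff_right _ z.1.2).1 h
      exact Subtype.ext (Submodule.disjoint_def.1 hc.disjoint _ this z.2.2)
    · intro h
      simp [h]
  · intro v
    obtain ⟨z, rfl⟩ := P.surjective v
    rw [hS, hP]
    simp only [map_eq_zero_iff S₁ S₁.injective]
    constructor
    · intro h
      have : (z.1 : E) ∈ E₂ := (Submodule.add_mem_iff_left _ z.2.2).1 h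
      exact Subtype.ext (Submodule.disjoint_def.1 hc.disjoint _ z.1.2 this)
    · intro h
      simp [h]

end Adapted

/-! ### Adapted coordinates for a hyperbolic dominated splitting. -/

section Hyperbolic

variable {E : Type*} [NormedAddCommGroup E] [InnerProductSpace ℝ E] [FiniteDimensional ℝ E]
  {L : E ≃L[ℝ] E} {Es Ecu Euu : Submodule ℝ E}

omit [FiniteDimensional ℝ E] in
theorem IsHyperbolicDominated.isCompl_s_u (h : IsHyperbolicDominated (L : E →L[ℝ] E) Es Ecu Euu) :
    IsCompl Es (Ecu ⊔ Euu) := by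
  constructor
  · have := h.isInternal.submodule_iSupIndep 0
    refine this.mono_right (sup_le ?_ ?_)
    · exact le_iSup₂_of_le (1 : Fin 3) (by decide) le_rfl
    · exact le_iSup₂_of_le (2 : Fin 3) (by decide) le_rfl
  · rw [codisjoint_iff, eq_top_iff, ← h.isInternal.submodule_iSup_eq_top]
    refine iSup_le fun i => ?_
    fin_cases i
    · exact le_sup_left
    · exact le_sup_left.trans le_sup_right
    · exact le_sup_right.trans le_sup_right

omit [FiniteDimensional ℝ E] in
theorem IsHyperbolicDominated.isCompl_scu_uu
    (h : IsHyperbolicDominated (L : E →L[ℝ] E) Es Ecu Euu) : IsCompl (Es ⊔ Ecu) Euu := by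
  constructor
  · have := h.isInternal.submodule_iSupIndep 2
    refine (this.mono_right (sup_le ?_ ?_)).symm
    · exact le_iSup₂_of_le (0 : Fin 3) (by decide) le_rfl
    · exact le_iSup₂_of_le (1 : Fin 3) (by decide) le_rfl
  · rw [codisjoint_iff, sup_assoc, ← codisjoint_iff]
    exact h.isCompl_s_u.codisjoint

theorem tendsto_mul_geometric_zero (C : ℝ) {θ : ℝ} (h0 : 0 < θ) (h1 : θ < 1) :
    Tendsto (fun n : ℕ => C * θ ^ n) atTop (𝓝 0) := by
  simpa using (tendsto_pow_atTop_nhds_zero_of_lt_one h0.le h1).const_mul C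

/-- Coordinates adapted to the stable and unstable directions. -/
theorem IsHyperbolicDominated.exists_coords_s_u
    (h : IsHyperbolicDominated (L : E →L[ℝ] E) Es Ecu Euu) {k₁ k₂ : ℕ}
    (hk₁ : Module.finrank ℝ Es = k₁) (hk₂ : Module.finrank ℝ (Ecu ⊔ Euu : Submodule ℝ E) = k₂) :
    ∃ (S : E ≃L[ℝ] Euc k₁ × Euc k₂) (d : Euc k₁ ≃L[ℝ] Euc k₁) (a : Euc k₂ ≃L[ℝ] Euc k₂) (μ : ℝ),
      0 < μ ∧ μ < 1 ∧ (∀ v, S (L v) = (d (S v).1, a (S v).2)) ∧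
      (∀ w, ‖d w‖ ≤ μ * ‖w‖) ∧ (∀ u, ‖u‖ ≤ μ * ‖a u‖) := by
  obtain ⟨C₁, hC₁, θ₁, hθ₁, hθ₁', h₁⟩ := h.contracting
  obtain ⟨C₂, hC₂, θ₂, hθ₂, hθ₂', h₂⟩ := h.expanding
  have e1 := (tendsto_mul_geometric_zero C₁ hθ₁ hθ₁').eventually (gt_mem_nhds one_half_pos)
  have e2 := (tendsto_mul_geometric_zero C₂ hθ₂ hθ₂').eventually (gt_mem_nhds one_half_pos)
  obtain ⟨N, ⟨hN1, hN2⟩, hN⟩ := ((e1.and e2).and (eventually_gt_atTop 0)).exists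
  have hmap : (Ecu ⊔ Euu).map (L : E →ₗ[ℝ] E) = Ecu ⊔ Euu := by
    rw [Submodule.map_sup]
    exact congrArg₂ _ h.map_cu h.map_uu
  obtain ⟨S, d, a, μ, hμ0, hμ1, hS, hd, ha, -, -⟩ := exists_adapted_splitting L h.isCompl_s_u h.map_s
    hmap hN one_pos
    (fun v hv => (h₁ N v hv).trans (mul_le_mul_of_nonneg_right (by simpa using hN1.le) (norm_nonneg _)))
    (fun v hv => by
      rw [one_pow, one_mul]
      exact (h₂ N v hv).trans (mul_le_mul_of_nonneg_right hN2.le (norm_nonneg _))) hk₁ hk₂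
  exact ⟨S, d, a, μ, hμ0, hμ1, hS, by simpa using hd, by simpa using ha⟩

/-- Coordinates adapted to the dominated splitting with strong unstable direction `Euu`. -/
theorem IsHyperbolicDominated.exists_coords_scu_uu
    (h : IsHyperbolicDominated (L : E →L[ℝ] E) Es Ecu Euu) {k₁ k₂ : ℕ} (hk₂0 : 0 < k₂)
    (hk₁ : Module.finrank ℝ (Es ⊔ Ecu : Submodule ℝ E) = k₁) (hk₂ : Module.finrank ℝ Euu = k₂) :
    ∃ (S : E ≃L[ℝ] Euc k₁ × Euc k₂) (d : Euc k₁ ≃L[ℝ] Euc k₁) (a : Euc k₂ ≃L[ℝ] Euc k₂) (μ m : ℝ),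
      0 < μ ∧ μ < 1 ∧ 1 ≤ m ∧ (∀ v, S (L v) = (d (S v).1, a (S v).2)) ∧
      (∀ w, ‖d w‖ ≤ μ * m * ‖w‖) ∧ (∀ u, m * ‖u‖ ≤ μ * ‖a u‖) ∧
      ∀ v, v ∈ Euu ↔ (S v).1 = 0 := by
  obtain ⟨C₁, hC₁, θ₁, hθ₁, hθ₁', h₁⟩ := h.contracting
  obtain ⟨C₂, hC₂, θ₂, hθ₂, hθ₂', h₂⟩ := h.expanding
  obtain ⟨C₃, hC₃, θ₃, hθ₃, hθ₃', h₃⟩ := h.dominated_cu_uu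
  -- The bounded projection compares the norms of the two components with that of a vector of `Es ⊔
  -- Ecu`. Domination of `Es` by `Euu` is obtained from contraction and expansion, that of `Ecu` is
  -- a hypothesis.
  let P : E →L[ℝ] Es := LinearMap.toContinuousLinearMap
    (Submodule.projectionOnto Es (Ecu ⊔ Euu) h.isCompl_s_u)
  let K := ‖P‖
  have hK : 0 ≤ K := norm_nonneg P
  have e1 := (tendsto_mul_geometric_zero C₁ hθ₁ hθ₁')
  have e2 := (tendsto_mul_geometric_zero C₂ hθ₂ hθ₂')
  have e3 := (tendsto_mul_geometric_zero C₃ hθ₃ hθ₃')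
  have e4 : Tendsto (fun n : ℕ => (C₁ * θ₁ ^ n) * (C₂ * θ₂ ^ n) * K + C₃ * θ₃ ^ n * (1 + K)) atTop
      (𝓝 0) := by
    simpa using ((e1.mul e2).mul_const K).add (e3.mul_const (1 + K))
  obtain ⟨N, ⟨hN1, hN2⟩, hN⟩ := (((e4.eventually (gt_mem_nhds (show (0 : ℝ) < 1 / 4 by norm_num))).and
    (e2.eventually (gt_mem_nhds one_half_pos))).and (eventually_gt_atTop 0)).exists
  set LN := (L : E →L[ℝ] E) ^ N
  have hdom : ∀ u ∈ Es ⊔ Ecu, ∀ v ∈ Euu, ‖LN u‖ * ‖v‖ ≤ 1 / 4 * (‖LN v‖ * ‖u‖) := by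
    intro u hu v hv
    obtain ⟨us, hus, uc, huc, rfl⟩ := Submodule.mem_sup.1 hu
    have hP : ((P (us + uc) : Es) : E) = us := by
      have h1 : P us = ⟨us, hus⟩ :=
        Submodule.projectionOnto_apply_left h.isCompl_s_u ⟨us, hus⟩
      have h2 : P uc = 0 :=
        (Submodule.projectionOnto_apply_eq_zero_iff h.isCompl_s_u).2 (Submodule.mem_sup_left huc)
      rw [map_add, h1, h2, add_zero]
    have b1 : ‖us‖ ≤ K * ‖us + uc‖ := by
      have := P.le_opNorm (us + uc)
      rwa [Submodule.coe_norm, hP] at this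
    have b2 : ‖uc‖ ≤ (1 + K) * ‖us + uc‖ := by
      have e : uc = (us + uc) - us := by abel
      calc ‖uc‖ = ‖(us + uc) - us‖ := by rw [← e]
        _ ≤ ‖us + uc‖ + ‖us‖ := norm_sub_le _ _
        _ ≤ _ := by linarith
    have c1 := h₁ N us hus
    have c2 := h₂ N v (Submodule.mem_sup_right hv)
    have c3 := h₃ N uc huc v hv
    have p1 : 0 < C₁ * θ₁ ^ N := by positivity
    have p2 : 0 < C₂ * θ₂ ^ N := by positivity
    have p3 : 0 < C₃ * θ₃ ^ N := by positivity
    have d1 : ‖LN us‖ * ‖v‖ ≤ ((C₁ * θ₁ ^ N) * (K * ‖us + uc‖)) * (C₂ * θ₂ ^ N * ‖LN v‖) := by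
      refine mul_le_mul (c1.trans (mul_le_mul_of_nonneg_left b1 p1.le)) c2 (norm_nonneg _) (by positivity)
    have d2 : ‖LN uc‖ * ‖v‖ ≤ C₃ * θ₃ ^ N * (‖LN v‖ * ((1 + K) * ‖us + uc‖)) := by
      refine c3.trans (mul_le_mul_of_nonneg_left (mul_le_mul_of_nonneg_left b2 (norm_nonneg _)) p3.le)
    calc ‖LN (us + uc)‖ * ‖v‖ ≤ (‖LN us‖ + ‖LN uc‖) * ‖v‖ := by
          rw [map_add]
          exact mul_le_mul_of_nonneg_right (norm_add_le _ _) (norm_nonneg _)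
      _ = ‖LN us‖ * ‖v‖ + ‖LN uc‖ * ‖v‖ := by ring
      _ ≤ ((C₁ * θ₁ ^ N) * (C₂ * θ₂ ^ N) * K + C₃ * θ₃ ^ N * (1 + K)) * (‖LN v‖ * ‖us + uc‖) := by
          refine (add_le_add d1 d2).trans (le_of_eq ?_)
          ring
      _ ≤ _ := mul_le_mul_of_nonneg_right hN1.le (by positivity)
  have hexp : ∀ v ∈ Euu, ‖v‖ ≤ 1 / 2 * ‖LN v‖ := fun v hv =>
    (h₂ N v (Submodule.mem_sup_right hv)).trans
      (mul_le_mul_of_nonneg_right hN2.le (norm_nonneg _))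
  have : Nontrivial Euu := Module.nontrivial_of_finrank_pos (R := ℝ) (by omega)
  obtain ⟨v₀, hv₀, hmin⟩ := (isCompact_sphere (0 : Euu) 1).exists_isMinOn
    (NormedSpace.sphere_nonempty.2 zero_le_one) (f := fun v : Euu => ‖LN v‖)
    (LN.continuous.comp continuous_subtype_val).norm.continuousOn
  set β := ‖LN v₀‖ with hβ
  have hv₀1 : ‖(v₀ : E)‖ = 1 := by simpa using hv₀
  have hβ2 : 2 ≤ β := by
    have := hexp v₀ v₀.2
    rw [hv₀1] at this
    linarith
  have hβv : ∀ v ∈ Euu, β * ‖v‖ ≤ ‖LN v‖ := by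
    intro v hv
    by_cases hv0 : v = 0
    · simp [hv0]
    have hvp := norm_pos_iff.2 hv0
    have h1 : (‖v‖⁻¹ • (⟨v, hv⟩ : Euu)) ∈ Metric.sphere (0 : Euu) 1 := by
      rw [mem_sphere_zero_iff_norm, norm_smul, norm_inv, norm_norm]
      exact inv_mul_cancel₀ hvp.ne'
    have h2 : β ≤ ‖LN (‖v‖⁻¹ • v)‖ := hmin h1
    rw [map_smul, norm_smul, norm_inv, norm_norm, le_inv_mul_iff₀ hvp] at h2
    linarith
  -- With β the minimal expansion of L^N on the unit sphere of `Euu`, this m satisfies m^N = β/2.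
  -- That is half of the expansion on `Euu` and at least twice the growth, at most β/4, on the
  -- complement. As β ≥ 2, also m ≥ 1.
  let m : ℝ := (β / 2) ^ (N : ℝ)⁻¹
  have hmN : m ^ N = β / 2 := Real.rpow_inv_natCast_pow (by linarith) hN.ne'
  have hm1 : 1 ≤ m := Real.one_le_rpow (by linarith) (by positivity)
  have hmap : (Es ⊔ Ecu).map (L : E →ₗ[ℝ] E) = Es ⊔ Ecu := by
    rw [Submodule.map_sup]
    exact congrArg₂ _ h.map_s h.map_cu
  obtain ⟨S, d, a, μ, hμ0, hμ1, hS, hd, ha, -, hE⟩ := exists_adapted_splitting L h.isCompl_scu_uu hmap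
    h.map_uu hN (zero_lt_one.trans_le hm1)
    (fun u hu => by
      have := hdom u hu v₀ v₀.2
      rw [hv₀1, mul_one] at this
      rw [hmN]
      linarith)
    (fun v hv => by
      rw [hmN]
      have := hβv v hv
      linarith) hk₁ hk₂
  exact ⟨S, d, a, μ, m, hμ0, hμ1, hm1, hS, hd, ha, hE⟩

end Hyperbolic

/-! ### Hyperbolic models and coverings -/

namespace HypLin

section Construct

variable {X₁ X₂ Y Z : Type*} [NormedAddCommGroup X₁] [NormedSpace ℝ X₁] [NormedAddCommGroup X₂]
  [NormedSpace ℝ X₂] [NormedAddCommGroup Y] [NormedSpace ℝ Y] [NormedAddCommGroup Z]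
  [NormedSpace ℝ Z]

/-- The product of a contraction and an expansion. -/
def ofProd (d : X₁ ≃L[ℝ] X₁) (a : X₂ ≃L[ℝ] X₂) (rate : ℝ) (h0 : 0 < rate) (h1 : rate < 1)
    (hd : ∀ w, ‖d w‖ ≤ rate * ‖w‖) (ha : ∀ u, ‖u‖ ≤ rate * ‖a u‖) : HypLin (X₁ × X₂) where
  Λ := d.prodCongr a
  Ps := (ContinuousLinearMap.inl ℝ X₁ X₂).comp (ContinuousLinearMap.fst ℝ X₁ X₂)
  Pu := (ContinuousLinearMap.inr ℝ X₁ X₂).comp (ContinuousLinearMap.snd ℝ X₁ X₂)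
  rate := rate
  add_proj x := by simp
  Ps_Pu x := by simp
  Pu_Ps x := by simp
  Ps_comm x := by simp
  Pu_comm x := by simp
  norm_eq x := by simp [Prod.norm_def]
  rate_pos := h0
  rate_lt := h1
  contr x := by simpa [Prod.norm_def] using hd x.1
  expand x := by simpa [Prod.norm_def] using ha x.2

/-- The product of a hyperbolic linear map with a contraction. -/
def prodContraction (H : HypLin Y) (A : Z ≃L[ℝ] Z) (hA : ∀ z, ‖A z‖ ≤ H.rate * ‖z‖) :
    HypLin (Y × Z) where
  Λ := H.Λ.prodCongr A
  Ps := H.Ps.prodMap (ContinuousLinearMap.id ℝ Z)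
  Pu := H.Pu.prodMap 0
  rate := H.rate
  add_proj x := by simp [Prod.map, H.add_proj]
  Ps_Pu x := by simp [Prod.map, H.Ps_Pu]
  Pu_Ps x := by simp [Prod.map, H.Pu_Ps]
  Ps_comm x := by simp [H.Ps_comm]
  Pu_comm x := by simp [H.Pu_comm]
  norm_eq x := by
    simp [Prod.norm_def, H.norm_eq x.1, max_right_comm]
  rate_pos := H.rate_pos
  rate_lt := H.rate_lt
  contr x := by
    have h1 := H.contr x.1
    have h2 := hA x.2
    have h3 := H.rate_pos.le
    change max ‖H.Λ (H.Ps x.1)‖ ‖A x.2‖ ≤ H.rate * max ‖H.Ps x.1‖ ‖x.2‖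
    rw [mul_max_of_nonneg _ _ h3]
    exact max_le_max h1 h2
  expand x := by
    have h1 := H.expand x.1
    simpa [Prod.norm_def] using h1

end Construct

variable {X : Type*} [NormedAddCommGroup X] [NormedSpace ℝ X] (H : HypLin X)

/-- Finitely many translations in the stable direction suffice to cover the unit ball by the images
of a smaller ball. -/
theorem exists_translations [FiniteDimensional ℝ X] :
    ∃ (d : ℕ) (v : Fin d → X), 2 ≤ d ∧
      ∀ y, ‖y‖ ≤ 1 → ∃ i, ‖H.Λ.symm (y - v i)‖ ≤ max (1 / 2) H.rate := by
  have : ProperSpace X := FiniteDimensional.proper ℝ X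
  let N := ‖(H.Λ.symm : X →L[ℝ] X)‖
  have hN : 0 ≤ N := norm_nonneg _
  let s : Set X := H.Ps '' Metric.closedBall 0 1
  have hs : IsCompact s := (isCompact_closedBall _ _).image H.Ps.continuous
  -- Only the stable part must be covered, as the unstable part shrinks under `Λ.symm`. The radius
  -- is such that `Λ.symm` sends these balls into balls of radius 1/2.
  obtain ⟨t, hts, ht, hst⟩ := finite_cover_balls_of_compact hs
    (e := (2 * (N + 1))⁻¹) (by positivity)
  obtain ⟨n, f, -, hf⟩ := ht.fin_param
  -- Two zero translations are appended only to guarantee at least two maps.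
  let v : Fin (n + 2) → X := fun i => if h : (i : ℕ) < n then f ⟨i, h⟩ else 0
  refine ⟨n + 2, v, by omega, fun y hy => ?_⟩
  have hys : H.Ps y ∈ s := ⟨y, by simpa using hy, rfl⟩
  obtain ⟨x, hx, hyx⟩ := mem_iUnion₂.1 (hst hys)
  rw [← hf] at hx
  obtain ⟨i, rfl⟩ := hx
  have hvi : v ⟨i, by omega⟩ = f i := by simp [v]
  refine ⟨⟨i, by omega⟩, ?_⟩
  rw [hvi]
  have hPs : H.Ps (f i) = f i ∧ H.Pu (f i) = 0 := by
    have : f i ∈ s := hts (hf ▸ mem_range_self _)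
    obtain ⟨z, -, hz⟩ := this
    rw [← hz]
    exact ⟨H.Ps_Ps z, H.Pu_Ps z⟩
  apply H.norm_le_of
  · rw [H.Ps_comm_symm, map_sub, hPs.1]
    refine le_trans ?_ (le_max_left _ _)
    have h1 := (H.Λ.symm : X →L[ℝ] X).le_opNorm (H.Ps y - f i)
    rw [mem_ball_iff_norm] at hyx
    refine h1.trans ((mul_le_mul_of_nonneg_left hyx.le hN).trans ?_)
    rw [mul_inv_le_iff₀ (by positivity)]
    linarith
  · rw [H.Pu_comm_symm, map_sub, hPs.2, sub_zero]
    refine le_trans ?_ (le_max_right _ _)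
    refine (H.norm_symm_Pu_le y).trans ?_
    exact mul_le_of_le_one_right H.rate_pos.le ((H.norm_Pu_le y).trans hy)

variable {H}

/-- A perturbation of `Λ + v` covers the points that `Λ + v` covers well. -/
theorem IsNear.exists_preimage [CompleteSpace X] {η R q : ℝ} {F : X → X} (hF : H.IsNear η R F)
    (hη : 0 ≤ η) (hR : 1 ≤ R) (hq1 : q < 1) {v y : X} (hv : ‖F 0 - v‖ ≤ η)
    (hy : ‖H.Λ.symm (y - v)‖ ≤ q)
    (hsmall : 2 * η ≤ (‖(H.Λ.symm : X →L[ℝ] X)‖⁻¹ - η) * ((1 - q) / 2)) :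
    ∃ x, ‖x‖ < 1 ∧ F x = y := by
  have happ : ApproximatesLinearOn F (H.Λ : X →L[ℝ] X) (Metric.closedBall 0 R) η.toNNReal := by
    intro x hx x' hx'
    rw [mem_closedBall_zero_iff] at hx hx'
    have h := hF x hx x' hx'
    rw [Real.coe_toNNReal _ hη]
    refine le_trans (le_of_eq ?_) h
    congr 1
    rw [map_sub]
    simp only [ContinuousLinearEquiv.coe_coe]
    abel
  -- The point `b` is the exact preimage for the affine map, and `F b` misses `y` by at most 2η.
  -- Quantitative surjectivity on the ball of radius (1 - q)/2 about `b`, which lies inside the open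
  -- unit ball, corrects the error.
  set b := H.Λ.symm (y - v) with hb
  have hq0 : 0 ≤ q := (norm_nonneg _).trans hy
  have hsub : Metric.closedBall b ((1 - q) / 2) ⊆ Metric.closedBall 0 R := by
    intro x hx
    rw [mem_closedBall_iff_norm] at hx
    rw [mem_closedBall_zero_iff]
    have := norm_le_norm_add_norm_sub' x b
    linarith
  have hsurj := happ.surjOn_closedBall_of_nonlinearRightInverse
    H.Λ.toNonlinearRightInverse (by linarith) hsub
  have hyb : y ∈ Metric.closedBall (F b) (((H.Λ.toNonlinearRightInverse.nnnorm : ℝ)⁻¹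
      - η.toNNReal) * ((1 - q) / 2)) := by
    rw [mem_closedBall_iff_norm, Real.coe_toNNReal _ hη]
    have hbR : ‖b‖ ≤ R := by linarith
    have h1 := hF b hbR 0 (by simpa using zero_le_one.trans hR)
    have hΛb : H.Λ b = y - v := by simp [hb]
    rw [hΛb, map_zero, sub_zero, sub_zero] at h1
    have e : y - F b = -((F b - (y - v) - F 0) + (F 0 - v)) := by abel
    have h2 : η * ‖b‖ ≤ η := mul_le_of_le_one_right hη (by linarith)
    calc ‖y - F b‖ ≤ ‖F b - (y - v) - F 0‖ + ‖F 0 - v‖ := by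
          rw [e, norm_neg]; exact norm_add_le _ _
      _ ≤ 2 * η := by linarith
      _ ≤ _ := hsmall
  obtain ⟨x, hx, hxy⟩ := hsurj hyb
  refine ⟨x, ?_, hxy⟩
  rw [mem_closedBall_iff_norm] at hx
  have := norm_le_norm_add_norm_sub' x b
  linarith

end HypLin

/-- Restriction to zero slope followed by projection does not increase operator norms. This derives
the estimates on the base from those for the lift, with the same constants. -/
theorem NearFamily.fst {𝒜 Y Z : Type*} [NormedAddCommGroup Y] [NormedSpace ℝ Y]
    [NormedAddCommGroup Z] [NormedSpace ℝ Z] {H : HypLin Y} {A : Z ≃L[ℝ] Z}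
    {hA : ∀ z, ‖A z‖ ≤ H.rate * ‖z‖} {η R τ : ℝ} {f : 𝒜 → Y × Z → Y × Z}
    {Df : 𝒜 → Y × Z → Y × Z →L[ℝ] Y × Z} (h : NearFamily (H.prodContraction A hA) η R τ f Df) :
    NearFamily H η R τ (fun i y => (f i (y, 0)).1) (fun i y => (ContinuousLinearMap.fst ℝ Y Z).comp
      ((Df i (y, 0)).comp (ContinuousLinearMap.inl ℝ Y Z))) := by
  have hn : ∀ {y : Y}, ‖y‖ ≤ R → ‖(y, (0 : Z))‖ ≤ R := fun {y} hy => by simpa [Prod.norm_def] using hy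
  have hfi : ∀ B : Y × Z →L[ℝ] Y × Z, ‖(ContinuousLinearMap.fst ℝ Y Z).comp
      (B.comp (ContinuousLinearMap.inl ℝ Y Z))‖ ≤ ‖B‖ := by
    intro B
    refine ContinuousLinearMap.opNorm_le_bound _ (norm_nonneg _) fun v => ?_
    have h1 := B.le_opNorm (v, 0)
    have h2 : ‖(v, (0 : Z))‖ = ‖v‖ := by simp [Prod.norm_def]
    rw [h2] at h1
    exact (norm_fst_le (B (v, 0))).trans h1
  exact
  { η_nonneg := h.η_nonneg
    rate_lt := h.rate_lt
    radius := h.radius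
    deriv := fun i y hy => by
      have h1 := h.deriv i (y, 0) (hn hy)
      have h2 : HasFDerivAt (fun y : Y => (y, (0 : Z))) (ContinuousLinearMap.inl ℝ Y Z) y :=
        (hasFDerivAt_id y).prodMk (hasFDerivAt_const 0 y)
      exact (ContinuousLinearMap.fst ℝ Y Z).hasFDerivAt.comp y (h1.comp y h2)
    near := fun i y hy => by
      refine le_trans (le_of_eq ?_) ((hfi _).trans (h.near i (y, 0) (hn hy)))
      congr 1
    zero := fun i => (norm_fst_le (f i (0, 0))).trans (h.zero i)
    small := by
      refine lt_of_le_of_lt (mul_le_mul_of_nonneg_left ?_ h.η_nonneg) h.small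
      exact hfi ((H.prodContraction A hA).Λ.symm : Y × Z →L[ℝ] Y × Z) }

/-! ### Rescaling -/

section Rescale

variable {Y Z : Type*} [NormedAddCommGroup Y] [NormedSpace ℝ Y] [NormedAddCommGroup Z]
  [NormedSpace ℝ Z]

/-- The points of a fixed ball, after zooming, tend to the origin uniformly as δ → 0. -/
theorem Filter.Eventually.rescale {P : ℝ × (Y × Z) → Prop} (h : ∀ᶠ z in 𝓝 0, P z) (R : ℝ) :
    ∀ᶠ δ : ℝ in 𝓝[>] 0, ∀ x : Y × Z, ‖x‖ ≤ R → P (δ, (δ ^ 2 • x.1, δ • x.2)) := by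
  obtain ⟨r, hr, hP⟩ := Metric.eventually_nhds_iff.1 h
  have h1 : Ioo (0 : ℝ) (min 1 (r / (max 1 R))) ∈ 𝓝[>] (0 : ℝ) :=
    Ioo_mem_nhdsGT (by positivity)
  filter_upwards [h1] with δ hδ x hx
  apply hP
  have hM : 0 < max 1 R := by positivity
  have h2 : δ * max 1 R < r := (lt_div_iff₀ hM).1 (hδ.2.trans_le (min_le_right _ _))
  have h3 : δ < 1 := hδ.2.trans_le (min_le_left _ _)
  have hδ0 := hδ.1
  rw [dist_zero_right]
  refine lt_of_le_of_lt ?_ h2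
  refine norm_prod_le_iff.2 ⟨?_, norm_prod_le_iff.2 ⟨?_, ?_⟩⟩
  · simp only [Real.norm_of_nonneg hδ0.le]
    exact le_mul_of_one_le_right hδ0.le (le_max_left _ _)
  · simp only [norm_smul, norm_pow, Real.norm_of_nonneg hδ0.le]
    have h4 : ‖x.1‖ ≤ max 1 R := ((norm_fst_le x).trans hx).trans (le_max_right _ _)
    rw [pow_two, mul_assoc]
    refine mul_le_mul_of_nonneg_left ?_ hδ0.le
    exact (mul_le_of_le_one_left (norm_nonneg _) h3.le).trans h4
  · simp only [norm_smul, Real.norm_of_nonneg hδ0.le]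
    exact mul_le_mul_of_nonneg_left (((norm_snd_le x).trans hx).trans (le_max_right _ _)) hδ0.le

/-- A map of `Y × Z` with a parameter `δ`, rescaled by `δ ^ 2` in `Y` and by `δ` in `Z`. -/
def rescale (Ψ₁ : ℝ × Y → Y) (Ψ₂ : ℝ × (Y × Z) → Z) (t : Y) (δ : ℝ) (x : Y × Z) : Y × Z :=
  ((δ ^ 2)⁻¹ • Ψ₁ (δ, δ ^ 2 • x.1) + t, δ⁻¹ • Ψ₂ (δ, (δ ^ 2 • x.1, δ • x.2)))

variable {Ψ₁ : ℝ × Y → Y} {Ψ₂ : ℝ × (Y × Z) → Z} {Λ : Y →L[ℝ] Y} {A : Z →L[ℝ] Z} {h : Z}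

/-- The powers of δ cancel in the diagonal blocks, while the effect of position on slope keeps a
factor δ² / δ = δ. -/
theorem hasFDerivAt_rescale (t : Y) {δ : ℝ} (hδ : 0 < δ) {x : Y × Z}
    (h₁ : DifferentiableAt ℝ Ψ₁ (δ, δ ^ 2 • x.1))
    (h₂ : DifferentiableAt ℝ Ψ₂ (δ, (δ ^ 2 • x.1, δ • x.2))) :
    HasFDerivAt (rescale Ψ₁ Ψ₂ t δ)
      ((((fderiv ℝ Ψ₁ (δ, δ ^ 2 • x.1)).comp (ContinuousLinearMap.inr ℝ ℝ Y)).comp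
          (ContinuousLinearMap.fst ℝ Y Z)).prod
        ((fderiv ℝ Ψ₂ (δ, (δ ^ 2 • x.1, δ • x.2))).comp
          ((ContinuousLinearMap.inr ℝ ℝ (Y × Z)).comp
            ((δ • ContinuousLinearMap.fst ℝ Y Z).prod (ContinuousLinearMap.snd ℝ Y Z))))) x := by
  have g₁ : HasFDerivAt (fun x : Y × Z => (δ, δ ^ 2 • x.1))
      ((0 : Y × Z →L[ℝ] ℝ).prod (δ ^ 2 • ContinuousLinearMap.fst ℝ Y Z)) x :=
    (hasFDerivAt_const δ x).prodMk (hasFDerivAt_fst.const_smul (δ ^ 2))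
  have g₂ : HasFDerivAt (fun x : Y × Z => (δ, (δ ^ 2 • x.1, δ • x.2)))
      ((0 : Y × Z →L[ℝ] ℝ).prod ((δ ^ 2 • ContinuousLinearMap.fst ℝ Y Z).prod
        (δ • ContinuousLinearMap.snd ℝ Y Z))) x :=
    (hasFDerivAt_const δ x).prodMk ((hasFDerivAt_fst.const_smul (δ ^ 2)).prodMk
      (hasFDerivAt_snd.const_smul δ))
  have k₁ := ((h₁.hasFDerivAt.comp x g₁).const_smul (δ ^ 2)⁻¹).add_const t
  have k₂ := (h₂.hasFDerivAt.comp x g₂).const_smul δ⁻¹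
  refine (k₁.prodMk k₂).congr_fderiv (ContinuousLinearMap.ext fun v => ?_)
  have hδ0 := hδ.ne'
  refine Prod.ext ?_ ?_
  · change (δ ^ 2)⁻¹ • fderiv ℝ Ψ₁ _ ((0 : ℝ), δ ^ 2 • v.1) = fderiv ℝ Ψ₁ _ ((0 : ℝ), v.1)
    rw [← map_smul]
    congr 1
    simp [smul_smul, hδ0]
  · change δ⁻¹ • fderiv ℝ Ψ₂ _ ((0 : ℝ), (δ ^ 2 • v.1, δ • v.2))
      = fderiv ℝ Ψ₂ _ ((0 : ℝ), (δ • v.1, v.2))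
    rw [← map_smul]
    congr 1
    simp only [Prod.smul_mk, smul_zero, smul_smul, inv_mul_cancel₀ hδ0, one_smul, pow_two,
      inv_mul_cancel_left₀ hδ0]

/-- The rescaled maps converge to their linear part in the `C¹` topology on balls. -/
theorem eventually_rescale_near (t : Y) (h₁ : ContDiffAt ℝ 1 Ψ₁ 0) (h₂ : ContDiffAt ℝ 1 Ψ₂ 0)
    (d₁ : HasFDerivAt (fun y => Ψ₁ (0, y)) Λ 0) (d₂ : HasFDerivAt (fun z => Ψ₂ (0, (0, z))) A 0)
    (R : ℝ) {η : ℝ} (hη : 0 < η) :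
    ∀ᶠ δ : ℝ in 𝓝[>] 0, ∀ x : Y × Z, ‖x‖ ≤ R → DifferentiableAt ℝ (rescale Ψ₁ Ψ₂ t δ) x ∧
      ‖fderiv ℝ (rescale Ψ₁ Ψ₂ t δ) x - Λ.prodMap A‖ ≤ η := by
  have e₁ : ∀ v, fderiv ℝ Ψ₁ 0 (0, v) = Λ v := by
    intro v
    have g : HasFDerivAt (fun y : Y => ((0 : ℝ), y)) (ContinuousLinearMap.inr ℝ ℝ Y) 0 :=
      (hasFDerivAt_const (0 : ℝ) (0 : Y)).prodMk (hasFDerivAt_id 0)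
    have k := ((h₁.differentiableAt one_ne_zero).hasFDerivAt).comp (0 : Y) g
    exact DFunLike.congr_fun (k.unique d₁) v
  have e₂ : ∀ v, fderiv ℝ Ψ₂ 0 (0, (0, v)) = A v := by
    intro v
    have g : HasFDerivAt (fun z : Z => ((0 : ℝ), ((0 : Y), z)))
        ((ContinuousLinearMap.inr ℝ ℝ (Y × Z)).comp (ContinuousLinearMap.inr ℝ Y Z)) 0 :=
      ((ContinuousLinearMap.inr ℝ ℝ (Y × Z)).comp (ContinuousLinearMap.inr ℝ Y Z)).hasFDerivAt
    have k := ((h₂.differentiableAt one_ne_zero).hasFDerivAt).comp (0 : Z) g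
    exact DFunLike.congr_fun (k.unique d₂) v
  -- One half is for the oscillation of the derivatives near the origin, the other for the coupling
  -- term with its factor δ.
  let η' := η / 2
  have hη' : 0 < η' := half_pos hη
  have c₁ : ∀ᶠ z in 𝓝 (0 : ℝ × Y), DifferentiableAt ℝ Ψ₁ z ∧ ‖fderiv ℝ Ψ₁ z - fderiv ℝ Ψ₁ 0‖ < η' := by
    refine ((h₁.eventually (by simp)).mono fun z hz => hz.differentiableAt one_ne_zero).and ?_
    have := (h₁.continuousAt_fderiv one_ne_zero).eventually (Metric.ball_mem_nhds _ hη')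
    simpa [dist_eq_norm] using this
  have c₂ : ∀ᶠ z in 𝓝 (0 : ℝ × (Y × Z)), DifferentiableAt ℝ Ψ₂ z ∧
      ‖fderiv ℝ Ψ₂ z - fderiv ℝ Ψ₂ 0‖ < η' := by
    refine ((h₂.eventually (by simp)).mono fun z hz => hz.differentiableAt one_ne_zero).and ?_
    have := (h₂.continuousAt_fderiv one_ne_zero).eventually (Metric.ball_mem_nhds _ hη')
    simpa [dist_eq_norm] using this
  have c₁' : ∀ᶠ z in 𝓝 (0 : ℝ × (Y × Z)), DifferentiableAt ℝ Ψ₁ (z.1, z.2.1) ∧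
      ‖fderiv ℝ Ψ₁ (z.1, z.2.1) - fderiv ℝ Ψ₁ 0‖ < η' := by
    have hc : Continuous fun z : ℝ × (Y × Z) => (z.1, z.2.1) := by fun_prop
    exact (hc.tendsto 0).eventually c₁
  have c₃ : ∀ᶠ δ : ℝ in 𝓝[>] 0, δ * ‖fderiv ℝ Ψ₂ 0‖ < η' := by
    have hc : Continuous fun δ : ℝ => δ * ‖fderiv ℝ Ψ₂ 0‖ := by fun_prop
    have := (hc.tendsto 0).eventually (gt_mem_nhds (show 0 * ‖fderiv ℝ Ψ₂ 0‖ < η' by simpa))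
    exact nhdsWithin_le_nhds this
  filter_upwards [c₁'.rescale R, c₂.rescale R, c₃, Ioo_mem_nhdsGT (zero_lt_one' ℝ)] with δ k₁ k₂ k₃ k₄ x hx
  have hδ : 0 < δ := k₄.1
  have k₁ := k₁ x hx
  have k₂ := k₂ x hx
  have hd := hasFDerivAt_rescale t hδ k₁.1 k₂.1
  refine ⟨hd.differentiableAt, ?_⟩
  rw [hd.fderiv]
  refine ContinuousLinearMap.opNorm_le_bound _ hη.le fun v => ?_
  refine norm_prod_le_iff.2 ⟨?_, ?_⟩
  · change ‖fderiv ℝ Ψ₁ (δ, δ ^ 2 • x.1) (0, v.1) - Λ v.1‖ ≤ η * ‖v‖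
    rw [← e₁, ← sub_apply]
    refine (ContinuousLinearMap.le_opNorm _ _).trans ?_
    refine mul_le_mul (k₁.2.le.trans (half_le_self hη.le)) ?_ (norm_nonneg _) hη.le
    exact norm_prod_le_iff.2 ⟨by simp, norm_fst_le v⟩
  · change ‖fderiv ℝ Ψ₂ (δ, (δ ^ 2 • x.1, δ • x.2)) (0, (δ • v.1, v.2)) - A v.2‖ ≤ η * ‖v‖
    have e : fderiv ℝ Ψ₂ (δ, (δ ^ 2 • x.1, δ • x.2)) (0, (δ • v.1, v.2)) - A v.2
        = fderiv ℝ Ψ₂ (δ, (δ ^ 2 • x.1, δ • x.2)) (0, (δ • v.1, v.2)) - fderiv ℝ Ψ₂ 0 (0, (δ • v.1, v.2))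
          + δ • fderiv ℝ Ψ₂ 0 (0, (v.1, 0)) := by
      rw [← e₂, ← map_smul, sub_add, ← map_sub]
      congr 2
      simp
    have n₁ : ‖((0 : ℝ), (δ • v.1, v.2))‖ ≤ ‖v‖ := by
      refine norm_prod_le_iff.2 ⟨by simp, norm_prod_le_iff.2 ⟨?_, norm_snd_le v⟩⟩
      simp only [norm_smul, Real.norm_of_nonneg hδ.le]
      exact (mul_le_of_le_one_left (norm_nonneg _) k₄.2.le).trans (norm_fst_le v)
    have n₂ : ‖((0 : ℝ), (v.1, (0 : Z)))‖ ≤ ‖v‖ :=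
      norm_prod_le_iff.2 ⟨by simp, norm_prod_le_iff.2 ⟨norm_fst_le v, by simp⟩⟩
    rw [e, ← sub_apply]
    have m₁ : ‖(fderiv ℝ Ψ₂ (δ, (δ ^ 2 • x.1, δ • x.2)) - fderiv ℝ Ψ₂ 0) (0, (δ • v.1, v.2))‖
        ≤ η' * ‖v‖ :=
      (ContinuousLinearMap.le_opNorm _ _).trans (mul_le_mul k₂.2.le n₁ (norm_nonneg _) hη'.le)
    have m₂ : ‖δ • fderiv ℝ Ψ₂ 0 (0, (v.1, 0))‖ ≤ η' * ‖v‖ := by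
      rw [norm_smul, Real.norm_of_nonneg hδ.le]
      calc δ * ‖fderiv ℝ Ψ₂ 0 (0, (v.1, 0))‖ ≤ δ * (‖fderiv ℝ Ψ₂ 0‖ * ‖v‖) :=
            mul_le_mul_of_nonneg_left ((ContinuousLinearMap.le_opNorm _ _).trans
              (mul_le_mul_of_nonneg_left n₂ (norm_nonneg _))) hδ.le
        _ = (δ * ‖fderiv ℝ Ψ₂ 0‖) * ‖v‖ := by ring
        _ ≤ _ := mul_le_mul_of_nonneg_right k₃.le (norm_nonneg _)
    calc _ ≤ η' * ‖v‖ + η' * ‖v‖ := (norm_add_le _ _).trans (add_le_add m₁ m₂)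
      _ = η * ‖v‖ := by simp only [η']; ring

/-- At the origin the slope component is a difference quotient in δ, which tends to the derivative
`h`. -/
theorem eventually_rescale_zero (t : Y) (h₁ : ∀ δ, Ψ₁ (δ, 0) = 0) (h₂ : Ψ₂ (0, 0) = 0)
    (d₂ : HasDerivAt (fun δ => Ψ₂ (δ, 0)) h 0) {η : ℝ} (hη : 0 < η) :
    ∀ᶠ δ : ℝ in 𝓝[>] 0, ‖rescale Ψ₁ Ψ₂ t δ 0 - (t, h)‖ ≤ η := by
  have h1 := d₂.tendsto_slope_zero_right
  simp only [zero_add, h₂, sub_zero] at h1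
  filter_upwards [h1.eventually (Metric.closedBall_mem_nhds h hη)] with δ hδ
  have hδ : dist (δ⁻¹ • Ψ₂ (δ, 0)) h ≤ η := hδ
  rw [dist_eq_norm] at hδ
  refine norm_prod_le_iff.2 ⟨?_, ?_⟩
  · simpa [rescale, h₁] using hη.le
  · have e : (0 : Y × Z) = (0, 0) := rfl
    rw [e] at hδ
    simpa [rescale] using hδ

end Rescale

/-! ### The maps in the chart -/

section GraphTransform

variable {U W : Type*} [NormedAddCommGroup U] [NormedSpace ℝ U] [NormedAddCommGroup W]
  [NormedSpace ℝ W]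

/-- The second component vanishes at 0, so the derivative of the inverse of the first component does
not contribute. -/
theorem hasDerivAt_graphSlope [CompleteSpace U] {J : ℝ → U →L[ℝ] U × W} {J' : U →L[ℝ] U × W}
    (hJ : HasDerivAt J J' 0) (a : U ≃L[ℝ] U)
    (h0 : J 0 = (ContinuousLinearMap.inl ℝ U W).comp (a : U →L[ℝ] U)) :
    HasDerivAt (fun δ => graphSlope (J δ))
      (((ContinuousLinearMap.snd ℝ U W).comp J').comp (a.symm : U →L[ℝ] U)) 0 := by
  have h1 : HasDerivAt (fun δ => (ContinuousLinearMap.snd ℝ U W).comp (J δ))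
      ((ContinuousLinearMap.snd ℝ U W).comp J') 0 := by
    have := (hasDerivAt_const (0 : ℝ) (ContinuousLinearMap.snd ℝ U W)).clm_comp hJ
    simpa using this
  have h2 : HasDerivAt (fun δ => (ContinuousLinearMap.fst ℝ U W).comp (J δ))
      ((ContinuousLinearMap.fst ℝ U W).comp J') 0 := by
    have := (hasDerivAt_const (0 : ℝ) (ContinuousLinearMap.fst ℝ U W)).clm_comp hJ
    simpa using this
  have hf0 : (ContinuousLinearMap.fst ℝ U W).comp (J 0) = (a : U →L[ℝ] U) := by
    rw [h0]; rfl
  have h3 : DifferentiableAt ℝ ContinuousLinearMap.inverse ((ContinuousLinearMap.fst ℝ U W).comp (J 0)) := by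
    rw [hf0]
    exact (contDiffAt_map_inverse (n := 1) a).differentiableAt one_ne_zero
  have h4 := (h3.hasFDerivAt.comp_hasDerivAt 0 h2)
  have h5 := h1.clm_comp h4
  refine h5.congr_deriv ?_
  have hs0 : (ContinuousLinearMap.snd ℝ U W).comp (J 0) = 0 := by
    rw [h0]; ext1 u; rfl
  rw [hs0, ContinuousLinearMap.zero_comp, add_zero, Function.comp_apply, hf0,
    ContinuousLinearMap.inverse_equiv]

theorem graphSlope_prodMap (a : U ≃L[ℝ] U) (d : W →L[ℝ] W) (K : U →L[ℝ] W) :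
    graphSlope (((a : U →L[ℝ] U).prodMap d).comp (graphMap K)) = d.comp (K.comp (a.symm : U →L[ℝ] U)) := by
  have h1 : (ContinuousLinearMap.fst ℝ U W).comp (((a : U →L[ℝ] U).prodMap d).comp (graphMap K)) = (a : U →L[ℝ] U) := by
    ext1 u; simp [graphMap_apply]
  have h2 : (ContinuousLinearMap.snd ℝ U W).comp (((a : U →L[ℝ] U).prodMap d).comp (graphMap K)) = d.comp K := by
    ext1 u; simp [graphMap_apply]
  rw [graphSlope, h1, h2, ContinuousLinearMap.inverse_equiv]
  rfl

end GraphTransform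

/-! ### Moving a subspace by rotations. -/

section Skew

variable {E U W : Type*} [NormedAddCommGroup E] [InnerProductSpace ℝ E] [FiniteDimensional ℝ E]
  [NormedAddCommGroup U] [NormedSpace ℝ U] [NormedAddCommGroup W] [NormedSpace ℝ W]

/-- Any infinitesimal displacement of a subspace is produced by a skew-adjoint map. -/
theorem exists_skewAdjoint (S : E ≃L[ℝ] U × W) {F : Submodule ℝ E} (hF : ∀ v, v ∈ F ↔ (S v).2 = 0)
    (h : U →L[ℝ] W) : ∃ B ∈ skewAdjoint (E →L[ℝ] E), ∀ u, (S (B (S.symm (u, 0)))).2 = h u := by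
  let P : E →L[ℝ] E := F.starProjection
  let N : E →L[ℝ] E := (S.symm : U × W →L[ℝ] E) ∘L (ContinuousLinearMap.inr ℝ U W ∘L
    (h ∘L (ContinuousLinearMap.fst ℝ U W ∘L (S : E →L[ℝ] U × W))))
  -- `N` has the required slope but need not be skew. The part `N₁` differs from it on `F` by
  -- vectors of `F`, which the second coordinate does not see, and the adjoint of `N₁` vanishes on
  -- `F`. Hence antisymmetrising is harmless.
  let N₁ : E →L[ℝ] E := (1 - P) * N * P
  refine ⟨N₁ - star N₁, ?_, fun u => ?_⟩
  · rw [skewAdjoint.mem_iff, star_sub, star_star, neg_sub]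
  · set v := S.symm (u, 0) with hv
    have hSv : S v = (u, 0) := by simp [hv]
    have hvF : v ∈ F := by rw [hF, hSv]
    have hPv : P v = v := Submodule.starProjection_eq_self_iff.2 hvF
    have hP : star P = P := isSelfAdjoint_starProjection F
    have hstar : star N₁ v = 0 := by
      have e : star N₁ = P * (star N * (1 - P)) := by
        simp only [N₁, star_mul, star_sub, star_one, hP]
      rw [e]
      change P (star N (v - P v)) = 0
      rw [hPv, sub_self, map_zero, map_zero]
    have hN₁ : N₁ v = N v - P (N v) := by
      change N (P v) - P (N (P v)) = _
      rw [hPv]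
    have hPF : (S (P (N v))).2 = 0 := (hF _).1 (F.starProjection_apply_mem _)
    have hNv : N v = S.symm (0, h u) := by simp [N, hSv]
    rw [sub_apply, hstar, sub_zero, hN₁, map_sub, Prod.snd_sub, hPF, sub_zero, hNv]
    simp

/-- The one-parameter group of linear isometries generated by a skew-adjoint map. -/
def expIsometry (B : E →L[ℝ] E) (hB : B ∈ skewAdjoint (E →L[ℝ] E)) (t : ℝ) : E ≃ₗᵢ[ℝ] E :=
  Unitary.linearIsometryEquiv ⟨NormedSpace.exp (t • B), by
    let _ : NormedAlgebra ℚ (E →L[ℝ] E) := NormedAlgebra.restrictScalars ℚ ℝ (E →L[ℝ] E)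
    exact NormedSpace.exp_mem_unitary_of_mem_skewAdjoint (skewAdjoint.smul_mem t hB)⟩

theorem coe_expIsometry (B : E →L[ℝ] E) (hB : B ∈ skewAdjoint (E →L[ℝ] E)) (t : ℝ) :
    ((expIsometry B hB t).toContinuousLinearEquiv : E →L[ℝ] E) = NormedSpace.exp (t • B) := rfl

theorem contDiff_exp_smul (B : E →L[ℝ] E) {n : WithTop ℕ∞} :
    ContDiff ℝ n fun t : ℝ => NormedSpace.exp (t • B) := by
  have h : ContDiff ℝ n (NormedSpace.exp : (E →L[ℝ] E) → E →L[ℝ] E) :=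
    contDiff_iff_contDiffAt.2 fun x => (NormedSpace.exp_analytic (𝕂 := ℝ) x).contDiffAt
  exact h.comp (contDiff_id.smul contDiff_const)

theorem hasDerivAt_exp_smul_zero (B : E →L[ℝ] E) :
    HasDerivAt (fun t : ℝ => NormedSpace.exp (t • B)) B 0 := by
  have h1 : HasDerivAt (fun t : ℝ => t • B) B 0 := by
    simpa using (hasDerivAt_id (0 : ℝ)).smul_const B
  have h2 := hasFDerivAt_exp_zero (𝕂 := ℝ) (𝔸 := E →L[ℝ] E)
  rw [← zero_smul ℝ B] at h2
  exact h2.comp_hasDerivAt 0 h1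

end Skew

section ChartMaps

theorem exp_zero_smul {E : Type*} [NormedAddCommGroup E] [NormedSpace ℝ E] (B : E →L[ℝ] E) :
    NormedSpace.exp ((0 : ℝ) • B) = ContinuousLinearMap.id ℝ E := by
  rw [zero_smul, NormedSpace.exp_zero]
  rfl

variable {c ℓ : ℕ} {r : WithTop ℕ∞} {Y : Type*} [NormedAddCommGroup Y] [NormedSpace ℝ Y]

/-- The affine twist of `φ` by `exp (δ B)`, with a translation by `s` after fixing `p`. -/
def EucDiffeo.expTwistShift (B : Euc c →L[ℝ] Euc c) (hB : B ∈ skewAdjoint (Euc c →L[ℝ] Euc c))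
    (p s : Euc c) (δ : ℝ) : Euc c :=
  p - expIsometry B hB δ p + δ ^ 2 • s

/-- The twisted map in affine coordinates centred at `p`. -/
def twistChart (φ : EucDiffeo c r) (p : Euc c) (T : Y ≃L[ℝ] Euc c) (B : Euc c →L[ℝ] Euc c)
    (z : ℝ × Y) : Y :=
  T.symm (NormedSpace.exp (z.1 • B) (φ (p + T z.2) - p))

/-- The derivative of the twisted map on the graph of a linear map. -/
def twistGraph (φ : EucDiffeo c r) (p : Euc c) (T : Y ≃L[ℝ] Euc c)
    (S : Euc c ≃L[ℝ] Euc ℓ × Euc (c - ℓ)) (B : Euc c →L[ℝ] Euc c)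
    (z : ℝ × (Y × (Euc ℓ →L[ℝ] Euc (c - ℓ)))) : Euc ℓ →L[ℝ] Euc ℓ × Euc (c - ℓ) :=
  (S : Euc c →L[ℝ] Euc ℓ × Euc (c - ℓ)) ∘L ((NormedSpace.exp (z.1 • B) ∘L fderiv ℝ φ (p + T z.2.1)) ∘L
    ((S.symm : Euc ℓ × Euc (c - ℓ) →L[ℝ] Euc c) ∘L graphMap z.2.2))

variable {φ : EucDiffeo c r} {p : Euc c} {T : Y ≃L[ℝ] Euc c}
  {S : Euc c ≃L[ℝ] Euc ℓ × Euc (c - ℓ)} {B : Euc c →L[ℝ] Euc c}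
  {L : Euc c ≃L[ℝ] Euc c} {a : Euc ℓ ≃L[ℝ] Euc ℓ} {d : Euc (c - ℓ) ≃L[ℝ] Euc (c - ℓ)}

theorem contDiff_twistChart (hr : 2 ≤ r) : ContDiff ℝ 1 (twistChart φ p T B) := by
  have h1 : ContDiff ℝ 1 φ := φ.contDiff.of_le (one_le_two.trans hr)
  have h2 : ContDiff ℝ 1 fun z : ℝ × Y => φ (p + T z.2) - p :=
    (h1.comp (contDiff_const.add (T.contDiff.comp contDiff_snd))).sub contDiff_const
  exact T.symm.contDiff.comp (((contDiff_exp_smul B).comp contDiff_fst).clm_apply h2)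

theorem contDiff_twist_fderiv (hr : 2 ≤ r) : ContDiff ℝ 1 fun z : ℝ × Y =>
    NormedSpace.exp (z.1 • B) ∘L fderiv ℝ φ (p + T z.2) := by
  have h1 : ContDiff ℝ 1 (fderiv ℝ φ) :=
    (φ.contDiff.of_le hr).fderiv_right (by norm_num [one_add_one_eq_two])
  exact ((contDiff_exp_smul B).comp contDiff_fst).clm_comp
    (h1.comp (contDiff_const.add (T.contDiff.comp contDiff_snd)))

theorem contDiff_twistGraph (hr : 2 ≤ r) : ContDiff ℝ 1 (twistGraph φ p T S B) := by
  have h1 : ContDiff ℝ 1 fun z : ℝ × (Y × (Euc ℓ →L[ℝ] Euc (c - ℓ))) => (z.1, z.2.1) :=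
    contDiff_fst.prodMk (contDiff_fst.comp contDiff_snd)
  exact contDiff_const.clm_comp (((contDiff_twist_fderiv hr).comp h1).clm_comp
    (contDiff_const.clm_comp (contDiff_graphMap.comp (contDiff_snd.comp contDiff_snd))))

theorem twistChart_zero (hp : φ p = p) (δ : ℝ) : twistChart φ p T B (δ, 0) = 0 := by
  simp [twistChart, hp]

theorem hasFDerivAt_twistChart (hr : 2 ≤ r) (hL : fderiv ℝ φ p = (L : Euc c →L[ℝ] Euc c)) :
    HasFDerivAt (fun y => twistChart φ p T B (0, y))
      ((T.symm : Euc c →L[ℝ] Y) ∘L ((L : Euc c →L[ℝ] Euc c) ∘L (T : Y →L[ℝ] Euc c))) 0 := by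
  have h1 : HasFDerivAt φ (L : Euc c →L[ℝ] Euc c) (p + T 0) := by
    rw [← hL, map_zero, add_zero]
    exact (φ.contDiff.differentiable (zero_lt_two.trans_le hr).ne' p).hasFDerivAt
  have h2 : HasFDerivAt (fun y : Y => p + T y) (T : Y →L[ℝ] Euc c) 0 :=
    T.hasFDerivAt.const_add p
  have h3 := T.symm.hasFDerivAt.comp (0 : Y) ((h1.comp (0 : Y) h2).sub_const p)
  have e : (fun y => twistChart φ p T B (0, y)) = fun y => T.symm (φ (p + T y) - p) := by
    funext y
    simp [twistChart, exp_zero_smul]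
  rw [e]
  exact h3

theorem twistGraph_apply_zero (hL : fderiv ℝ φ p = (L : Euc c →L[ℝ] Euc c))
    (hS : ∀ v, S (L v) = (a (S v).1, d (S v).2)) (K : Euc ℓ →L[ℝ] Euc (c - ℓ)) :
    twistGraph φ p T S B (0, (0, K)) = ((a : Euc ℓ →L[ℝ] Euc ℓ).prodMap
      (d : Euc (c - ℓ) →L[ℝ] Euc (c - ℓ))).comp (graphMap K) := by
  ext1 u
  simp [twistGraph, exp_zero_smul, hL, hS, graphMap_apply]

theorem isInvertible_twistGraph_zero (hL : fderiv ℝ φ p = (L : Euc c →L[ℝ] Euc c))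
    (hS : ∀ v, S (L v) = (a (S v).1, d (S v).2)) :
    (ContinuousLinearMap.fst ℝ _ _ ∘L twistGraph φ p T S B 0).IsInvertible := by
  have := twistGraph_apply_zero (T := T) (B := B) hL hS 0
  rw [show (0 : ℝ × (Y × (Euc ℓ →L[ℝ] Euc (c - ℓ)))) = (0, (0, 0)) from rfl, this]
  exact ⟨a, by ext1 u; simp [graphMap_apply]⟩

theorem eventually_isInvertible_twistGraph (hr : 2 ≤ r) (hL : fderiv ℝ φ p = (L : Euc c →L[ℝ] Euc c))
    (hS : ∀ v, S (L v) = (a (S v).1, d (S v).2)) :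
    ∀ᶠ z in 𝓝 0, (ContinuousLinearMap.fst ℝ _ _ ∘L twistGraph φ p T S B z).IsInvertible := by
  have hc : Continuous fun z => ContinuousLinearMap.fst ℝ _ _ ∘L twistGraph φ p T S B z :=
    continuous_const.clm_comp (contDiff_twistGraph hr).continuous
  obtain ⟨e, he⟩ := isInvertible_twistGraph_zero (T := T) (B := B) hL hS
  refine (hc.tendsto 0).eventually (p := fun f => f.IsInvertible) ?_
  have h1 := ContinuousLinearEquiv.nhds e
  rw [he] at h1
  exact h1

theorem contDiffAt_graphSlope_twistGraph (hr : 2 ≤ r) (hL : fderiv ℝ φ p = (L : Euc c →L[ℝ] Euc c))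
    (hS : ∀ v, S (L v) = (a (S v).1, d (S v).2)) :
    ContDiffAt ℝ 1 (fun z => graphSlope (twistGraph φ p T S B z)) 0 :=
  (contDiffAt_graphSlope (isInvertible_twistGraph_zero hL hS)).comp 0 (contDiff_twistGraph hr).contDiffAt

/-- Without twist and at the fixed point, the action on slopes is exactly linear: K ↦ d K a⁻¹. -/
theorem hasFDerivAt_graphSlope_twistGraph (hL : fderiv ℝ φ p = (L : Euc c →L[ℝ] Euc c))
    (hS : ∀ v, S (L v) = (a (S v).1, d (S v).2)) :
    HasFDerivAt (fun K => graphSlope (twistGraph φ p T S B (0, (0, K))))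
      (a.arrowCongr d : (Euc ℓ →L[ℝ] Euc (c - ℓ)) →L[ℝ] (Euc ℓ →L[ℝ] Euc (c - ℓ))) 0 := by
  have e : (fun K => graphSlope (twistGraph φ p T S B (0, (0, K))))
      = fun K => a.arrowCongr d K := by
    funext K
    rw [twistGraph_apply_zero hL hS, graphSlope_prodMap]
    rfl
  rw [e]
  exact (a.arrowCongr d).hasFDerivAt

/-- The derivative at p preserves the zero-slope plane and acts on it by `a`, and this `a` cancels
against the a⁻¹ of `hasDerivAt_graphSlope`. What remains is the displacement by `B` alone. -/
theorem hasDerivAt_graphSlope_twistGraph (hL : fderiv ℝ φ p = (L : Euc c →L[ℝ] Euc c))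
    (hS : ∀ v, S (L v) = (a (S v).1, d (S v).2)) {h : Euc ℓ →L[ℝ] Euc (c - ℓ)}
    (hB : ∀ u, (S (B (S.symm (u, 0)))).2 = h u) :
    HasDerivAt (fun δ : ℝ => graphSlope (twistGraph φ p T S B (δ, 0))) h 0 := by
  have h1 : HasDerivAt (fun δ : ℝ => twistGraph φ p T S B (δ, 0))
      ((S : Euc c →L[ℝ] Euc ℓ × Euc (c - ℓ)) ∘L ((B ∘L fderiv ℝ φ (p + T 0)) ∘L
        ((S.symm : Euc ℓ × Euc (c - ℓ) →L[ℝ] Euc c) ∘L graphMap 0))) 0 := by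
    have g1 := (hasDerivAt_exp_smul_zero B).clm_comp (hasDerivAt_const (0 : ℝ) (fderiv ℝ φ (p + T 0)))
    have g2 := g1.clm_comp (hasDerivAt_const (0 : ℝ)
      ((S.symm : Euc ℓ × Euc (c - ℓ) →L[ℝ] Euc c) ∘L graphMap (0 : Euc ℓ →L[ℝ] Euc (c - ℓ))))
    have g3 := (hasDerivAt_const (0 : ℝ) (S : Euc c →L[ℝ] Euc ℓ × Euc (c - ℓ))).clm_comp g2
    refine g3.congr_deriv ?_
    simp
  have h0 : twistGraph φ p T S B ((0 : ℝ), 0) = (ContinuousLinearMap.inl ℝ _ _).comp (a : Euc ℓ →L[ℝ] Euc ℓ) := by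
    have := twistGraph_apply_zero (T := T) (B := B) hL hS 0
    refine this.trans ?_
    ext1 u
    simp [graphMap_apply]
  refine (hasDerivAt_graphSlope h1 a h0).congr_deriv ?_
  ext1 u
  have e1 : fderiv ℝ φ (p + T 0) = (L : Euc c →L[ℝ] Euc c) := by rw [map_zero, add_zero, hL]
  have e2 : L (S.symm (a.symm u, 0)) = S.symm (u, 0) := by
    apply S.injective
    rw [hS]
    simp
  simp only [ContinuousLinearMap.comp_apply, e1, ContinuousLinearEquiv.coe_coe, graphMap_apply,
    zero_apply, e2, ContinuousLinearMap.coe_snd', hB]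

/-- In the chart the map induced by the twisted map is the rescaled graph transform. -/
theorem hat_affineTwist_hatChart (hr : 1 ≤ r) (hB : B ∈ skewAdjoint (Euc c →L[ℝ] Euc c))
    {δ : ℝ} (hδ : 0 < δ) (t : Y) (x : Y × (Euc ℓ →L[ℝ] Euc (c - ℓ)))
    (hinv : (ContinuousLinearMap.fst ℝ _ _ ∘L
      twistGraph φ p T S B (δ, (δ ^ 2 • x.1, δ • x.2))).IsInvertible) :
    EucDiffeo.hat ℓ hr (φ.affineTwist (expIsometry B hB δ) (EucDiffeo.expTwistShift B hB p (T t) δ))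
        (hatChart T S p (δ ^ 2) δ x)
      = hatChart T S p (δ ^ 2) δ (rescale (twistChart φ p T B)
          (fun z => graphSlope (twistGraph φ p T S B z)) t δ x) := by
  have hδ0 : δ ^ 2 ≠ 0 := by positivity
  have hexp : ∀ v, expIsometry B hB δ v = NormedSpace.exp (δ • B) v := fun v => rfl
  refine Prod.ext ?_ ?_
  · change expIsometry B hB δ (φ (p + δ ^ 2 • T x.1)) + (p - expIsometry B hB δ p + δ ^ 2 • T t)
      = p + δ ^ 2 • T ((δ ^ 2)⁻¹ • T.symm (NormedSpace.exp (δ • B) (φ (p + T (δ ^ 2 • x.1)) - p)) + t)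
    rw [map_add T, map_smul T _ (T.symm _), ContinuousLinearEquiv.apply_symm_apply, smul_add,
      smul_smul, mul_inv_cancel₀ hδ0, one_smul, map_smul T, ← hexp, map_sub]
    abel
  · change EucDiffeo.pushPlane hr _ (p + δ ^ 2 • T x.1) (graphPlane S (δ • x.2))
      = graphPlane S (δ • δ⁻¹ • graphSlope (twistGraph φ p T S B (δ, (δ ^ 2 • x.1, δ • x.2))))
    rw [smul_inv_smul₀ hδ.ne']
    refine eq_graphPlane (J := (NormedSpace.exp (δ • B) ∘L fderiv ℝ φ (p + T (δ ^ 2 • x.1))) ∘L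
      ((S.symm : Euc ℓ × Euc (c - ℓ) →L[ℝ] Euc c) ∘L graphMap (δ • x.2))) (fun u => ?_) hinv
    refine ⟨S.symm (graphMap (δ • x.2) u), ⟨u, rfl⟩, ?_⟩
    rw [EucDiffeo.fderiv_affineTwist hr, ← map_smul, coe_expIsometry]
    rfl

end ChartMaps

/-! ### The unstable cone -/

section Cone

variable {c ℓ : ℕ}

/-- A large weight on the strong unstable component lets its expansion outweigh a possible loss in
the other component. -/
theorem exists_expanding_norm (hℓc : ℓ ≤ c) (S : Euc c ≃L[ℝ] Euc ℓ × Euc (c - ℓ)) {s : ℝ}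
    (hs : 0 < s) : ∃ N : Euc c ≃L[ℝ] Euc c, ∀ v, ‖N v‖ ^ 2 = s * ‖(S v).1‖ ^ 2 + ‖(S v).2‖ ^ 2 := by
  let E := WithLp 2 (Euc ℓ × Euc (c - ℓ))
  let e₁ : Euc ℓ ≃L[ℝ] Euc ℓ := ContinuousLinearEquiv.smulLeft (Units.mk0 (√s) (Real.sqrt_ne_zero'.2 hs))
  let e₂ : (Euc ℓ × Euc (c - ℓ)) ≃L[ℝ] E := (WithLp.prodContinuousLinearEquiv 2 ℝ (Euc ℓ) (Euc (c - ℓ))).symm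
  have hE : Module.finrank ℝ E = c := by
    rw [← e₂.toLinearEquiv.finrank_eq, Module.finrank_prod]
    simp [hℓc]
  let e₃ : E ≃ₗᵢ[ℝ] Euc c := ((stdOrthonormalBasis ℝ E).reindex (finCongr hE)).repr
  refine ⟨S.trans ((e₁.prodCongr (ContinuousLinearEquiv.refl ℝ _)).trans
    (e₂.trans e₃.toContinuousLinearEquiv)), fun v => ?_⟩
  have h : ‖e₃ (e₂ (√s • (S v).1, (S v).2))‖ ^ 2 = s * ‖(S v).1‖ ^ 2 + ‖(S v).2‖ ^ 2 := by
    rw [e₃.norm_map, WithLp.prod_norm_sq_eq_of_L2]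
    have h1 : (e₂ (√s • (S v).1, (S v).2)).fst = √s • (S v).1 := rfl
    have h2 : (e₂ (√s • (S v).1, (S v).2)).snd = (S v).2 := rfl
    rw [h1, h2, norm_smul, mul_pow, Real.norm_of_nonneg (Real.sqrt_nonneg _), Real.sq_sqrt hs.le]
  exact h

theorem mem_interior_cone (S : Euc c ≃L[ℝ] Euc ℓ × Euc (c - ℓ)) {v : Euc c}
    (hv : ‖(S v).2‖ < ‖(S v).1‖) : v ∈ interior {v | ‖(S v).2‖ ≤ ‖(S v).1‖} := by
  have ho : IsOpen {v | ‖(S v).2‖ < ‖(S v).1‖} :=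
    isOpen_lt (continuous_snd.comp S.continuous).norm (continuous_fst.comp S.continuous).norm
  exact interior_maximal (fun w (hw : ‖(S w).2‖ < ‖(S w).1‖) => hw.le) ho hv

/-- Perturbations of a dominated linear map leave a cone invariant and expand it. -/
theorem exists_cone_bounds (hℓc : ℓ ≤ c) (S : Euc c ≃L[ℝ] Euc ℓ × Euc (c - ℓ))
    {a : Euc ℓ ≃L[ℝ] Euc ℓ} {d : Euc (c - ℓ) ≃L[ℝ] Euc (c - ℓ)} {μ m : ℝ} (hμ0 : 0 < μ) (hμ1 : μ < 1)
    (hm : 1 ≤ m) (hd : ∀ w, ‖d w‖ ≤ μ * m * ‖w‖) (ha : ∀ u, m * ‖u‖ ≤ μ * ‖a u‖) :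
    ∃ η > 0, ∃ (N : Euc c ≃L[ℝ] Euc c) (θ : ℝ), 1 < θ ∧ ∀ Q : Euc c →L[ℝ] Euc c,
      ‖(S : Euc c →L[ℝ] Euc ℓ × Euc (c - ℓ)) ∘L (Q ∘L (S.symm : Euc ℓ × Euc (c - ℓ) →L[ℝ] Euc c))
        - (a : Euc ℓ →L[ℝ] Euc ℓ).prodMap (d : Euc (c - ℓ) →L[ℝ] Euc (c - ℓ))‖ < η →
      ∀ v, ‖(S v).2‖ ≤ ‖(S v).1‖ → (v ≠ 0 → ‖(S (Q v)).2‖ < ‖(S (Q v)).1‖) ∧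
        θ * ‖N v‖ ≤ ‖N (Q v)‖ := by
  -- On the cone the first component is stretched at least by m (1 + 4η), as 1/μ ≥ 2 - μ, and the
  -- second becomes at most m (1 - 4η) times the first. A perturbation of size η leaves both gaps
  -- open.
  let η := (1 - μ) / 4
  have hη : 0 < η := by simp only [η]; linarith
  let θ₀ := 1 + η
  have hθ₀ : 1 < θ₀ := by simp only [θ₀]; linarith
  -- The weight s = 1/η solves s θ₀² = θ₀ (s + 1) for θ₀ = 1 + η. So the gain in the first component
  -- alone pays for the whole norm, with factor √θ₀.
  obtain ⟨N, hN⟩ := exists_expanding_norm hℓc S (s := 1 / η) (by positivity)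
  refine ⟨η, hη, N, √θ₀, by rw [Real.lt_sqrt] <;> linarith, fun Q hQ v hv => ?_⟩
  have hclose : ‖S (Q v) - (a (S v).1, d (S v).2)‖ ≤ η * ‖(S v).1‖ := by
    have h1 := (ContinuousLinearMap.le_opNorm _ (S v)).trans
      (mul_le_mul_of_nonneg_right hQ.le (norm_nonneg (S v)))
    have h2 : ‖S v‖ = ‖(S v).1‖ := by rw [Prod.norm_def, max_eq_left hv]
    rw [h2] at h1
    simpa [Prod.map] using h1
  have c1 : ‖(S (Q v)).1 - a (S v).1‖ ≤ η * ‖(S v).1‖ := (norm_fst_le _).trans hclose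
  have c2 : ‖(S (Q v)).2 - d (S v).2‖ ≤ η * ‖(S v).1‖ := (norm_snd_le _).trans hclose
  have b1 : ‖a (S v).1‖ - η * ‖(S v).1‖ ≤ ‖(S (Q v)).1‖ := by
    have := norm_sub_norm_le (a (S v).1) ((S (Q v)).1)
    rw [norm_sub_rev] at this
    linarith
  have b2 : ‖(S (Q v)).2‖ ≤ ‖d (S v).2‖ + η * ‖(S v).1‖ := by
    have := norm_sub_norm_le ((S (Q v)).2) (d (S v).2)
    linarith
  have b3 : ‖d (S v).2‖ ≤ μ * m * ‖(S v).1‖ :=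
    (hd _).trans (mul_le_mul_of_nonneg_left hv (by positivity))
  have n0 := norm_nonneg (S v).1
  have b4 : m * (2 - μ) * ‖(S v).1‖ ≤ ‖a (S v).1‖ := by
    have h1 := ha (S v).1
    have h2 : μ * (m * (2 - μ) * ‖(S v).1‖) ≤ μ * ‖a (S v).1‖ := by
      refine le_trans ?_ h1
      have : 0 ≤ m * ‖(S v).1‖ * (1 - μ) ^ 2 := by positivity
      nlinarith
    exact le_of_mul_le_mul_left h2 hμ0
  have b5 : m * ‖(S v).1‖ + 4 * η * (m * ‖(S v).1‖) ≤ ‖a (S v).1‖ := by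
    refine le_trans (le_of_eq ?_) b4
    simp only [η]; ring
  have b6 : ‖(S v).1‖ ≤ m * ‖(S v).1‖ := le_mul_of_one_le_left n0 hm
  have b7 : η * ‖(S v).1‖ ≤ η * (m * ‖(S v).1‖) := mul_le_mul_of_nonneg_left b6 hη.le
  have b8 : ‖d (S v).2‖ ≤ m * ‖(S v).1‖ - 4 * η * (m * ‖(S v).1‖) := by
    refine b3.trans (le_of_eq ?_)
    simp only [η]; ring
  refine ⟨fun hv0 => ?_, ?_⟩
  · have n1 : 0 < ‖(S v).1‖ := by
      rw [norm_pos_iff]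
      intro h0
      rw [h0, norm_zero, norm_le_zero_iff] at hv
      exact hv0 (S.injective (by rw [map_zero]; exact Prod.ext h0 hv))
    have : 0 < η * (m * ‖(S v).1‖) := by positivity
    linarith
  · have b9 : θ₀ * ‖(S v).1‖ ≤ ‖(S (Q v)).1‖ := by
      simp only [θ₀]
      nlinarith
    refine le_of_sq_le_sq ?_ (norm_nonneg _)
    rw [mul_pow, Real.sq_sqrt (by linarith), hN, hN]
    have h1 : ‖(S v).2‖ ^ 2 ≤ ‖(S v).1‖ ^ 2 := pow_le_pow_left₀ (norm_nonneg _) hv 2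
    have h2 : (θ₀ * ‖(S v).1‖) ^ 2 ≤ ‖(S (Q v)).1‖ ^ 2 := pow_le_pow_left₀ (by positivity) b9 2
    have h3 : 1 / η * θ₀ ^ 2 = θ₀ * (1 / η + 1) := by
      simp only [θ₀]
      field_simp
    calc θ₀ * (1 / η * ‖(S v).1‖ ^ 2 + ‖(S v).2‖ ^ 2)
        ≤ θ₀ * (1 / η * ‖(S v).1‖ ^ 2 + ‖(S v).1‖ ^ 2) := by gcongr
      _ = (θ₀ * (1 / η + 1)) * ‖(S v).1‖ ^ 2 := by ring
      _ = 1 / η * (θ₀ * ‖(S v).1‖) ^ 2 := by rw [← h3]; ring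
      _ ≤ 1 / η * ‖(S (Q v)).1‖ ^ 2 := by gcongr
      _ ≤ _ := le_add_of_nonneg_right (by positivity)

end Cone

/-! ### Covering families -/

/-- For suitable translations `v i`, all families of maps close to `Λ + v i` satisfy the estimates of
a near family and cover the unit ball. -/
theorem HypLin.exists_covering_family {X : Type*} [NormedAddCommGroup X] [NormedSpace ℝ X]
    [FiniteDimensional ℝ X] [Nontrivial X] (H : HypLin X) :
    ∃ (n : ℕ) (v : Fin n → X) (η R τ : ℝ), 2 ≤ n ∧ 0 < η ∧ 1 < R ∧
      ∀ (f : Fin n → X → X) (Df : Fin n → X → X →L[ℝ] X),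
        (∀ i x, ‖x‖ ≤ R → HasFDerivAt (f i) (Df i x) x) →
        (∀ i x, ‖x‖ ≤ R → ‖Df i x - (H.Λ : X →L[ℝ] X)‖ ≤ η) → (∀ i, ‖f i 0 - v i‖ ≤ η) →
        NearFamily H η R τ f Df ∧ ∀ y, ‖y‖ ≤ 1 → ∃ i x, ‖x‖ < 1 ∧ f i x = y := by
  have : CompleteSpace X := FiniteDimensional.complete ℝ X
  obtain ⟨n, v, hn, hv⟩ := H.exists_translations
  have hl0 := H.rate_pos
  have hl1 := H.rate_lt
  set q := max (1 / 2) H.rate with hq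
  have hq1 : q < 1 := max_lt (by norm_num) hl1
  set N := ‖(H.Λ.symm : X →L[ℝ] X)‖ with hN
  have hN0 : 0 < N := by
    obtain ⟨x, hx⟩ := exists_ne (0 : X)
    rw [hN, norm_pos_iff]
    intro h0
    apply hx
    have h1 : H.Λ.symm (H.Λ x) = 0 := DFunLike.congr_fun h0 (H.Λ x)
    simpa using h1
  have hw0 : 0 < (1 - q) / 2 := by linarith
  have hw1 : (1 - q) / 2 ≤ 1 := by
    have : (1 : ℝ) / 2 ≤ q := le_max_left _ _
    linarith
  set w := (1 - q) / 2 with hw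
  -- The second entry keeps `rate + η` below 1; the third leaves room for the inverse function
  -- estimate of `IsNear.exists_preimage` and for `small`.
  let η := min (min 1 ((1 - H.rate) / 2)) (N⁻¹ * w / 3)
  have hη0 : 0 < η := lt_min (lt_min one_pos (by linarith)) (by positivity)
  have hη1 : η ≤ 1 := (min_le_left _ _).trans (min_le_left _ _)
  have hη2 : η ≤ (1 - H.rate) / 2 := (min_le_left _ _).trans (min_le_right _ _)
  have hη3 : η ≤ N⁻¹ * w / 3 := min_le_right _ _
  have hsmall : 2 * η ≤ (N⁻¹ - η) * w := by
    have : η * w ≤ η := mul_le_of_le_one_right hη0.le hw1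
    linarith
  let τ := ∑ i, ‖v i‖ + 1
  have hτ : 1 ≤ τ := by
    have : 0 ≤ ∑ i, ‖v i‖ := Finset.sum_nonneg fun _ _ => norm_nonneg _
    simp only [τ]; linarith
  -- The radius makes (1 - rate - η) R exceed τ, so bounded orbits stay off the boundary; the
  -- summand 2 gives strictness and R > 1.
  let R := 2 * τ / (1 - H.rate) + 2
  have hR0 : 0 < 2 * τ / (1 - H.rate) := div_pos (by linarith) (by linarith)
  refine ⟨n, v, η, R, τ, hn, hη0, by simp only [R]; linarith, fun f Df h1 h2 h3 => ?_⟩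
  have hnear : NearFamily H η R τ f Df :=
  { η_nonneg := hη0.le
    rate_lt := by linarith
    radius := by
      have h4 : (1 - H.rate) / 2 * R = τ + (1 - H.rate) := by
        have : 1 - H.rate ≠ 0 := by linarith
        simp only [R]
        field_simp
      have h5 : η * R ≤ (1 - H.rate) / 2 * R :=
        mul_le_mul_of_nonneg_right hη2 (by simp only [R]; linarith)
      nlinarith
    deriv := h1
    near := h2
    zero := fun i => by
      have h4 : ‖v i‖ ≤ ∑ i, ‖v i‖ :=
        Finset.single_le_sum (f := fun i => ‖v i‖) (fun _ _ => norm_nonneg _) (Finset.mem_univ i)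
      have h5 := norm_le_norm_add_norm_sub' (f i 0) (v i)
      have h6 := h3 i
      simp only [τ]
      linarith
    small := by
      have h4 : η * N ≤ N⁻¹ * w / 3 * N := mul_le_mul_of_nonneg_right hη3 hN0.le
      have h5 : N⁻¹ * w / 3 * N = w / 3 := by field_simp
      linarith }
  refine ⟨hnear, fun y hy => ?_⟩
  obtain ⟨i, hi⟩ := hv y hy
  obtain ⟨x, hx⟩ := HypLin.IsNear.exists_preimage (hnear.isNear i) hη0.le
    (by simp only [R]; linarith) hq1 (h3 i) hi hsmall
  exact ⟨i, x, hx⟩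

/-! ### The blending regions of the twisted maps -/

section Twists

variable {c ℓ : ℕ} {r : WithTop ℕ∞} {Y : Type*} [NormedAddCommGroup Y] [NormedSpace ℝ Y]
  {φ : EucDiffeo c r} {p : Euc c} {T : Y ≃L[ℝ] Euc c}
  {S : Euc c ≃L[ℝ] Euc ℓ × Euc (c - ℓ)} {L : Euc c ≃L[ℝ] Euc c} {a : Euc ℓ ≃L[ℝ] Euc ℓ}
  {d : Euc (c - ℓ) ≃L[ℝ] Euc (c - ℓ)}

/-- The map induced by a twisted map, in the chart rescaled by `δ`. -/
def twistModel (φ : EucDiffeo c r) (p : Euc c) (T : Y ≃L[ℝ] Euc c)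
    (S : Euc c ≃L[ℝ] Euc ℓ × Euc (c - ℓ)) (B : Euc c →L[ℝ] Euc c) (t : Y) (δ : ℝ) :
    Y × (Euc ℓ →L[ℝ] Euc (c - ℓ)) → Y × (Euc ℓ →L[ℝ] Euc (c - ℓ)) :=
  rescale (twistChart φ p T B) (fun z => graphSlope (twistGraph φ p T S B z)) t δ

/-- Here the hypotheses of `HypLin.exists_covering_family` are met: the zoomed twist is C¹-close to
Λ̂ + v. Invertibility of the first component keeps the image planes in the graph chart. -/
theorem eventually_twistModel (hr : 2 ≤ r) (hp : φ p = p)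
    (hL : fderiv ℝ φ p = (L : Euc c →L[ℝ] Euc c)) (hS : ∀ v, S (L v) = (a (S v).1, d (S v).2))
    (H : HypLin Y) (hT : ∀ y, T (H.Λ y) = L (T y))
    (hA : ∀ K, ‖a.arrowCongr d K‖ ≤ H.rate * ‖K‖) {B : Euc c →L[ℝ] Euc c}
    (v : Y × (Euc ℓ →L[ℝ] Euc (c - ℓ))) (hB : ∀ u, (S (B (S.symm (u, 0)))).2 = v.2 u)
    {η : ℝ} (hη : 0 < η) (R : ℝ) :
    ∀ᶠ δ : ℝ in 𝓝[>] 0, ‖twistModel φ p T S B v.1 δ 0 - v‖ ≤ η ∧ ∀ x, ‖x‖ ≤ R →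
      (DifferentiableAt ℝ (twistModel φ p T S B v.1 δ) x ∧
      ‖fderiv ℝ (twistModel φ p T S B v.1 δ) x - ((H.prodContraction (a.arrowCongr d) hA).Λ :
        Y × (Euc ℓ →L[ℝ] Euc (c - ℓ)) →L[ℝ] Y × (Euc ℓ →L[ℝ] Euc (c - ℓ)))‖ ≤ η) ∧
      (ContinuousLinearMap.fst ℝ _ _ ∘L
        twistGraph φ p T S B (δ, (δ ^ 2 • x.1, δ • x.2))).IsInvertible := by
  have d₁ : HasFDerivAt (fun y => twistChart φ p T B (0, y)) (H.Λ : Y →L[ℝ] Y) 0 := by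
    refine (hasFDerivAt_twistChart hr hL).congr_fderiv (ContinuousLinearMap.ext fun y => ?_)
    apply T.injective
    simp [hT]
  have d₂ := hasDerivAt_graphSlope_twistGraph (T := T) hL hS hB
  have h0 : graphSlope (twistGraph φ p T S B (0, 0)) = 0 := by
    have := twistGraph_apply_zero (T := T) (B := B) hL hS 0
    refine (congrArg graphSlope this).trans ?_
    rw [graphSlope_prodMap]
    simp
  filter_upwards [eventually_rescale_zero (Ψ₂ := fun z => graphSlope (twistGraph φ p T S B z)) v.1
      (twistChart_zero hp) h0 d₂ hη,
    eventually_rescale_near v.1 (contDiff_twistChart hr).contDiffAt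
      (contDiffAt_graphSlope_twistGraph hr hL hS) d₁ (hasFDerivAt_graphSlope_twistGraph hL hS) R hη,
    (eventually_isInvertible_twistGraph (T := T) (B := B) hr hL hS).rescale R] with δ h1 h2 h3
  exact ⟨h1, fun x hx => ⟨h2 x hx, h3 x hx⟩⟩

/-- By continuity, since the twisted derivative at δ = 0 and at the fixed point is the block map of
`a` and `d`. -/
theorem eventually_cone_twist (hr : 2 ≤ r)
    (hL : fderiv ℝ φ p = (L : Euc c →L[ℝ] Euc c)) (hS : ∀ v, S (L v) = (a (S v).1, d (S v).2))
    (B : Euc c →L[ℝ] Euc c) {η : ℝ} (hη : 0 < η) (R : ℝ) :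
    ∀ᶠ δ : ℝ in 𝓝[>] 0, ∀ y : Y, ‖y‖ ≤ R →
      ‖(S : Euc c →L[ℝ] Euc ℓ × Euc (c - ℓ)) ∘L
        ((NormedSpace.exp (δ • B) ∘L fderiv ℝ φ (p + T (δ ^ 2 • y))) ∘L
          (S.symm : Euc ℓ × Euc (c - ℓ) →L[ℝ] Euc c))
        - (a : Euc ℓ →L[ℝ] Euc ℓ).prodMap (d : Euc (c - ℓ) →L[ℝ] Euc (c - ℓ))‖ < η := by
  let g : ℝ × (Y × Y) → Euc ℓ × Euc (c - ℓ) →L[ℝ] Euc ℓ × Euc (c - ℓ) := fun z =>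
    (S : Euc c →L[ℝ] Euc ℓ × Euc (c - ℓ)) ∘L
        ((NormedSpace.exp (z.1 • B) ∘L fderiv ℝ φ (p + T z.2.1)) ∘L
          (S.symm : Euc ℓ × Euc (c - ℓ) →L[ℝ] Euc c))
  have hg : Continuous g := by
    have h1 : Continuous fun z : ℝ × (Y × Y) => (z.1, z.2.1) := by fun_prop
    exact continuous_const.clm_comp
      (((contDiff_twist_fderiv (T := T) hr).continuous.comp h1).clm_comp continuous_const)
  have h0 : g 0 = (a : Euc ℓ →L[ℝ] Euc ℓ).prodMap (d : Euc (c - ℓ) →L[ℝ] Euc (c - ℓ)) := by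
    refine ContinuousLinearMap.ext fun v => ?_
    simp [g, exp_zero_smul, hL, hS, Prod.map]
  have h1 : ∀ᶠ z in 𝓝 0, ‖g z - g 0‖ < η := by
    have := (hg.tendsto 0).eventually (Metric.ball_mem_nhds _ hη)
    simpa only [Metric.mem_ball, dist_eq_norm] using this
  filter_upwards [h1.rescale R] with δ hδ y hy
  rw [← h0]
  refine hδ (y, 0) ?_
  simpa [Prod.norm_def] using hy

theorem hatChart_image_ball (T : Y ≃L[ℝ] Euc c) (S : Euc c ≃L[ℝ] Euc ℓ × Euc (c - ℓ)) (p : Euc c)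
    (ρ δ : ℝ) : hatChart T S p ρ δ '' Metric.ball 0 1
      = ((fun y => p + ρ • T y) '' Metric.ball 0 1) ×ˢ
        ((fun K => graphPlane S (δ • K)) '' Metric.ball 0 1) := by
  have h : (Metric.ball (0 : Y × (Euc ℓ →L[ℝ] Euc (c - ℓ))) 1)
      = Metric.ball 0 1 ×ˢ Metric.ball 0 1 := (ball_prod_same _ _ _).symm
  rw [h, prod_image_image_eq]
  rfl

/-- The set is the projection of an open set of the product chart, with an auxiliary affine factor.
-/
theorem isOpen_graphPlane_image (S : Euc c ≃L[ℝ] Euc ℓ × Euc (c - ℓ)) {δ : ℝ} (hδ : δ ≠ 0) :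
    IsOpen ((fun K => graphPlane S (δ • K)) '' Metric.ball 0 1) := by
  have h1 := (isEmbChart_hatChart (ContinuousLinearEquiv.refl ℝ (Euc c)) S 0 (one_ne_zero' ℝ)
    hδ).isOpenEmbedding.isOpenMap _ (Metric.isOpen_ball (x := 0) (ε := 1))
  rw [hatChart_image_ball] at h1
  have h2 := isOpenMap_snd _ h1
  rwa [snd_image_prod] at h2
  exact (Metric.nonempty_ball.2 one_pos).image _

variable [FiniteDimensional ℝ Y]

/-- The conclusions about blending regions, for maps that satisfy the estimates in the chart. -/
theorem isCsBlendingRegion_twists (hr : 2 ≤ r) {n : ℕ} (hn : 0 < n) {H : HypLin Y}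
    {hA : ∀ K, ‖a.arrowCongr d K‖ ≤ H.rate * ‖K‖} {B : Fin n → Euc c →L[ℝ] Euc c}
    (hB : ∀ i, B i ∈ skewAdjoint (Euc c →L[ℝ] Euc c)) {t : Fin n → Y} {δ η R τ : ℝ} (hδ : 0 < δ)
    (hR : 1 < R)
    {Df : Fin n → Y × (Euc ℓ →L[ℝ] Euc (c - ℓ)) →
      Y × (Euc ℓ →L[ℝ] Euc (c - ℓ)) →L[ℝ] Y × (Euc ℓ →L[ℝ] Euc (c - ℓ))}
    (hf : NearFamily (H.prodContraction (a.arrowCongr d) hA) η R τ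
      (fun i => twistModel φ p T S (B i) (t i) δ) Df)
    (hcov : ∀ y, ‖y‖ ≤ 1 → ∃ i x, ‖x‖ < 1 ∧ twistModel φ p T S (B i) (t i) δ x = y)
    (hinv : ∀ i (x : Y × (Euc ℓ →L[ℝ] Euc (c - ℓ))), ‖x‖ ≤ R → (ContinuousLinearMap.fst ℝ _ _ ∘L
        twistGraph φ p T S (B i) (δ, (δ ^ 2 • x.1, δ • x.2))).IsInvertible)
    {ψ : Fin n → EucDiffeo c r} (hψ : ψ = φ.twists (fun i => expIsometry (B i) (hB i) δ)
      fun i => EucDiffeo.expTwistShift (B i) (hB i) p (T (t i)) δ)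
    {V : Set (Euc c)} (hV : V = (fun y => p + δ ^ 2 • T y) '' Metric.ball 0 1) {G : Set (Gr ℓ c)}
    (hG : G = (fun K => graphPlane S (δ • K)) '' Metric.ball 0 1) :
    closure (V ×ˢ G) ⊆ ⋃ i, EucDiffeo.hats ℓ (one_le_two.trans hr) ψ i '' (V ×ˢ G) ∧
    (0 < Module.finrank ℝ (LinearMap.range (H.Ps : Y →ₗ[ℝ] Y)) →
      (∃ D, IsCsBlendingRegion (id : Euc c → Euc c) (fun i => (ψ i).toEquiv) V D
        (Module.finrank ℝ (LinearMap.range (H.Ps : Y →ₗ[ℝ] Y)))) ∧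
      ∃ (D : Set (Euc c × Gr ℓ c)) (k : ℕ), IsCsBlendingRegion (grEmb ℓ c)
        (EucDiffeo.hats ℓ (one_le_two.trans hr) ψ) (V ×ˢ G) D k) := by
  have : NeZero n := ⟨hn.ne'⟩
  have hVG : V ×ˢ G = hatChart T S p (δ ^ 2) δ '' Metric.ball 0 1 := by
    rw [hatChart_image_ball, hV, hG]
  have hδ2 : δ ^ 2 ≠ 0 := by positivity
  have hchart := isEmbChart_hatChart T S p hδ2 hδ.ne'
  have hconj : ∀ i x, ‖x‖ ≤ R → EucDiffeo.hats ℓ (one_le_two.trans hr) ψ i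
      (hatChart T S p (δ ^ 2) δ x)
        = hatChart T S p (δ ^ 2) δ (twistModel φ p T S (B i) (t i) δ x) := by
    intro i x hx
    rw [hψ]
    exact hat_affineTwist_hatChart (one_le_two.trans hr) (hB i) hδ (t i) x (hinv i x hx)
  have hcover : closure (V ×ˢ G) ⊆ ⋃ i, EucDiffeo.hats ℓ (one_le_two.trans hr) ψ i '' (V ×ˢ G) := by
    rw [hVG]
    refine (hchart.closure_image_ball_subset 1).trans ?_
    rintro _ ⟨y, hy, rfl⟩
    obtain ⟨i, x, hx, rfl⟩ := hcov y (by simpa using hy)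
    exact mem_iUnion.2 ⟨i, _, ⟨x, by simpa using hx, rfl⟩, hconj i x (hx.le.trans hR.le)⟩
  refine ⟨hcover, fun hpos => ⟨⟨(fun y => p + δ ^ 2 • T y) '' Metric.ball 0 R, ?_⟩,
    hatChart T S p (δ ^ 2) δ '' Metric.ball 0 R, Module.finrank ℝ (LinearMap.range
      ((H.prodContraction (a.arrowCongr d) hA).Ps : Y × (Euc ℓ →L[ℝ] Euc (c - ℓ)) →ₗ[ℝ]
        Y × (Euc ℓ →L[ℝ] Euc (c - ℓ)))), ?_⟩⟩
  · have hconj' : ∀ i (y : Y), ‖y‖ ≤ R → (ψ i).toEquiv (p + δ ^ 2 • T y)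
        = p + δ ^ 2 • T (twistModel φ p T S (B i) (t i) δ (y, 0)).1 := fun i y hy =>
      congrArg Prod.fst (hconj i (y, 0) (by simpa [Prod.norm_def] using hy))
    rw [hV]
    refine (isEmbChart_affine T p hδ2).isCsBlendingRegion (NearFamily.fst hf) hconj'
      (fun i => EucDiffeo.isLocallyBiLipschitz (one_le_two.trans hr) _) hR ?_ hpos
    refine ((isEmbChart_affine T p hδ2).closure_image_ball_subset 1).trans ?_
    rintro _ ⟨y, hy, rfl⟩
    -- A base point is covered by covering the point above it with zero slope. The slope of the
    -- preimage can be forgotten, since the base map does not see it.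
    obtain ⟨i, x, hx, hxy⟩ := hcov (y, 0) (by simpa [Prod.norm_def] using hy)
    have hx1 : ‖x.1‖ < 1 := (norm_fst_le x).trans_lt hx
    refine mem_iUnion.2 ⟨i, _, ⟨x.1, by simpa using hx1, rfl⟩, ?_⟩
    refine (congrArg Prod.fst (hconj i x (hx.le.trans hR.le))).trans ?_
    rw [hxy]
    rfl
  · rw [hVG] at hcover ⊢
    refine hchart.isCsBlendingRegion hf hconj
      (fun i => EucDiffeo.isLocallyBiLipschitz_hat hr _) hR hcover ?_
    -- A nonzero stable vector of the base, with zero slope, is stable for the lift.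
    rw [Module.finrank_pos_iff_exists_ne_zero] at hpos ⊢
    obtain ⟨⟨_, ⟨w, rfl⟩⟩, hw⟩ := hpos
    refine ⟨⟨(H.Ps w, 0), (w, 0), rfl⟩, fun h => hw (Subtype.ext ?_)⟩
    exact congrArg Prod.fst (congrArg Subtype.val h)

end Twists

/-! ### The linear model at the fixed point -/

theorem HypLin.finrank_range_ofProd {X₁ X₂ : Type*} [NormedAddCommGroup X₁] [NormedSpace ℝ X₁]
    [NormedAddCommGroup X₂] [NormedSpace ℝ X₂] (d : X₁ ≃L[ℝ] X₁) (a : X₂ ≃L[ℝ] X₂) (rate : ℝ)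
    (h0 : 0 < rate) (h1 : rate < 1) (hd : ∀ w, ‖d w‖ ≤ rate * ‖w‖) (ha : ∀ u, ‖u‖ ≤ rate * ‖a u‖) :
    Module.finrank ℝ (LinearMap.range
      ((HypLin.ofProd d a rate h0 h1 hd ha).Ps : X₁ × X₂ →ₗ[ℝ] X₁ × X₂)) = Module.finrank ℝ X₁ := by
  have h : LinearMap.range ((HypLin.ofProd d a rate h0 h1 hd ha).Ps : X₁ × X₂ →ₗ[ℝ] X₁ × X₂)
      = LinearMap.range (LinearMap.inl ℝ X₁ X₂) :=
    LinearMap.range_comp_of_range_eq_top (LinearMap.inl ℝ X₁ X₂) (f := LinearMap.fst ℝ X₁ X₂)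
      (LinearMap.range_eq_top.2 LinearMap.fst_surjective)
  rw [h, LinearMap.finrank_range_of_inj LinearMap.inl_injective]

theorem EucDiffeo.exists_fderiv_eq_equiv {c : ℕ} {r : WithTop ℕ∞} (hr : 1 ≤ r) (φ : EucDiffeo c r)
    {p : Euc c} (hp : φ p = p) : ∃ L : Euc c ≃L[ℝ] Euc c, fderiv ℝ φ p = (L : Euc c →L[ℝ] Euc c) := by
  have h1 := EucDiffeo.fderiv_symm_comp hr φ p
  have h2 := EucDiffeo.fderiv_symm_comp hr φ.symm p
  have hp' : φ.symm p = p := (congrArg φ.symm hp.symm).trans (φ.symm_apply_apply p)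
  rw [hp] at h1
  rw [hp'] at h2
  exact ⟨ContinuousLinearEquiv.equivOfInverse (fderiv ℝ φ p) (fderiv ℝ φ.symm p)
    (fun v => DFunLike.congr_fun h1 v) (fun v => DFunLike.congr_fun h2 v), rfl⟩

/-- The separating rate cancels: `d` costs μ m and the inverse of `a` costs μ / m, and μ² ≤ μ. -/
theorem norm_arrowCongr_le {U W : Type*} [NormedAddCommGroup U] [NormedSpace ℝ U]
    [NormedAddCommGroup W] [NormedSpace ℝ W] {a : U ≃L[ℝ] U} {d : W ≃L[ℝ] W} {μ m : ℝ} (hμ0 : 0 < μ)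
    (hμ1 : μ < 1) (hm : 1 ≤ m) (hd : ∀ w, ‖d w‖ ≤ μ * m * ‖w‖) (ha : ∀ u, m * ‖u‖ ≤ μ * ‖a u‖)
    (K : U →L[ℝ] W) : ‖a.arrowCongr d K‖ ≤ μ * ‖K‖ := by
  refine ContinuousLinearMap.opNorm_le_bound _ (by positivity) fun u => ?_
  change ‖d (K (a.symm u))‖ ≤ _
  have h1 := ha (a.symm u)
  rw [ContinuousLinearEquiv.apply_symm_apply] at h1
  have h2 : μ * ‖u‖ ≤ ‖u‖ := mul_le_of_le_one_left (norm_nonneg _) hμ1.le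
  calc ‖d (K (a.symm u))‖ ≤ μ * m * (‖K‖ * ‖a.symm u‖) :=
        (hd _).trans (mul_le_mul_of_nonneg_left (K.le_opNorm _) (by positivity))
    _ = μ * ‖K‖ * (m * ‖a.symm u‖) := by ring
    _ ≤ μ * ‖K‖ * ‖u‖ := mul_le_mul_of_nonneg_left (h1.trans h2) (by positivity)

/-- Coordinates at a hyperbolic fixed point with a dominated splitting: `T` is adapted to the
hyperbolic splitting, and `S` to the strong unstable direction. -/
theorem IsHyperbolicDominated.exists_model {c ℓ : ℕ} (hℓ : 0 < ℓ) {L : Euc c ≃L[ℝ] Euc c}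
    {Es Ecu Euu : Submodule ℝ (Euc c)}
    (h : IsHyperbolicDominated (L : Euc c →L[ℝ] Euc c) Es Ecu Euu)
    (hdim : Module.finrank ℝ Euu = ℓ) :
    ∃ (k₁ k₂ : ℕ) (T : (Euc k₁ × Euc k₂) ≃L[ℝ] Euc c) (H : HypLin (Euc k₁ × Euc k₂))
      (S : Euc c ≃L[ℝ] Euc ℓ × Euc (c - ℓ)) (a : Euc ℓ ≃L[ℝ] Euc ℓ)
      (d : Euc (c - ℓ) ≃L[ℝ] Euc (c - ℓ)) (μ m : ℝ),
      Module.finrank ℝ (LinearMap.range (H.Ps : Euc k₁ × Euc k₂ →ₗ[ℝ] Euc k₁ × Euc k₂))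
        = Module.finrank ℝ Es ∧
      (∀ y, T (H.Λ y) = L (T y)) ∧ (∀ v, S (L v) = (a (S v).1, d (S v).2)) ∧
      (∀ v, v ∈ Euu ↔ (S v).2 = 0) ∧ (∀ K, ‖a.arrowCongr d K‖ ≤ H.rate * ‖K‖) ∧
      0 < μ ∧ μ < 1 ∧ 1 ≤ m ∧ (∀ w, ‖d w‖ ≤ μ * m * ‖w‖) ∧ (∀ u, m * ‖u‖ ≤ μ * ‖a u‖) := by
  obtain ⟨S₁, d₁, a₁, μ₁, hμ₁0, hμ₁1, hS₁, hd₁, ha₁⟩ := h.exists_coords_s_u rfl rfl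
  have hk : Module.finrank ℝ (Es ⊔ Ecu : Submodule ℝ (Euc c)) = c - ℓ := by
    have := Submodule.finrank_add_eq_of_isCompl h.isCompl_scu_uu
    rw [hdim, finrank_euclideanSpace_fin] at this
    omega
  obtain ⟨S₂, d, a, μ, m, hμ0, hμ1, hm, hS₂, hd, ha, hE⟩ := h.exists_coords_scu_uu hℓ hk hdim
  have h1 : μ₁ ≤ max μ₁ μ := le_max_left _ _
  have h2 : μ ≤ max μ₁ μ := le_max_right _ _
  -- Taking the larger of the two rates lets one rate govern both the base and the action on slopes.
  refine ⟨_, _, S₁.symm, HypLin.ofProd d₁ a₁ (max μ₁ μ) (lt_max_of_lt_left hμ₁0) (max_lt hμ₁1 hμ1)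
    (fun w => (hd₁ w).trans (mul_le_mul_of_nonneg_right h1 (norm_nonneg _)))
    (fun u => (ha₁ u).trans (mul_le_mul_of_nonneg_right h1 (norm_nonneg _))),
    S₂.trans (ContinuousLinearEquiv.prodComm ℝ _ _), a, d, μ, m, ?_, fun y => ?_, fun v => ?_,
    fun v => ?_, fun K => ?_, hμ0, hμ1, hm, hd, ha⟩
  · rw [HypLin.finrank_range_ofProd, finrank_euclideanSpace_fin]
  · apply S₁.injective
    rw [hS₁, ContinuousLinearEquiv.apply_symm_apply, ContinuousLinearEquiv.apply_symm_apply]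
    rfl
  · change Prod.swap (S₂ (L v)) = _
    rw [hS₂]
    rfl
  · exact hE v
  · exact (norm_arrowCongr_le hμ0 hμ1 hm hd ha K).trans
      (mul_le_mul_of_nonneg_right h2 (norm_nonneg _))

/-! ### The twisted family: dependence on the parameter and the unstable cone. -/

section Family

variable {c ℓ : ℕ} {r : WithTop ℕ∞} {φ : EucDiffeo c r}

theorem EucDiffeo.continuous_expTwistShift {B : Euc c →L[ℝ] Euc c}
    (hB : B ∈ skewAdjoint (Euc c →L[ℝ] Euc c)) (p s : Euc c) :
    Continuous (EucDiffeo.expTwistShift B hB p s) := by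
  have h1 : Continuous fun δ : ℝ => NormedSpace.exp (δ • B) p :=
    (contDiff_exp_smul (n := 0) B).continuous.clm_apply continuous_const
  exact (continuous_const.sub h1).add ((continuous_pow 2).smul continuous_const)

theorem EucDiffeo.affineTwist_exp_zero {B : Euc c →L[ℝ] Euc c}
    (hB : B ∈ skewAdjoint (Euc c →L[ℝ] Euc c)) (p s : Euc c) :
    φ.affineTwist (expIsometry B hB 0) (EucDiffeo.expTwistShift B hB p s 0) = φ := by
  have h : ∀ v, expIsometry B hB 0 v = v := fun v => DFunLike.congr_fun (exp_zero_smul B) v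
  refine Diffeomorph.ext fun x => ?_
  rw [EucDiffeo.affineTwist_apply, EucDiffeo.expTwistShift, h, h]
  simp

theorem isUnstableCone_twists (hr : 1 ≤ r) {ι : Type*} {S : Euc c ≃L[ℝ] Euc ℓ × Euc (c - ℓ)}
    {B : ι → Euc c →L[ℝ] Euc c} (hB : ∀ i, B i ∈ skewAdjoint (Euc c →L[ℝ] Euc c)) {δ : ℝ}
    (b : ι → Euc c) {V : Set (Euc c)} {N : Euc c ≃L[ℝ] Euc c} {θ : ℝ} (hθ : 1 < θ)
    (h : ∀ x ∈ V, ∀ i v, ‖(S v).2‖ ≤ ‖(S v).1‖ →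
      (v ≠ 0 → ‖(S ((NormedSpace.exp (δ • B i) ∘L fderiv ℝ φ x) v)).2‖
        < ‖(S ((NormedSpace.exp (δ • B i) ∘L fderiv ℝ φ x) v)).1‖) ∧
      θ * ‖N v‖ ≤ ‖N ((NormedSpace.exp (δ • B i) ∘L fderiv ℝ φ x) v)‖) :
    IsUnstableCone ℓ (φ.twists (fun i => expIsometry (B i) (hB i) δ) b) V
      {v | ‖(S v).2‖ ≤ ‖(S v).1‖} := by
  have hd : ∀ i x, fderiv ℝ (φ.twists (fun i => expIsometry (B i) (hB i) δ) b i) x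
      = NormedSpace.exp (δ • B i) ∘L fderiv ℝ φ x := fun i x =>
    EucDiffeo.fderiv_affineTwist hr φ _ _ x
  refine ⟨⟨S, rfl⟩, fun x hx i v hv hv0 => ?_, N, θ, hθ, fun x hx i v hv => ?_⟩
  · rw [hd]
    exact mem_interior_cone S ((h x hx i v hv).1 hv0)
  · rw [hd]
    exact (h x hx i v hv).2

theorem graphPlane_zero {S : Euc c ≃L[ℝ] Euc ℓ × Euc (c - ℓ)} {F : Submodule ℝ (Euc c)}
    (hF : ∀ v, v ∈ F ↔ (S v).2 = 0) (hdim : Module.finrank ℝ F = ℓ) :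
    graphPlane S 0 = ⟨F, hdim⟩ :=
  Subtype.ext (Submodule.ext fun v => mem_graphPlane.trans (hF v).symm)

theorem graphPlane_mem_conePlanes (S : Euc c ≃L[ℝ] Euc ℓ × Euc (c - ℓ))
    {K : Euc ℓ →L[ℝ] Euc (c - ℓ)} (hK : ‖K‖ ≤ 1) :
    graphPlane S K ∈ conePlanes ℓ {v | ‖(S v).2‖ ≤ ‖(S v).1‖} := by
  intro v hv
  have h : (S v).2 = K (S v).1 := mem_graphPlane.1 hv
  change ‖(S v).2‖ ≤ ‖(S v).1‖
  rw [h]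
  exact (K.le_opNorm _).trans (mul_le_of_le_one_left (norm_nonneg _) hK)

end Family

/-! ### Proof of the proposition. -/

theorem mainTheorem9 (c ℓ : ℕ) (hℓ : 0 < ℓ) (hℓc : ℓ < c) (r : WithTop ℕ∞) (hr : 2 ≤ r)
    (φ : EucDiffeo c r) (p : Euc c) (hp : φ p = p)
    (Es Ecu Euu : Submodule ℝ (Euc c))
    (hsplit : IsHyperbolicDominated (fderiv ℝ φ p) Es Ecu Euu)
    (hdim : Module.finrank ℝ Euu = ℓ) :
    ∃ C : Set (Euc c), IsCone ℓ C ∧ (∀ v ∈ Euu, v ≠ 0 → v ∈ interior C) ∧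
    ∃ d : ℕ, 2 ≤ d ∧
    ∃ (A : ℝ → Fin d → (Euc c ≃ₗᵢ[ℝ] Euc c)) (b : ℝ → Fin d → Euc c),
      (∀ i, ContinuousOn (fun ε => ((A ε i).toContinuousLinearEquiv : Euc c →L[ℝ] Euc c)) (Ici 0)) ∧
      (∀ i, ContinuousOn (fun ε => b ε i) (Ici 0)) ∧
      (∀ i, φ.twists (A 0) (b 0) i = φ) ∧
      ∀ ε > (0 : ℝ),
        (∀ i, IsLocallyBiLipschitz (EucDiffeo.hats ℓ (one_le_two.trans hr) (φ.twists (A ε) (b ε)) i)) ∧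
        (∃ (B : Set (Euc c)) (G : Set (Gr ℓ c)),
          IsOpen B ∧ Bornology.IsBounded B ∧ p ∈ B ∧
          IsOpen G ∧ (⟨Euu, hdim⟩ : Gr ℓ c) ∈ G ∧ G ⊆ conePlanes ℓ C ∧
          IsUnstableCone ℓ (φ.twists (A ε) (b ε)) B C ∧
          closure (B ×ˢ G) ⊆
            ⋃ i, EucDiffeo.hats ℓ (one_le_two.trans hr) (φ.twists (A ε) (b ε)) i '' (B ×ˢ G) ∧
          (Es ≠ ⊥ →
            (∃ D : Set (Euc c), IsCsBlendingRegion (id : Euc c → Euc c)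
              (fun i => (φ.twists (A ε) (b ε) i).toEquiv) B D (Module.finrank ℝ Es)) ∧
            IsTangency ℓ (one_le_two.trans hr) (φ.twists (A ε) (b ε)) B C (B ×ˢ G))) ∧
        (∀ κ : ℝ, IsPHS κ (fun _ : Fin d => φ.toEquiv) →
          IsPHS κ (fun i => (φ.twists (A ε) (b ε) i).toEquiv)) ∧
        ((∃ κ : ℝ, IsPHS κ (fun _ : Fin d => φ.toEquiv)) →
          (∃ K : ℝ≥0, LipschitzWith K (fderiv ℝ φ) ∧ LipschitzWith K (fderiv ℝ φ.symm)) →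
          ∃ κ : ℝ, IsPHS κ (EucDiffeo.hats ℓ (one_le_two.trans hr) (φ.twists (A ε) (b ε)))) := by
  have hr1 : 1 ≤ r := one_le_two.trans hr
  obtain ⟨L, hL⟩ := EucDiffeo.exists_fderiv_eq_equiv hr1 φ hp
  rw [hL] at hsplit
  obtain ⟨k₁, k₂, T, H, S, a, d, μ, m, hEs, hT, hS, hE, hA, hμ0, hμ1, hm, hd, ha⟩ :=
    hsplit.exists_model hℓ hdim
  obtain ⟨ηc, hηc, N, θ, hθ, hcone⟩ := exists_cone_bounds hℓc.le S hμ0 hμ1 hm hd ha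
  have : Nonempty (Fin c) := ⟨⟨0, by omega⟩⟩
  have : Nontrivial (Euc k₁ × Euc k₂) := T.symm.injective.nontrivial
  obtain ⟨n, v, η, R, τ, hn, hη, hR, hfam⟩ :=
    (H.prodContraction (a.arrowCongr d) hA).exists_covering_family
  -- Each translation of the model splits in two: its slope part is produced by a rotation
  -- generator, its position part by the shift of the twist.
  choose B hB hBv using fun i => exists_skewAdjoint S hE (v i).2
  have hev := (eventually_all.2 fun i => (eventually_twistModel hr hp hL hS H hT hA (v i) (hBv i) hη R).and
    (eventually_cone_twist (T := T) hr hL hS (B i) hηc 1))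
  obtain ⟨δ₁, hδ₁, hδ₁'⟩ := mem_nhdsGT_iff_exists_Ioc_subset.1 hev
  have hδ₁ : 0 < δ₁ := hδ₁
  -- The estimates hold for all δ in (0, δ₁], so capping handles every ε > 0 and preserves
  -- continuity and the value 0 at 0. The cap 1 keeps the planes of `G` inside the cone.
  let σ : ℝ → ℝ := fun ε => min ε (min δ₁ 1)
  have hσc : Continuous σ := continuous_id.min continuous_const
  have hσ0 : σ 0 = 0 := min_eq_left (lt_min hδ₁ one_pos).le
  refine ⟨{v | ‖(S v).2‖ ≤ ‖(S v).1‖}, ⟨S, rfl⟩, fun w hw hw0 => mem_interior_cone S ?_, n, hn,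
    fun ε i => expIsometry (B i) (hB i) (σ ε),
    fun ε i => EucDiffeo.expTwistShift (B i) (hB i) p (T (v i).1) (σ ε), fun i => ?_, fun i => ?_,
    fun i => ?_, fun ε hε => ?_⟩
  · rw [(hE w).1 hw, norm_zero, norm_pos_iff]
    exact fun h0 => hw0 (S.injective (by rw [map_zero]; exact Prod.ext h0 ((hE w).1 hw)))
  · exact ((contDiff_exp_smul (n := 0) (B i)).continuous.comp hσc).continuousOn
  · exact ((EucDiffeo.continuous_expTwistShift (hB i) p _).comp hσc).continuousOn
  · change φ.affineTwist (expIsometry (B i) (hB i) (σ 0))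
      (EucDiffeo.expTwistShift (B i) (hB i) p (T (v i).1) (σ 0)) = φ
    rw [hσ0]
    exact EucDiffeo.affineTwist_exp_zero (hB i) p _
  have hδ : 0 < σ ε := lt_min hε (lt_min hδ₁ one_pos)
  have hδ1 : σ ε ≤ 1 := (min_le_right _ _).trans (min_le_right _ _)
  have hP := hδ₁' ⟨hδ, (min_le_right ε _).trans (min_le_left _ _)⟩
  set δ := σ ε
  have hP : ∀ i, _ := hP
  obtain ⟨hnear, hcov⟩ := hfam (fun i => twistModel φ p T S (B i) (v i).1 δ)
    (fun i => fderiv ℝ (twistModel φ p T S (B i) (v i).1 δ))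
    (fun i x hx => ((hP i).1.2 x hx).1.1.hasFDerivAt) (fun i x hx => ((hP i).1.2 x hx).1.2)
    (fun i => (hP i).1.1)
  obtain ⟨hcover, hblend⟩ := isCsBlendingRegion_twists hr (by omega) hB hδ hR hnear hcov
    (fun i x hx => ((hP i).1.2 x hx).2) rfl rfl rfl
  set ψ := φ.twists (fun i => expIsometry (B i) (hB i) δ)
    fun i => EucDiffeo.expTwistShift (B i) (hB i) p (T (v i).1) δ
  set V := (fun y => p + δ ^ 2 • T y) '' Metric.ball 0 1
  set G := (fun K => graphPlane S (δ • K)) '' Metric.ball 0 1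
  have hchart := isEmbChart_affine T p (pow_ne_zero 2 hδ.ne')
  have hunst : IsUnstableCone ℓ ψ V {v | ‖(S v).2‖ ≤ ‖(S v).1‖} := by
    refine isUnstableCone_twists (N := N) hr1 hB _ hθ ?_
    rintro _ ⟨y, hy, rfl⟩ i
    have h1 := (hP i).2 y (by simpa using (mem_ball_zero_iff.1 hy).le)
    rw [map_smul] at h1
    exact hcone _ h1
  have hGC : G ⊆ conePlanes ℓ {v | ‖(S v).2‖ ≤ ‖(S v).1‖} := by
    rintro _ ⟨K, hK, rfl⟩
    refine graphPlane_mem_conePlanes S ?_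
    rw [norm_smul, Real.norm_of_nonneg hδ.le]
    exact mul_le_one₀ hδ1 (norm_nonneg _) (mem_ball_zero_iff.1 hK).le
  refine ⟨fun i => EucDiffeo.isLocallyBiLipschitz_hat hr _, ⟨V, G,
    hchart.isOpenEmbedding.isOpenMap _ Metric.isOpen_ball, ?_, ⟨0, by simp, by simp⟩,
    isOpen_graphPlane_image S hδ.ne', ⟨0, by simp,
      (congrArg (graphPlane S) (smul_zero δ)).trans (graphPlane_zero hE hdim)⟩, hGC, hunst,
    hcover, fun hEs0 => ?_⟩, fun κ hκ => EucDiffeo.isPHS_twists φ _ _ hκ, fun h1 h2 => ?_⟩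
  · exact ((isCompact_closedBall _ _).image hchart.isOpenEmbedding.continuous).isBounded.subset
      (image_mono Metric.ball_subset_closedBall)
  · have hpos : 0 < Module.finrank ℝ Es := Submodule.one_le_finrank_iff.2 hEs0
    rw [hEs] at hblend
    exact ⟨(hblend hpos).1, hunst, prod_mono_right hGC, (hblend hpos).2⟩
  · have : NeZero n := ⟨by omega⟩
    exact EucDiffeo.exists_isPHS_hats hr1 φ _ _ h1 h2

end
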